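/- Notation. $\mathfrak{so}(n)$ denotes the real skew-symmetric $n\times n$ matrices and $\mathfrak{su}(n)$ the trace-free skew-Hermitian complex $n\times n$ matrices. A scalar product on $\mathfrak{so}(n)$ (resp. $\mathfrak{su}(n)$) is called $\mathrm{Ad}$-invariant if it is invariant under $X\mapsto AXA^{-1}$ for all $A\in\mathrm{SO}(n)$ (resp. $A\in\mathrm{SU}(n)$). Let $V$ be a two-dimensional Euclidean space with orthonormal basis $Z_1,Z_2$ and let $\mathfrak m=\mathfrak{so}(m)$ or $\mathfrak{su}(m)$. An *isospectral family* $j(t):V\to\mathfrak m$, $t\in(-\varepsilon,\varepsilon)$, is a continuous family of linear maps, written $z\mapsto j_z(t)$, such that 1. for all $s,t\in(-\varepsilon,\varepsilon)$ and every $z\in V$ there is $A\in \mathrm{O}(m)$ (resp. $A\in\mathrm{SU}(m)$) with $j_z(t)=A\,j_z(s)\,A^{-1}$; 2. the function $t\mapsto \operatorname{tr}\big((j_{Z_1}(t)^2+j_{Z_2}(t)^2)^2\big)$ is not constant in any interval around $0$. Let $\mathfrak g$ be a Lie algebra with a scalar product $g_0$, let $\mathfrak h\subset\mathfrak g$ be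 a two-dimensional subspace with the induced scalar product, and let $j:\mathfrak h\to\mathfrak g$ be linear. Let $\lambda:\mathfrak g\to\mathfrak h\subset\mathfrak g$ be the transpose of $j$, i.e. $g_0(\lambda(X),Z)=g_0(X,j_Z)$ for $X\in\mathfrak g$, $Z\in\mathfrak h$. On a Lie group $G$ with Lie algebra $\mathfrak g$, let $g_\lambda$ be the left invariant Riemannian metric given by the scalar product $(\mathrm{Id}+\lambda)^*g_0$ on $\mathfrak g$. Proposition. Let $g_{\lambda(t)}$, $t\in(-\varepsilon,\varepsilon)$, be a family of left invariant metrics on a Lie group $G$ of one of the following types, where $\lambda(t)$ is the transpose of $j(t)$. (a) $\mathfrak g=\mathfrak{so}(m)\oplus\mathfrak h$ with $m\ge5$ and $\mathfrak h$ abelian and two-dimensional (e.g. $G=\mathrm{SO}(m)\times T^2$ or $\mathrm{Spin}(m)\times T^2$); $g_0$ is the orthogonal sum of an $\mathrm{Ad}$-invariant scalar product on $\mathfrak{so}(m)$ and any scalar product on $\mathfrak h$; $j(t):\mathfrak h\to\mathfrak{so}(m)$ is an isospectral family. (b) The same with $\mathfrak{su}(m)$, $m\ge3$, in place of $\mathfrak{so}(m)$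 (e.g. $G=\mathrm{SU}(m)\times T^2$). (c) $\mathfrak g=\mathfrak{so}(m+4)$ with $m\ge5$ (e.g. $G=\mathrm{SO}(m+4)$ or $\mathrm{Spin}(m+4)$); $g_0$ is $\mathrm{Ad}$-invariant; $\mathfrak h$ is the Lie algebra of a maximal torus of $\mathrm{SO}(4)$, where $\mathfrak{so}(m)\oplus\mathfrak{so}(4)\subset\mathfrak{so}(m+4)$ is embedded block-diagonally; $j(t):\mathfrak h\to\mathfrak{so}(m)$ is an isospectral family. (d) $\mathfrak g=\mathfrak{su}(m+3)$ with $m\ge3$ (e.g. $G=\mathrm{SU}(m+3)$); $g_0$ is $\mathrm{Ad}$-invariant; $\mathfrak h$ is the Lie algebra of a maximal torus of $\mathrm{SU}(3)$, where $\mathfrak{su}(m)\oplus\mathfrak{su}(3)\subset\mathfrak{su}(m+3)$ is embedded block-diagonally; $j(t):\mathfrak h\to\mathfrak{su}(m)$ is an isospectral family. (e) $\mathfrak g=\mathfrak{so}(2m+2)$ with $m\ge3$ (e.g. $G=\mathrm{SO}(2m+2)$ or $\mathrm{Spin}(2m+2)$); $g_0$ is $\mathrm{Ad}$-invariant; $\mathfrak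 h=\mathbb R J\oplus\mathfrak{so}(2)$ in the block-diagonal subalgebra $\mathfrak{so}(2m)\oplus\mathfrak{so}(2)$, where $J=\begin{pmatrix}0&-I\\ I&0\end{pmatrix}$; and $j(t)=\phi\circ\widehat\jmath(t)$, where $\widehat\jmath(t):\mathfrak h\to\mathfrak{su}(m)$ is an isospectral family and $\phi:\mathfrak{su}(m)\to\mathfrak{so}(2m)$, $P+iQ\mapsto\begin{pmatrix}P&-Q\\ Q&P\end{pmatrix}$ ($P,Q$ real). Then for each $t$ the function $\|\mathrm{Ric}^{\lambda(t)}\|^2_{\lambda(t)}$ is constant on $G$, and this constant is nonconstant in $t\in(-\varepsilon,\varepsilon)$. If it takes different values at $s$ and $t$, then no nonempty open subset of $(G,g_{\lambda(s)})$ is isometric to an open subset of $(G,g_{\lambda(t)})$; hence the metrics $g_{\lambda(t)}$ are not pairwise locally isometric. -/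

import Mathlib

open scoped Manifold ContDiff Matrix

-- Matrices carry the commutator bracket.
attribute [local instance 100] LieRing.ofAssociativeRing

/-- Smooth Lie groups have the regularity which Mathlib asks for to define their Lie algebra. -/
instance leInfty_minSmoothness_three : ENat.LEInfty (minSmoothness ℝ 3) :=
  ⟨by rw [minSmoothness_of_isRCLikeNormedField]; exact ENat.LEInfty.out⟩

noncomputable section

/-! ## Riemannian geometry: Levi-Civita connection, curvature, norm of the Ricci tensor -/

section Riemannian

variable {E : Type*} [NormedAddCommGroup E] [NormedSpace ℝ E]
  {H : Type*} [TopologicalSpace H] (I : ModelWithCorners ℝ E H)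
  {M : Type*} [TopologicalSpace M] [ChartedSpace H M]

variable (M) in
/-- A field of bilinear forms on the tangent spaces of `M`. -/
abbrev MetricTensor : Type _ := ∀ p : M, LinearMap.BilinForm ℝ (TangentSpace I p)

/-- The right-hand side of the Koszul formula,
`X⟨Y,Z⟩ + Y⟨Z,X⟩ - Z⟨X,Y⟩ + ⟨[X,Y],Z⟩ - ⟨[Y,Z],X⟩ + ⟨[Z,X],Y⟩`, at the point `p`. -/
def koszul (g : MetricTensor I M) (X Y Z : ∀ p : M, TangentSpace I p) (p : M) : ℝ :=
  mvfderiv I (fun q => g q (Y q) (Z q)) p (X p)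
    + mvfderiv I (fun q => g q (Z q) (X q)) p (Y p)
    - mvfderiv I (fun q => g q (X q) (Y q)) p (Z p)
    + g p (VectorField.mlieBracket I X Y p) (Z p)
    - g p (VectorField.mlieBracket I Y Z p) (X p)
    + g p (VectorField.mlieBracket I Z X p) (Y p)

open Classical in
/-- The Levi-Civita covariant derivative `(∇_X Y)(p)`: the vector `v` at `p` with
`2 ⟨v, Z⟩ = koszul X Y Z` at `p` for all vector fields `Z` differentiable at `p`. For a Riemannian
metric and differentiable `X`, `Y` there is exactly one such `v`. -/
def leviCivita [IsManifold I 1 M] (g : MetricTensor I M) (X Y : ∀ p : M, TangentSpace I p) (p : M) :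
    TangentSpace I p :=
  if h : ∃ v : TangentSpace I p, ∀ Z : ∀ q : M, TangentSpace I q,
      MDifferentiableAt I I.tangent (fun q => (⟨q, Z q⟩ : TangentBundle I M)) p →
        2 * g p v (Z p) = koszul I g X Y Z p
  then h.choose else 0

/-- `R(X,Y)Z = ∇_X ∇_Y Z - ∇_Y ∇_X Z - ∇_{[X,Y]} Z`. -/
def curvature [IsManifold I 1 M] (g : MetricTensor I M) (X Y Z : ∀ p : M, TangentSpace I p) (p : M) :
    TangentSpace I p :=
  leviCivita I g X (leviCivita I g Y Z) p - leviCivita I g Y (leviCivita I g X Z) p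
    - leviCivita I g (VectorField.mlieBracket I X Y) Z p

/-- The curvature tensor at `p` on tangent vectors. The value of `R(X,Y)Z` at `p` depends only on
the values of the smooth fields `X`, `Y`, `Z` at `p`; here the vectors are extended to vector fields
which are constant in the trivialization of the tangent bundle around `p`. -/
def curvatureAt [IsManifold I 1 M] (g : MetricTensor I M) (p : M) (u v w : TangentSpace I p) :
    TangentSpace I p :=
  curvature I g (FiberBundle.extend E u) (FiberBundle.extend E v) (FiberBundle.extend E w) p

/-- `e` is an orthonormal family for the bilinear form `B`. -/
def OrthonormalFor {V ι : Type*} [AddCommGroup V] [Module ℝ V] [DecidableEq ι]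
    (B : LinearMap.BilinForm ℝ V) (e : ι → V) : Prop :=
  ∀ i j, B (e i) (e j) = if i = j then 1 else 0

/-- `Ric(u,v)`, the trace of `w ↦ R(w,u)v`, computed in the orthonormal basis `e`. -/
def ricciAt [IsManifold I 1 M] (g : MetricTensor I M) (p : M) {ι : Type*} [Fintype ι]
    (e : ι → TangentSpace I p) (u v : TangentSpace I p) : ℝ :=
  ∑ k, g p (curvatureAt I g p (e k) u v) (e k)

open Classical in
/-- `‖Ric‖²` at `p`: the sum of the squares of the entries of the Ricci tensor in an orthonormal
basis of the tangent space (the result does not depend on that basis). -/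
def ricciNormSq [IsManifold I 1 M] (g : MetricTensor I M) (p : M) : ℝ :=
  if h : ∃ e : Module.Basis (Fin (Module.finrank ℝ E)) ℝ (TangentSpace I p),
      OrthonormalFor (g p) e
  then ∑ i, ∑ j, (ricciAt I g p h.choose (h.choose i) (h.choose j)) ^ 2
  else 0

/-- Some nonempty open subset of `(M, g)` is isometric to an open subset of `(M', g')`. -/
def SomewhereLocallyIsometric {M' : Type*} [TopologicalSpace M'] [ChartedSpace H M']
    (g : MetricTensor I M) (g' : MetricTensor I M') : Prop :=
  ∃ Φ : OpenPartialHomeomorph M M', Φ.source.Nonempty ∧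
    ContMDiffOn I I ∞ Φ Φ.source ∧ ContMDiffOn I I ∞ Φ.symm Φ.target ∧
    ∀ x ∈ Φ.source, ∀ u v : TangentSpace I x,
      g' (Φ x) (mfderiv I I Φ x u) (mfderiv I I Φ x v) = g x u v

end Riemannian

/-! ## Left invariant metrics -/

section LeftInvariant

variable {E : Type*} [NormedAddCommGroup E] [NormedSpace ℝ E]
  {H : Type*} [TopologicalSpace H] (I : ModelWithCorners ℝ E H)
  {G : Type*} [TopologicalSpace G] [ChartedSpace H G] [Group G]

/-- The differential at `x` of the left translation by `x⁻¹`, which maps the tangent space at `x` to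
the tangent space at `x⁻¹ * x = 1`. -/
def leftTranslateToOne (x : G) : TangentSpace I x →ₗ[ℝ] GroupLieAlgebra I G :=
  (mfderiv I I (fun y : G => x⁻¹ * y) x).toLinearMap

/-- The left invariant field of bilinear forms on `G` with the value `B` at the identity. -/
def leftInvariantMetric (B : LinearMap.BilinForm ℝ (GroupLieAlgebra I G)) : MetricTensor I G :=
  fun x => B.comp (leftTranslateToOne I x) (leftTranslateToOne I x)

variable [LieGroup I ∞ G]

/-- The left invariant metric on `G` given by a scalar product `B` on a Lie algebra `L` which is
identified with the Lie algebra of `G`. -/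
def metricOfForm [CompleteSpace E] {L : Type*} [LieRing L] [LieAlgebra ℝ L]
    (e : L ≃ₗ⁅ℝ⁆ GroupLieAlgebra I G) (B : LinearMap.BilinForm ℝ L) : MetricTensor I G :=
  leftInvariantMetric I (B.comp (e.symm : GroupLieAlgebra I G →ₗ[ℝ] L)
    (e.symm : GroupLieAlgebra I G →ₗ[ℝ] L))

/-- For the metrics `g t`, `-ε < t < ε`: `‖Ric‖²` is, for each `t`, a constant function on the
manifold; this constant is nonconstant in `t`; and metrics for which the constants differ are not
locally isometric. -/
def RicciNormVaries (ε : ℝ) (g : ℝ → MetricTensor I G) : Prop :=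
  ∃ c : ℝ → ℝ,
    (∀ t ∈ Set.Ioo (-ε) ε, ∀ p : G, ricciNormSq I (g t) p = c t) ∧
    (∃ s ∈ Set.Ioo (-ε) ε, ∃ t ∈ Set.Ioo (-ε) ε, c s ≠ c t) ∧
    (∀ s ∈ Set.Ioo (-ε) ε, ∀ t ∈ Set.Ioo (-ε) ε, c s ≠ c t →
      ¬ SomewhereLocallyIsometric I (g s) (g t))

end LeftInvariant

/-! ## Scalar products and the forms `(Id + λ)^* g₀` -/

section Forms

/-- `B` is a scalar product. -/
def IsScalarProduct {V : Type*} [AddCommGroup V] [Module ℝ V] (B : LinearMap.BilinForm ℝ V) :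
    Prop :=
  (∀ x y, B x y = B y x) ∧ ∀ x, x ≠ 0 → 0 < B x x

/-- The orthogonal sum of two bilinear forms. -/
def formProd {V W : Type*} [AddCommGroup V] [Module ℝ V] [AddCommGroup W] [Module ℝ W]
    (B : LinearMap.BilinForm ℝ V) (C : LinearMap.BilinForm ℝ W) :
    LinearMap.BilinForm ℝ (V × W) :=
  B.comp (LinearMap.fst ℝ V W) (LinearMap.fst ℝ V W)
    + C.comp (LinearMap.snd ℝ V W) (LinearMap.snd ℝ V W)

variable {L V : Type*} [AddCommGroup L] [Module ℝ L] [AddCommGroup V] [Module ℝ V]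

/-- The transpose `λ : L → V ⊆ L` of `j : V → L`, where `V` is embedded in `L` by `inc` and `Z` is an
orthonormal basis of `V`: `λ(x) = ∑ᵢ ⟨x, j Zᵢ⟩ Zᵢ`. -/
def transposeMap (B : LinearMap.BilinForm ℝ L) (inc : V →ₗ[ℝ] L) (Z : Fin 2 → V)
    (j : V →ₗ[ℝ] L) : L →ₗ[ℝ] L :=
  ∑ i, (B.flip (j (Z i))).smulRight (inc (Z i))

/-- The defining property of the transpose: `⟨λ(x), z⟩ = ⟨x, j z⟩` for `z ∈ V`. -/
theorem transposeMap_spec (B : LinearMap.BilinForm ℝ L) (inc : V →ₗ[ℝ] L)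
    (Z : Module.Basis (Fin 2) ℝ V) (hZ : OrthonormalFor (B.comp inc inc) Z)
    (j : V →ₗ[ℝ] L) (x : L) (z : V) :
    B (transposeMap B inc Z j x) (inc z) = B x (j z) := by
  have hZ' : ∀ i k, B (inc (Z i)) (inc (Z k)) = if i = k then 1 else 0 := hZ
  have h : ∀ k, B (transposeMap B inc Z j x) (inc (Z k)) = B x (j (Z k)) := by
    intro k
    fin_cases k <;> simp [transposeMap, hZ']
  have key : (B (transposeMap B inc Z j x)).comp inc = (B x).comp j := Z.ext h
  exact LinearMap.congr_fun key z

/-- The scalar product `(Id + λ)^* B` for `λ` the transpose of `j`. -/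
def deformedForm (B : LinearMap.BilinForm ℝ L) (inc : V →ₗ[ℝ] L) (Z : Fin 2 → V)
    (j : V →ₗ[ℝ] L) : LinearMap.BilinForm ℝ L :=
  B.comp (LinearMap.id + transposeMap B inc Z j) (LinearMap.id + transposeMap B inc Z j)

end Forms

/-! ## The matrix Lie algebras -/

section MatrixAlgebras

variable (ι κ : Type*) [Fintype ι] [DecidableEq ι] [Fintype κ] [DecidableEq κ]

/-- The real Lie algebra `𝔰𝔬` of skew-symmetric real matrices. -/
abbrev soLie : LieSubalgebra ℝ (Matrix ι ι ℝ) := LieAlgebra.Orthogonal.so ι ℝ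

/-- The real Lie algebra `𝔰𝔲` of trace-free skew-Hermitian complex matrices. -/
def suLie : LieSubalgebra ℝ (Matrix ι ι ℂ) where
  carrier := {X | Xᴴ = -X ∧ X.trace = 0}
  zero_mem' := by simp
  add_mem' := by
    rintro X Y ⟨hX, hX'⟩ ⟨hY, hY'⟩
    exact ⟨by rw [Matrix.conjTranspose_add, hX, hY, neg_add], by simp [hX', hY']⟩
  smul_mem' := by
    rintro c X ⟨hX, hX'⟩
    exact ⟨by rw [Matrix.conjTranspose_smul, hX]; simp, by simp [hX']⟩
  lie_mem' := by
    rintro X Y ⟨hX, _⟩ ⟨hY, _⟩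
    refine ⟨?_, ?_⟩
    · rw [Ring.lie_def, Matrix.conjTranspose_sub, Matrix.conjTranspose_mul,
        Matrix.conjTranspose_mul, hX, hY]
      simp
    · rw [Ring.lie_def, Matrix.trace_sub, Matrix.trace_mul_comm, sub_self]

variable {ι κ}

theorem mem_suLie {X : Matrix ι ι ℂ} : X ∈ suLie ι ↔ Xᴴ = -X ∧ X.trace = 0 := Iff.rfl

variable (ι κ)

/-- `X ↦ diag(X, 0)` as a map `𝔰𝔬(ι) → 𝔰𝔬(ι ⊕ κ)`. -/
def soUpper : soLie ι →ₗ[ℝ] soLie (ι ⊕ κ) where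
  toFun X := ⟨Matrix.fromBlocks (X : Matrix ι ι ℝ) 0 0 0, by
    have h := (LieAlgebra.Orthogonal.mem_so ι ℝ _).1 X.2
    rw [LieAlgebra.Orthogonal.mem_so, Matrix.fromBlocks_transpose, h, Matrix.fromBlocks_neg]
    simp⟩
  map_add' X Y := by ext1; simp [Matrix.fromBlocks_add]
  map_smul' c X := by ext1; simp [Matrix.fromBlocks_smul]

/-- `Y ↦ diag(0, Y)` as a map `𝔰𝔬(κ) → 𝔰𝔬(ι ⊕ κ)`. -/
def soLower : soLie κ →ₗ[ℝ] soLie (ι ⊕ κ) where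
  toFun Y := ⟨Matrix.fromBlocks 0 0 0 (Y : Matrix κ κ ℝ), by
    have h := (LieAlgebra.Orthogonal.mem_so κ ℝ _).1 Y.2
    rw [LieAlgebra.Orthogonal.mem_so, Matrix.fromBlocks_transpose, h, Matrix.fromBlocks_neg]
    simp⟩
  map_add' X Y := by ext1; simp [Matrix.fromBlocks_add]
  map_smul' c X := by ext1; simp [Matrix.fromBlocks_smul]

/-- `X ↦ diag(X, 0)` as a map `𝔰𝔲(ι) → 𝔰𝔲(ι ⊕ κ)`. -/
def suUpper : suLie ι →ₗ[ℝ] suLie (ι ⊕ κ) where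
  toFun X := ⟨Matrix.fromBlocks (X : Matrix ι ι ℂ) 0 0 0, by
    obtain ⟨h, h'⟩ := mem_suLie.1 X.2
    rw [mem_suLie, Matrix.fromBlocks_conjTranspose, h, Matrix.fromBlocks_neg]
    refine ⟨by simp, ?_⟩
    simpa [Matrix.trace, Fintype.sum_sum_type] using h'⟩
  map_add' X Y := by ext1; simp [Matrix.fromBlocks_add]
  map_smul' c X := by ext1; simp [Matrix.fromBlocks_smul]

/-- `Y ↦ diag(0, Y)` as a map `𝔰𝔲(κ) → 𝔰𝔲(ι ⊕ κ)`. -/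
def suLower : suLie κ →ₗ[ℝ] suLie (ι ⊕ κ) where
  toFun Y := ⟨Matrix.fromBlocks 0 0 0 (Y : Matrix κ κ ℂ), by
    obtain ⟨h, h'⟩ := mem_suLie.1 Y.2
    rw [mem_suLie, Matrix.fromBlocks_conjTranspose, h, Matrix.fromBlocks_neg]
    refine ⟨by simp, ?_⟩
    simpa [Matrix.trace, Fintype.sum_sum_type] using h'⟩
  map_add' X Y := by ext1; simp [Matrix.fromBlocks_add]
  map_smul' c X := by ext1; simp [Matrix.fromBlocks_smul]

variable {κ} in
/-- The inclusion of a subalgebra `𝔥 ⊆ 𝔰𝔬(κ)` into `𝔰𝔬(ι ⊕ κ)`. -/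
def soLowerOf (𝔥 : LieSubalgebra ℝ (soLie κ)) : 𝔥 →ₗ[ℝ] soLie (ι ⊕ κ) :=
  soLower ι κ ∘ₗ 𝔥.toSubmodule.subtype

variable {κ} in
/-- The inclusion of a subalgebra `𝔥 ⊆ 𝔰𝔲(κ)` into `𝔰𝔲(ι ⊕ κ)`. -/
def suLowerOf (𝔥 : LieSubalgebra ℝ (suLie κ)) : 𝔥 →ₗ[ℝ] suLie (ι ⊕ κ) :=
  suLower ι κ ∘ₗ 𝔥.toSubmodule.subtype

/-- The embedding `φ : 𝔰𝔲(m) → 𝔰𝔬(2m)` which comes from `ℂ^m ≅ ℝ^(2m)`, where `e_k` and `i e_k` are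
sent to `e_k` and `e_(m+k)`. -/
def realify : suLie ι →ₗ[ℝ] soLie (ι ⊕ ι) where
  toFun X := ⟨Matrix.fromBlocks ((X : Matrix ι ι ℂ).map Complex.re)
      (-(X : Matrix ι ι ℂ).map Complex.im) ((X : Matrix ι ι ℂ).map Complex.im)
      ((X : Matrix ι ι ℂ).map Complex.re), by
    have h := (mem_suLie.1 X.2).1
    have hk : ∀ a b, star ((X : Matrix ι ι ℂ) b a) = -(X : Matrix ι ι ℂ) a b := fun a b => by
      simpa using congrFun (congrFun h a) b
    have hre : ∀ a b, ((X : Matrix ι ι ℂ) b a).re = -((X : Matrix ι ι ℂ) a b).re := fun a b => by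
      simpa using congrArg Complex.re (hk a b)
    have him : ∀ a b, ((X : Matrix ι ι ℂ) b a).im = ((X : Matrix ι ι ℂ) a b).im := fun a b => by
      simpa using congrArg Complex.im (hk a b)
    rw [LieAlgebra.Orthogonal.mem_so, Matrix.fromBlocks_transpose, Matrix.fromBlocks_neg]
    congr 1 <;> ext a b <;> first | simpa using hre a b | simpa using him a b⟩
  map_add' X Y := by
    refine Subtype.ext ?_
    change Matrix.fromBlocks _ _ _ _ = Matrix.fromBlocks _ _ _ _ + Matrix.fromBlocks _ _ _ _
    rw [Matrix.fromBlocks_add]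
    congr 1 <;> ext a b <;>
      first
      | exact Complex.add_re _ _
      | exact Complex.add_im _ _
      | exact (congrArg Neg.neg (Complex.add_im _ _)).trans (neg_add _ _)
  map_smul' c X := by
    refine Subtype.ext ?_
    change Matrix.fromBlocks _ _ _ _ = c • Matrix.fromBlocks _ _ _ _
    rw [Matrix.fromBlocks_smul]
    congr 1 <;> ext a b <;>
      first
      | exact Complex.smul_re _ _
      | exact Complex.smul_im _ _
      | exact (congrArg Neg.neg (Complex.smul_im _ _)).trans (smul_neg _ _).symm

/-- The complex structure `J = (0, -1; 1, 0)` as an element of `𝔰𝔬(2m)`. -/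
def complexStructure : soLie (ι ⊕ ι) :=
  ⟨Matrix.fromBlocks 0 (-1) 1 0, by
    rw [LieAlgebra.Orthogonal.mem_so, Matrix.fromBlocks_transpose, Matrix.fromBlocks_neg]
    simp⟩

/-- The Lie algebra `ℝ J ⊕ 𝔰𝔬(2) ⊆ 𝔰𝔬(2m + 2)` of the two-dimensional torus
`exp(ℝ J) × SO(2) ⊆ SO(2m + 2)`. -/
def torusJ : Submodule ℝ (soLie ((ι ⊕ ι) ⊕ Fin 2)) :=
  Submodule.span ℝ {soUpper (ι ⊕ ι) (Fin 2) (complexStructure ι)}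
    ⊔ LinearMap.range (soLower (ι ⊕ ι) (Fin 2))

end MatrixAlgebras

/-! ## Bi-invariant scalar products and isospectral families of linear maps -/

section Isospectral

variable {ι 𝕜 : Type*} [Fintype ι] [DecidableEq ι] [RCLike 𝕜]

/-- The form `B` on a matrix Lie algebra `𝔪` is invariant under `Ad_A : X ↦ A X A⁻¹` for all `A` in
the group `K` of unitary matrices, where `A⁻¹ = A*`. -/
def AdInvariant (𝔪 : LieSubalgebra ℝ (Matrix ι ι 𝕜)) (K : Submonoid (Matrix ι ι 𝕜))
    (B : LinearMap.BilinForm ℝ 𝔪) : Prop :=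
  ∀ A ∈ K, ∀ X Y X' Y' : 𝔪,
    (X' : Matrix ι ι 𝕜) = A * (X : Matrix ι ι 𝕜) * star A →
    (Y' : Matrix ι ι 𝕜) = A * (Y : Matrix ι ι 𝕜) * star A → B X' Y' = B X Y

/-- `tr((j_{Z₁}² + j_{Z₂}²)²)`. -/
def quarticTrace {V : Type*} [AddCommGroup V] [Module ℝ V]
    {𝔪 : LieSubalgebra ℝ (Matrix ι ι 𝕜)} (Z : Fin 2 → V) (j : V →ₗ[ℝ] 𝔪) : 𝕜 :=
  Matrix.trace (((j (Z 0) : Matrix ι ι 𝕜) ^ 2 + (j (Z 1) : Matrix ι ι 𝕜) ^ 2) ^ 2)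

/-- A continuous family `j(t)`, `-ε < t < ε`, of linear maps from `V` to the matrix Lie algebra `𝔪`
which are pairwise isospectral (for every `z` the matrices `j_z(s)` and `j_z(t)` are conjugate by a
matrix from the group `K` of unitary matrices) and for which `tr((j_{Z₁}(t)² + j_{Z₂}(t)²)²)` is not
constant in any interval around zero. -/
structure IsIsospectralFamily {V : Type*} [AddCommGroup V] [Module ℝ V]
    (𝔪 : LieSubalgebra ℝ (Matrix ι ι 𝕜)) (K : Submonoid (Matrix ι ι 𝕜)) (Z : Fin 2 → V)
    (ε : ℝ) (j : ℝ → V →ₗ[ℝ] 𝔪) : Prop where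
  pos : 0 < ε
  continuous : ∀ z : V, ContinuousOn (fun t => (j t z : Matrix ι ι 𝕜)) (Set.Ioo (-ε) ε)
  isospectral : ∀ s ∈ Set.Ioo (-ε) ε, ∀ t ∈ Set.Ioo (-ε) ε, ∀ z : V, ∃ A ∈ K,
    (j t z : Matrix ι ι 𝕜) = A * (j s z : Matrix ι ι 𝕜) * star A
  nonconstant : ∀ δ, 0 < δ → δ ≤ ε → ∃ s ∈ Set.Ioo (-δ) δ, ∃ t ∈ Set.Ioo (-δ) δ,
    quarticTrace Z (j s) ≠ quarticTrace Z (j t)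

/-- `𝔥` is a maximal abelian subalgebra; for the Lie algebra of a compact Lie group these are the
Lie algebras of the maximal tori. -/
def IsMaximalAbelian {L : Type*} [LieRing L] [LieAlgebra ℝ L] (𝔥 : LieSubalgebra ℝ L) : Prop :=
  Maximal (fun 𝔞 : LieSubalgebra ℝ L => IsLieAbelian 𝔞) 𝔥

end Isospectral

end

/-! Write `λ` for the transpose of `j` and `μ` for the transpose of `λ` with respect to `g₀`. The
metrics are left invariant, so curvature is a computation in the Lie algebra `L`. Since `j` takes
values orthogonal to `𝔥`, `λ² = 0`; hence `1 + λ`, which is an isometry from `(L, g_λ)` to `(L,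
g₀)`, has the inverse `1 - λ`.

`L` is unimodular, and therefore `Ric(y, z) = -tr(∇z ∘ ∇y)`, where `∇y` is the map `x ↦ ∇_x y`
(`IsAlgLeviCivita.ricci_eq`). After conjugation by `1 + λ`, the operator `2∇y` is a sum of a
`g₀`-symmetric commutator and a `g₀`-skew operator (`IsDeformation.conj_flip_eq`). Most products of
these vanish because `𝔥` is abelian and commutes with the image of `j`. What remains is the Ricci
operator `¼ (1 + λ) K (1 + μ) + S`, where `-g₀(K ·, ·)` is the Killing form and `S = ½ ∑ ad(jᵢ)² + ∑
ad(jᵢ) ad(Zᵢ)` (`IsDeformation.trace_conj_mul_conj`). The trace of its square is `tr S²` plus terms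
which depend on `t` only through the Gram matrix of `j₀, j₁` (`IsDeformation.algRicciNormSq_eq`).

Isospectrality fixes `tr(j_z ^ n)` for all `z` and `n`. Polarizing `n = 2` fixes the Gram matrix;
polarizing `n = 4` fixes `2 tr(X²Y²) + tr(XYXY)` for `X = j₀`, `Y = j₁`. On `𝔰𝔬(n)` and `𝔰𝔲(n)` the
trace of a product of four operators `ad` is explicit in matrix traces (`trace_ad_quartic_soLie`,
`trace_ad_quartic_suLie`), so that `tr S²` varies with `t` exactly as `(n - 2)/2`, respectively `n`,
times `tr(X²Y²)`. This trace does vary, since `tr((X² + Y²)²) = tr X⁴ + tr Y⁴ + 2 tr(X²Y²)` is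
nonconstant by hypothesis. The scalar product enters through a classification: an `Ad`-invariant one
is a multiple of the trace form, which makes `ad` skew and relates it to the Killing form.

On the geometric side, a local frame with constant structure constants and constant metric
coefficients determines `‖Ric‖²` by algebra (`IsHomogeneousFrameOn.ricciNormSq_eq`). Left invariant
fields form such a frame. A local isometry pulls the left invariant frame of its target back to such
a frame for the metric of its source (`isHomogeneousFrameOn_pullback`), so both algebraic constants
compute the same number. -/

noncomputable section

/-! ### Coordinates of vector fields in a local frame -/

section Frames

open Filter Topology VectorField

variable {E : Type*} [NormedAddCommGroup E] [NormedSpace ℝ E] [FiniteDimensional ℝ E]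
  [CompleteSpace E] {H : Type*} [TopologicalSpace H] {I : ModelWithCorners ℝ E H}
  {M : Type*} [TopologicalSpace M] [ChartedSpace H M] [IsManifold I ∞ M]

/-- A `C²` frame of the tangent bundle on the open set `U`, parametrized by the model space. -/
structure IsTangentFrameOn (θ : ∀ q : M, E →L[ℝ] TangentSpace I q) (U : Set M) : Prop where
  isOpen : IsOpen U
  isInvertible : ∀ q ∈ U, (θ q).IsInvertible
  contMDiffAt : ∀ u, ∀ q ∈ U,
    ContMDiffAt I I.tangent 2 (fun q => (⟨q, θ q u⟩ : TangentBundle I M)) q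

/-- In finite dimensions `A q` is a finite sum of rank-one maps, one for each `A q (b i)` with `b` a
basis. -/
theorem contMDiffAt_clm_of_apply {F : Type*} [NormedAddCommGroup F] [NormedSpace ℝ F]
    {n : ℕ∞ω} {A : M → E →L[ℝ] F} {p : M}
    (h : ∀ u, ContMDiffAt I 𝓘(ℝ, F) n (fun q => A q u) p) :
    ContMDiffAt I 𝓘(ℝ, E →L[ℝ] F) n A p := by
  let b := Module.finBasis ℝ E
  have hA : A = fun q => ∑ i, ContinuousLinearMap.smulRightL ℝ E F
      (LinearMap.toContinuousLinearMap (b.coord i)) (A q (b i)) := by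
    funext q
    ext u
    conv_lhs => rw [← b.sum_repr u, map_sum]
    simp
  rw [hA]
  refine ContMDiffAt.sum fun i _ => ?_
  exact ContMDiffAt.clm_apply contMDiffAt_const (h (b i))

namespace IsTangentFrameOn

variable {θ : ∀ q : M, E →L[ℝ] TangentSpace I q} {U : Set M} {p : M}

/-- Near `p`, the coordinates of a vector field in a frame are obtained from its components in the
trivialization around `p` by a family of linear maps which is `C²`. -/
theorem exists_transition (h : IsTangentFrameOn θ U) (hp : p ∈ U) :
    ∃ A : M → E →L[ℝ] E, ContMDiffAt I 𝓘(ℝ, E →L[ℝ] E) 2 A p ∧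
      ∀ᶠ q in 𝓝 p, ∀ v : TangentSpace I q,
        (θ q).inverse v =
          A q (trivializationAt E (TangentSpace I) p (⟨q, v⟩ : TangentBundle I M)).2 := by
  let t := trivializationAt E (TangentSpace I : M → Type _) p
  have hpt : p ∈ t.baseSet := FiberBundle.mem_baseSet_trivializationAt' p
  -- The frame read in the trivialization. It is an invertible endomorphism of the fixed space `E`,
  -- so the transition family is its inverse, and inversion is smooth at invertible operators.
  let B : M → E →L[ℝ] E := fun q => (t.continuousLinearMapAt ℝ q).comp (θ q)
  have hBapp : ∀ q ∈ t.baseSet, ∀ u, B q u = (t (⟨q, θ q u⟩ : TangentBundle I M)).2 := by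
    intro q hq u
    exact congrFun (t.coe_linearMapAt_of_mem (R := ℝ) hq) (θ q u)
  have hBs : ContMDiffAt I 𝓘(ℝ, E →L[ℝ] E) 2 B p := by
    refine contMDiffAt_clm_of_apply fun u => ?_
    have h1 := (Bundle.contMDiffAt_section p).1 (h.contMDiffAt u p hp)
    refine h1.congr_of_eventuallyEq ?_
    filter_upwards [t.open_baseSet.mem_nhds hpt] with q hq
    exact hBapp q hq u
  have hinvt : ∀ q ∈ t.baseSet, (t.continuousLinearMapAt ℝ q).IsInvertible := by
    intro q hq
    exact ⟨t.continuousLinearEquivAt ℝ q hq,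
      ContinuousLinearMap.coe_injective (LinearMap.ext fun v =>
        congrFun (t.coe_continuousLinearEquivAt_eq hq) v)⟩
  refine ⟨fun q => (B q).inverse, ?_, ?_⟩
  · obtain ⟨e, he⟩ : (B p).IsInvertible := (hinvt p hpt).comp (h.isInvertible p hp)
    have h2 : ContDiffAt ℝ 2 ContinuousLinearMap.inverse (B p) := by
      rw [← he]; exact contDiffAt_map_inverse e
    exact h2.contMDiffAt.comp p hBs
  · filter_upwards [t.open_baseSet.mem_nhds hpt, h.isOpen.mem_nhds hp] with q hq hqU v
    have h3 : (t (⟨q, v⟩ : TangentBundle I M)).2 = t.continuousLinearMapAt ℝ q v :=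
      (congrFun (t.coe_linearMapAt_of_mem (R := ℝ) hq) v).symm
    change _ = (B q).inverse (t (⟨q, v⟩ : TangentBundle I M)).2
    rw [h3]
    change _ = ((t.continuousLinearMapAt ℝ q).comp (θ q)).inverse _
    rw [(hinvt q hq).inverse_comp_apply_of_left, (hinvt q hq).inverse_apply_self]

theorem contMDiffAt_coords (h : IsTangentFrameOn θ U) (hp : p ∈ U) {n : ℕ∞ω} (hn : n ≤ 2)
    {X : ∀ q : M, TangentSpace I q}
    (hX : ContMDiffAt I I.tangent n (fun q => (⟨q, X q⟩ : TangentBundle I M)) p) :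
    ContMDiffAt I 𝓘(ℝ, E) n (fun q => (θ q).inverse (X q)) p := by
  obtain ⟨A, hA, hAX⟩ := h.exists_transition hp
  have h1 := (Bundle.contMDiffAt_section p).1 hX
  refine ((hA.of_le hn).clm_apply h1).congr_of_eventuallyEq ?_
  filter_upwards [hAX] with q hq
  exact hq _

theorem mdifferentiableAt_coords (h : IsTangentFrameOn θ U) (hp : p ∈ U)
    {X : ∀ q : M, TangentSpace I q}
    (hX : MDifferentiableAt I I.tangent (fun q => (⟨q, X q⟩ : TangentBundle I M)) p) :
    MDifferentiableAt I 𝓘(ℝ, E) (fun q => (θ q).inverse (X q)) p := by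
  obtain ⟨A, hA, hAX⟩ := h.exists_transition hp
  have h1 := (mdifferentiableAt_section I X).1 hX
  refine ((hA.mdifferentiableAt (by simp)).clm_apply h1).congr_of_eventuallyEq ?_
  filter_upwards [hAX] with q hq
  exact hq _

end IsTangentFrameOn

end Frames

/-! ### Product rules for derivatives and Lie brackets -/

section Frames

open Filter Topology VectorField

variable {E : Type*} [NormedAddCommGroup E] [NormedSpace ℝ E]
  {H : Type*} [TopologicalSpace H] {I : ModelWithCorners ℝ E H}
  {M : Type*} [TopologicalSpace M] [ChartedSpace H M]

theorem mvfderiv_bilinear {F₁ F₂ F₃ : Type*} [NormedAddCommGroup F₁] [NormedSpace ℝ F₁]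
    [NormedAddCommGroup F₂] [NormedSpace ℝ F₂] [NormedAddCommGroup F₃] [NormedSpace ℝ F₃]
    (B : F₁ →L[ℝ] F₂ →L[ℝ] F₃) {f : M → F₁} {g : M → F₂} {p : M}
    (hf : MDifferentiableAt I 𝓘(ℝ, F₁) f p) (hg : MDifferentiableAt I 𝓘(ℝ, F₂) g p)
    (v : TangentSpace I p) :
    mvfderiv I (fun q => B (f q) (g q)) p v =
      B (mvfderiv I f p v) (g p) + B (f p) (mvfderiv I g p v) := by
  have h : HasMFDerivAt I 𝓘(ℝ, F₃) (fun q => B (f q) (g q)) p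
      (B.precompR E (f p) (mfderiv I 𝓘(ℝ, F₂) g p)
        + B.precompL E (mfderiv I 𝓘(ℝ, F₁) f p) (g p)) := by
    refine ⟨?_, ?_⟩
    · exact (B.continuous₂.tendsto (f p, g p)).comp (hf.continuousAt.prodMk_nhds hg.continuousAt)
    · have := B.hasFDerivWithinAt_of_bilinear hf.hasMFDerivAt.2 hg.hasMFDerivAt.2
      simpa [writtenInExtChartAt, Function.comp_def] using! this
  have h2 : mvfderiv I (fun q => B (f q) (g q)) p = _ := h.mfderiv
  rw [h2, add_comm]
  rfl

theorem mvfderiv_clm_comp {F₁ F₂ : Type*} [NormedAddCommGroup F₁] [NormedSpace ℝ F₁]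
    [NormedAddCommGroup F₂] [NormedSpace ℝ F₂]
    (B : F₁ →L[ℝ] F₂) {f : M → F₁} {p : M}
    (hf : MDifferentiableAt I 𝓘(ℝ, F₁) f p) (v : TangentSpace I p) :
    mvfderiv I (fun q => B (f q)) p v = B (mvfderiv I f p v) := by
  have h := HasMFDerivAt.comp p (B.hasFDerivAt.hasMFDerivAt (x := f p)) hf.hasMFDerivAt
  have h2 : mvfderiv I (fun q => B (f q)) p = _ := h.mfderiv
  rw [h2]
  rfl

variable [CompleteSpace E] [IsManifold I ∞ M]

theorem mlieBracket_sum_smul_right {ι : Type*} (s : Finset ι) (V : ∀ q : M, TangentSpace I q)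
    {f : ι → M → ℝ} {W : ι → ∀ q : M, TangentSpace I q} {p : M}
    (hf : ∀ i ∈ s, MDifferentiableAt I 𝓘(ℝ, ℝ) (f i) p)
    (hW : ∀ i ∈ s, MDifferentiableAt I I.tangent (fun q => (⟨q, W i q⟩ : TangentBundle I M)) p) :
    mlieBracket I V (fun q => ∑ i ∈ s, f i q • W i q) p =
      ∑ i ∈ s, (mvfderiv I (f i) p (V p) • W i p + f i p • mlieBracket I V (W i) p) := by
  classical
  induction s using Finset.induction_on with
  | empty =>
    simp only [Finset.sum_empty]
    exact congrFun (mlieBracket_zero_right (I := I) (W := V)) p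
  | insert a s ha ih =>
    simp only [Finset.sum_insert ha]
    rw [← ih (fun i hi => hf i (Finset.mem_insert_of_mem hi))
      (fun i hi => hW i (Finset.mem_insert_of_mem hi)),
      ← mlieBracket_smul_right (hf a (Finset.mem_insert_self a s))
        (hW a (Finset.mem_insert_self a s))]
    refine mlieBracket_add_right ?_ ?_
    · exact (hf a (Finset.mem_insert_self a s)).smul_section (hW a (Finset.mem_insert_self a s))
    · exact MDifferentiableAt.sum_section fun i hi => (hf i (Finset.mem_insert_of_mem hi)).smul_section
        (hW i (Finset.mem_insert_of_mem hi))

variable [FiniteDimensional ℝ E]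

namespace IsTangentFrameOn

variable {θ : ∀ q : M, E →L[ℝ] TangentSpace I q} {U : Set M} {p : M}

theorem mdifferentiableAt (h : IsTangentFrameOn θ U) (hp : p ∈ U) (u : E) :
    MDifferentiableAt I I.tangent (fun q => (⟨q, θ q u⟩ : TangentBundle I M)) p :=
  (h.contMDiffAt u p hp).mdifferentiableAt (by simp)

theorem eventually_apply_inverse (h : IsTangentFrameOn θ U) (hp : p ∈ U)
    (Y : ∀ q : M, TangentSpace I q) :
    ∀ᶠ q in 𝓝 p, θ q ((θ q).inverse (Y q)) = Y q := by
  filter_upwards [h.isOpen.mem_nhds hp] with q hq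
  exact (h.isInvertible q hq).self_apply_inverse _

/-- The product rule for the Lie bracket in terms of the coordinates in a frame. -/
theorem mlieBracket_right (h : IsTangentFrameOn θ U) (hp : p ∈ U)
    (V : ∀ q : M, TangentSpace I q) {Y : ∀ q : M, TangentSpace I q} {y : M → E}
    (hy : MDifferentiableAt I 𝓘(ℝ, E) y p) (hY : ∀ᶠ q in 𝓝 p, Y q = θ q (y q)) :
    mlieBracket I V Y p = θ p (mvfderiv I y p (V p))
      + mlieBracket I V (fun q => θ q (y p)) p := by
  let b := Module.finBasis ℝ E
  -- Expanding `z` in a basis gives a derivative term and a term which depends only on `z p`.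
  -- Comparing `z = y` with the constant `y p` then isolates the derivative term.
  have key : ∀ z : M → E, MDifferentiableAt I 𝓘(ℝ, E) z p →
      mlieBracket I V (fun q => θ q (z q)) p = θ p (mvfderiv I z p (V p))
        + ∑ i, b.repr (z p) i • mlieBracket I V (fun q => θ q (b i)) p := by
    intro z hz
    let L : ∀ i, E →L[ℝ] ℝ := fun i => LinearMap.toContinuousLinearMap (b.coord i)
    have hL : ∀ i, MDifferentiableAt I 𝓘(ℝ, ℝ) (fun q => L i (z q)) p := fun i =>
      (L i).mdifferentiableAt.comp p hz
    have h1 := mlieBracket_sum_smul_right Finset.univ V (f := fun i q => L i (z q))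
      (W := fun i q => θ q (b i)) (p := p) (fun i _ => hL i)
      (fun i _ => h.mdifferentiableAt hp (b i))
    have h2 : (fun q => θ q (z q)) = fun q => ∑ i, L i (z q) • θ q (b i) := by
      funext q
      conv_lhs => rw [← b.sum_repr (z q), map_sum]
      simp [L]
    rw [h2, h1, Finset.sum_add_distrib]
    congr 1
    conv_rhs => rw [← b.sum_repr (mvfderiv I z p (V p)), map_sum]
    refine Finset.sum_congr rfl fun i _ => ?_
    rw [mvfderiv_clm_comp (L i) hz, map_smul]
    rfl
  rw [Filter.EventuallyEq.mlieBracket_vectorField_eq (V := V) (V₁ := V) (EventuallyEq.rfl) hY,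
    key y hy, key (fun _ => y p) mdifferentiableAt_const]
  simp [mvfderiv_const]

end IsTangentFrameOn

end Frames

/-! ### The Levi-Civita connection in a homogeneous frame -/

section Frames

open Filter Topology VectorField

variable {E : Type*} [NormedAddCommGroup E] [NormedSpace ℝ E]
  {H : Type*} [TopologicalSpace H] {I : ModelWithCorners ℝ E H}
  {M : Type*} [TopologicalSpace M] [ChartedSpace H M]

theorem mvfderiv_congr {F : Type*} [NormedAddCommGroup F] [NormedSpace ℝ F] {f f' : M → F} {p : M}
    (h : f =ᶠ[𝓝 p] f') (v : TangentSpace I p) : mvfderiv I f p v = mvfderiv I f' p v := by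
  have h1 : (mfderiv I 𝓘(ℝ, F) f p : E →L[ℝ] F) = mfderiv I 𝓘(ℝ, F) f' p := h.mfderiv_eq
  exact congrArg (fun A : E →L[ℝ] F => A v) h1

variable [CompleteSpace E] [IsManifold I ∞ M] [FiniteDimensional ℝ E]

/-- A frame of vector fields in which the metric `g` has constant coefficients, given by the form
`Q`, and which has constant structure coefficients, given by the bracket `br`. -/
structure IsHomogeneousFrameOn (g : MetricTensor I M) (br : E →L[ℝ] E →L[ℝ] E)
    (Q : E →L[ℝ] E →L[ℝ] ℝ) (θ : ∀ q : M, E →L[ℝ] TangentSpace I q) (U : Set M) : Prop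
    extends IsTangentFrameOn θ U where
  mlieBracket_eq : ∀ u v, ∀ q ∈ U,
    mlieBracket I (fun q => θ q u) (fun q => θ q v) q = θ q (br u v)
  metric_eq : ∀ q ∈ U, ∀ u v, g q (θ q u) (θ q v) = Q u v

/-- The Koszul formula for left invariant vector fields. -/
def IsKoszul (br : E →L[ℝ] E →L[ℝ] E) (Q : E →L[ℝ] E →L[ℝ] ℝ) (Γ : E →L[ℝ] E →L[ℝ] E) : Prop :=
  ∀ x y z, 2 * Q (Γ x y) z = Q (br x y) z - Q (br y z) x + Q (br z x) y

namespace IsHomogeneousFrameOn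

variable {g : MetricTensor I M} {br : E →L[ℝ] E →L[ℝ] E} {Q : E →L[ℝ] E →L[ℝ] ℝ}
  {Γ : E →L[ℝ] E →L[ℝ] E}
  {θ : ∀ q : M, E →L[ℝ] TangentSpace I q} {U : Set M} {p : M}

/-- The product rule for the right argument is used twice, the second time after exchanging the two
fields. What is left is the bracket of two frame fields with constant coordinates. -/
theorem mlieBracket_apply (h : IsHomogeneousFrameOn g br Q θ U) (hbr : ∀ u v, br u v = -br v u)
    (hp : p ∈ U) {X Y : ∀ q : M, TangentSpace I q} {x y : M → E}
    (hx : MDifferentiableAt I 𝓘(ℝ, E) x p) (hX : ∀ᶠ q in 𝓝 p, X q = θ q (x q))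
    (hy : MDifferentiableAt I 𝓘(ℝ, E) y p) (hY : ∀ᶠ q in 𝓝 p, Y q = θ q (y q)) :
    mlieBracket I X Y p = θ p (mvfderiv I y p (X p) - mvfderiv I x p (Y p) + br (x p) (y p)) := by
  rw [h.mlieBracket_right hp X hy hY, mlieBracket_swap_apply, h.mlieBracket_right hp _ hx hX,
    h.mlieBracket_eq _ _ p hp, hbr (x p) (y p), hY.self_of_nhds, map_add, map_sub, map_neg]
  abel

/-- The coefficients of the metric in the frame are constant, so only the coordinates get
differentiated in the Koszul formula. The derivatives of `x` and `z` cancel against those in the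
brackets and the derivatives of `y` add up to `2 Q (X y) z`; the remaining terms are the algebraic
Koszul formula for `Γ`. -/
theorem leviCivita_eq (h : IsHomogeneousFrameOn g br Q θ U) (hbr : ∀ u v, br u v = -br v u)
    (hQ : ∀ u v, Q u v = Q v u) (hQ' : ∀ u, (∀ v, Q u v = 0) → u = 0) (hΓ : IsKoszul br Q Γ)
    (hp : p ∈ U) {X Y : ∀ q : M, TangentSpace I q} {x y : M → E}
    (hx : MDifferentiableAt I 𝓘(ℝ, E) x p) (hX : ∀ᶠ q in 𝓝 p, X q = θ q (x q))
    (hy : MDifferentiableAt I 𝓘(ℝ, E) y p) (hY : ∀ᶠ q in 𝓝 p, Y q = θ q (y q)) :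
    leviCivita I g X Y p = θ p (mvfderiv I y p (X p) + Γ (x p) (y p)) := by
  have hmet : ∀ {V W : ∀ q : M, TangentSpace I q} {v w : M → E},
      (∀ᶠ q in 𝓝 p, V q = θ q (v q)) → (∀ᶠ q in 𝓝 p, W q = θ q (w q)) →
      (fun q => g q (V q) (W q)) =ᶠ[𝓝 p] fun q => Q (v q) (w q) := by
    intro V W v w hV hW
    filter_upwards [hV, hW, h.isOpen.mem_nhds hp] with q h1 h2 h3
    rw [h1, h2, h.metric_eq q h3]
  have key : ∀ Z : ∀ q : M, TangentSpace I q,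
      MDifferentiableAt I I.tangent (fun q => (⟨q, Z q⟩ : TangentBundle I M)) p →
      2 * g p (θ p (mvfderiv I y p (X p) + Γ (x p) (y p))) (Z p) = koszul I g X Y Z p := by
    intro Z hZ
    have hz := h.mdifferentiableAt_coords hp hZ
    have hZ' := (h.eventually_apply_inverse hp Z).mono fun _ h => h.symm
    set z : M → E := fun q => (θ q).inverse (Z q) with hzdef
    rw [koszul, mvfderiv_congr (hmet hY hZ'), mvfderiv_congr (hmet hZ' hX),
      mvfderiv_congr (hmet hX hY), mvfderiv_bilinear Q hy hz, mvfderiv_bilinear Q hz hx,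
      mvfderiv_bilinear Q hx hy, h.mlieBracket_apply hbr hp hx hX hy hY,
      h.mlieBracket_apply hbr hp hy hY hz hZ', h.mlieBracket_apply hbr hp hz hZ' hx hX]
    have eX : X p = θ p (x p) := hX.self_of_nhds
    have eY : Y p = θ p (y p) := hY.self_of_nhds
    have eZ : Z p = θ p (z p) := hZ'.self_of_nhds
    have m : ∀ (u : E) (T : TangentSpace I p) (w : E), T = θ p w → g p (θ p u) T = Q u w := by
      intro u T w hT
      rw [hT, h.metric_eq p hp]
    rw [m _ _ _ eX, m _ _ _ eY, m _ _ _ eZ, m _ _ _ eZ]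
    have := hΓ (x p) (y p) (z p)
    simp only [map_add, map_sub, add_apply, sub_apply]
    rw [hQ (z p) (mvfderiv I x p (Y p)), hQ (y p) (mvfderiv I z p (X p)),
      hQ (x p) (mvfderiv I y p (Z p))]
    linarith
  have hex : ∃ v : TangentSpace I p, ∀ Z : ∀ q : M, TangentSpace I q,
      MDifferentiableAt I I.tangent (fun q => (⟨q, Z q⟩ : TangentBundle I M)) p →
        2 * g p v (Z p) = koszul I g X Y Z p := ⟨_, key⟩
  rw [leviCivita, dif_pos hex]
  -- The chosen vector agrees with the explicit one: frame fields are admissible test fields, and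
  -- they separate vectors since `Q` is nondegenerate.
  have hs := hex.choose_spec
  set w := hex.choose with hw
  have hw' : θ p ((θ p).inverse w) = w := (h.isInvertible p hp).self_apply_inverse w
  rw [← hw']
  congr 1
  rw [← sub_eq_zero]
  refine hQ' _ fun u => ?_
  have h1 := hs (fun q => θ q u) (h.mdifferentiableAt hp u)
  have h2 := key (fun q => θ q u) (h.mdifferentiableAt hp u)
  rw [← h2, ← hw'] at h1
  simp only [h.metric_eq p hp] at h1
  rw [map_sub, sub_apply]
  linarith

end IsHomogeneousFrameOn

end Frames

/-! ### Second derivatives of functions along vector fields -/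

section Frames

open Filter Topology VectorField

variable {E : Type*} [NormedAddCommGroup E] [NormedSpace ℝ E]
  {H : Type*} [TopologicalSpace H] {I : ModelWithCorners ℝ E H}
  {M : Type*} [TopologicalSpace M] [ChartedSpace H M]
  [CompleteSpace E] [IsManifold I ∞ M] [FiniteDimensional ℝ E]

theorem mdifferentiableAt_mlieBracket {X Y : ∀ q : M, TangentSpace I q} {p : M}
    (hX : ContMDiffAt I I.tangent 2 (fun q => (⟨q, X q⟩ : TangentBundle I M)) p)
    (hY : ContMDiffAt I I.tangent 2 (fun q => (⟨q, Y q⟩ : TangentBundle I M)) p) :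
    MDifferentiableAt I I.tangent
      (fun q => (⟨q, mlieBracket I X Y q⟩ : TangentBundle I M)) p := by
  have : IsManifold I (((2 : ℕ∞) : ℕ∞ω) + 1) M := .of_le (n := ∞) (by exact_mod_cast le_top)
  have h := ContMDiffAt.mlieBracket_vectorField (m := 1) (n := 2) (I := I) hX hY
    (by rw [minSmoothness_of_isRCLikeNormedField]; norm_num)
  exact h.mdifferentiableAt (by simp)

namespace IsTangentFrameOn

variable {θ : ∀ q : M, E →L[ℝ] TangentSpace I q} {U : Set M} {p : M}

theorem eventually_mlieBracket_smul (h : IsTangentFrameOn θ U) (hp : p ∈ U) {f : M → ℝ}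
    (hf : ContMDiffAt I 𝓘(ℝ, ℝ) 2 f p) (Y : ∀ q : M, TangentSpace I q) (w : E) :
    ∀ᶠ q in 𝓝 p, mlieBracket I Y (f • fun q => θ q w) q =
      mvfderiv I f q (Y q) • θ q w + f q • mlieBracket I Y (fun q => θ q w) q := by
  filter_upwards [(contMDiffAt_iff_contMDiffAt_nhds (by simp)).1 hf,
    h.isOpen.mem_nhds hp] with q hq hqU
  exact mlieBracket_smul_right (hq.mdifferentiableAt (by simp)) (h.mdifferentiableAt hqU w)

/-- The regularity of `Y f` is read off from that of Lie brackets: `[Y, f W] - f [Y, W] = (Y f) W`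
for a nonvanishing frame field `W`, and brackets of `C²` fields are differentiable. A linear
functional which is nonzero on the coordinates of `W` then extracts `Y f`. -/
theorem mdifferentiableAt_mvfderiv_apply (h : IsTangentFrameOn θ U) (hp : p ∈ U) {f : M → ℝ}
    (hf : ContMDiffAt I 𝓘(ℝ, ℝ) 2 f p) {Y : ∀ q : M, TangentSpace I q}
    (hY : ContMDiffAt I I.tangent 2 (fun q => (⟨q, Y q⟩ : TangentBundle I M)) p) :
    MDifferentiableAt I 𝓘(ℝ, ℝ) (fun q => mvfderiv I f q (Y q)) p := by
  rcases subsingleton_or_nontrivial E with hE | hE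
  · have : (fun q => mvfderiv I f q (Y q)) = fun _ => 0 := by
      funext q
      have : Y q = 0 := Subsingleton.elim (α := E) _ _
      rw [this, map_zero]
    rw [this]
    exact mdifferentiableAt_const
  obtain ⟨w, hw⟩ := exists_ne (0 : E)
  obtain ⟨φ, hφ⟩ := Module.Projective.exists_dual_ne_zero ℝ hw
  let L : E →L[ℝ] ℝ := LinearMap.toContinuousLinearMap φ
  have hW := h.contMDiffAt w p hp
  have h1 := mdifferentiableAt_mlieBracket hY (hf.smul_section hW)
  have h2 := (hf.mdifferentiableAt (by simp)).smul_section (mdifferentiableAt_mlieBracket hY hW)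
  have h3 := h.mdifferentiableAt_coords hp (mdifferentiableAt_sub_section h1 h2)
  have h4 : MDifferentiableAt I 𝓘(ℝ, ℝ) (fun q => (φ w)⁻¹ • L ((θ q).inverse
      ((mlieBracket I Y (f • fun q => θ q w) - (f • mlieBracket I Y fun q => θ q w)) q))) p :=
    (L.mdifferentiableAt.comp p h3).const_smul _
  refine h4.congr_of_eventuallyEq ?_
  filter_upwards [h.eventually_mlieBracket_smul hp hf Y w, h.isOpen.mem_nhds hp] with q hq hqU
  rw [Pi.sub_apply, hq, Pi.smul_apply', add_sub_cancel_right, map_smul,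
    (h.isInvertible q hqU).inverse_apply_self]
  simp only [L, LinearMap.coe_toContinuousLinearMap', map_smul, smul_eq_mul]
  field_simp

/-- `X (Y f) - Y (X f) = [X, Y] f`. -/
theorem mvfderiv_mlieBracket (h : IsTangentFrameOn θ U) (hp : p ∈ U) {f : M → ℝ}
    (hf : ContMDiffAt I 𝓘(ℝ, ℝ) 2 f p) {X Y : ∀ q : M, TangentSpace I q}
    (hX : ContMDiffAt I I.tangent 2 (fun q => (⟨q, X q⟩ : TangentBundle I M)) p)
    (hY : ContMDiffAt I I.tangent 2 (fun q => (⟨q, Y q⟩ : TangentBundle I M)) p) :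
    mvfderiv I f p (mlieBracket I X Y p) =
      mvfderiv I (fun q => mvfderiv I f q (Y q)) p (X p)
        - mvfderiv I (fun q => mvfderiv I f q (X q)) p (Y p) := by
  rcases subsingleton_or_nontrivial E with hE | hE
  · have hz : ∀ (F : M → ℝ) (v : TangentSpace I p), mvfderiv I F p v = 0 := by
      intro F v
      have : v = 0 := Subsingleton.elim (α := E) _ _
      rw [this, map_zero]
    simp only [hz, sub_zero]
  obtain ⟨w, hw⟩ := exists_ne (0 : E)
  have hW := h.contMDiffAt w p hp
  have hfd := hf.mdifferentiableAt (I := I) (by simp)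
  have hWd := hW.mdifferentiableAt (I := I) (by simp)
  have expand : ∀ {X Y : ∀ q : M, TangentSpace I q},
      ContMDiffAt I I.tangent 2 (fun q => (⟨q, X q⟩ : TangentBundle I M)) p →
      ContMDiffAt I I.tangent 2 (fun q => (⟨q, Y q⟩ : TangentBundle I M)) p →
      mlieBracket I X (mlieBracket I Y (f • fun q => θ q w)) p =
        mvfderiv I (fun q => mvfderiv I f q (Y q)) p (X p) • θ p w
        + mvfderiv I f p (Y p) • mlieBracket I X (fun q => θ q w) p
        + (mvfderiv I f p (X p) • mlieBracket I Y (fun q => θ q w) p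
        + f p • mlieBracket I X (mlieBracket I Y fun q => θ q w) p) := by
    intro X Y hX hY
    have hYf := h.mdifferentiableAt_mvfderiv_apply hp hf hY
    have hYW := mdifferentiableAt_mlieBracket hY hW
    rw [Filter.EventuallyEq.mlieBracket_vectorField_eq (V := X) (V₁ := X) (EventuallyEq.rfl)
      (h.eventually_mlieBracket_smul hp hf Y w)]
    have e1 := mlieBracket_smul_right (V := X) hYf hWd
    have e2 := mlieBracket_smul_right (V := X) hfd hYW
    rw [← e1, ← e2]
    exact mlieBracket_add_right (hYf.smul_section hWd) (hfd.smul_section hYW)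
  have hmin : minSmoothness ℝ 2 = 2 := minSmoothness_of_isRCLikeNormedField
  -- The Jacobi identity for `X, Y, f W`, from which `f` times the one for `X, Y, W` is removed,
  -- becomes the claim multiplied by `W`. The field `W` does not vanish.
  have J1 := leibniz_identity_mlieBracket_apply (I := I) (U := X) (V := Y)
    (W := f • fun q => θ q w) (x := p) (by rwa [hmin]) (by rwa [hmin])
    (by rw [hmin]; exact hf.smul_section hW)
  have J2 := leibniz_identity_mlieBracket_apply (I := I) (U := X) (V := Y)
    (W := fun q => θ q w) (x := p) (by rwa [hmin]) (by rwa [hmin]) (by rwa [hmin])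
  rw [expand hX hY, expand hY hX, mlieBracket_smul_right hfd hWd, J2] at J1
  have h0 : (mvfderiv I f p (mlieBracket I X Y p) -
      (mvfderiv I (fun q => mvfderiv I f q (Y q)) p (X p)
        - mvfderiv I (fun q => mvfderiv I f q (X q)) p (Y p))) • θ p w = 0 := by
    rw [sub_smul, sub_smul, sub_eq_zero]
    rw [smul_add] at J1
    rw [← sub_eq_zero] at J1 ⊢
    rw [← neg_eq_zero, ← J1]
    abel
  have hne : θ p w ≠ 0 := fun h0 => hw ((h.isInvertible p hp).injective (by rw [h0, map_zero]))
  exact sub_eq_zero.1 ((smul_eq_zero.1 h0).resolve_right hne)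

theorem mdifferentiableAt_of_coord {F : Type*} [NormedAddCommGroup F] [NormedSpace ℝ F]
    [FiniteDimensional ℝ F] {f : M → F} {p : M}
    (hf : ∀ L : F →L[ℝ] ℝ, MDifferentiableAt I 𝓘(ℝ, ℝ) (fun q => L (f q)) p) :
    MDifferentiableAt I 𝓘(ℝ, F) f p := by
  let b := Module.finBasis ℝ F
  let L : ∀ i, F →L[ℝ] ℝ := fun i => LinearMap.toContinuousLinearMap (b.coord i)
  have h1 : MDifferentiableAt I 𝓘(ℝ, F) (fun q => ∑ i, L i (f q) • b i) p := by
    have h2 : MDifferentiableAt I 𝓘(ℝ, F) (∑ i, (fun q => L i (f q)) • fun _ => b i) p :=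
      MDifferentiableAt.sum fun i _ => (hf (L i)).smul mdifferentiableAt_const
    convert h2 using 1
    ext q
    simp
  refine h1.congr_of_eventuallyEq (Eventually.of_forall fun q => ?_)
  exact (b.sum_repr (f q)).symm

end IsTangentFrameOn

end Frames

/-! ### Curvature in a homogeneous frame -/

section Frames

open Filter Topology VectorField

variable {E : Type*} [NormedAddCommGroup E] [NormedSpace ℝ E]
  {H : Type*} [TopologicalSpace H] {I : ModelWithCorners ℝ E H}
  {M : Type*} [TopologicalSpace M] [ChartedSpace H M]
  [CompleteSpace E] [IsManifold I ∞ M] [FiniteDimensional ℝ E]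

theorem eq_of_forall_clm_eq {F : Type*} [NormedAddCommGroup F] [NormedSpace ℝ F]
    [FiniteDimensional ℝ F] {u v : F} (h : ∀ L : F →L[ℝ] ℝ, L u = L v) : u = v :=
  (Module.finBasis ℝ F).ext_elem fun i =>
    h (LinearMap.toContinuousLinearMap ((Module.finBasis ℝ F).coord i))

namespace IsTangentFrameOn

variable {θ : ∀ q : M, E →L[ℝ] TangentSpace I q} {U : Set M} {p : M}
  {F : Type*} [NormedAddCommGroup F] [NormedSpace ℝ F]

theorem eventually_clm_mvfderiv {f : M → F} (hf : ContMDiffAt I 𝓘(ℝ, F) 2 f p)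
    (L : F →L[ℝ] ℝ) (Y : ∀ q : M, TangentSpace I q) :
    (fun q => L (mvfderiv I f q (Y q))) =ᶠ[𝓝 p] fun q => mvfderiv I (fun q => L (f q)) q (Y q) := by
  filter_upwards [(contMDiffAt_iff_contMDiffAt_nhds (by simp)).1 hf] with q hq
  exact (mvfderiv_clm_comp L (hq.mdifferentiableAt (by simp)) _).symm

variable [FiniteDimensional ℝ F]

theorem mdifferentiableAt_mvfderiv_apply' (h : IsTangentFrameOn θ U) (hp : p ∈ U) {f : M → F}
    (hf : ContMDiffAt I 𝓘(ℝ, F) 2 f p) {Y : ∀ q : M, TangentSpace I q}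
    (hY : ContMDiffAt I I.tangent 2 (fun q => (⟨q, Y q⟩ : TangentBundle I M)) p) :
    MDifferentiableAt I 𝓘(ℝ, F) (fun q => mvfderiv I f q (Y q)) p := by
  refine mdifferentiableAt_of_coord fun L => ?_
  refine (h.mdifferentiableAt_mvfderiv_apply hp (f := fun q => L (f q)) ?_ hY).congr_of_eventuallyEq
    (eventually_clm_mvfderiv hf L Y)
  exact L.contMDiffAt.comp p hf

theorem mvfderiv_mlieBracket' (h : IsTangentFrameOn θ U) (hp : p ∈ U) {f : M → F}
    (hf : ContMDiffAt I 𝓘(ℝ, F) 2 f p) {X Y : ∀ q : M, TangentSpace I q}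
    (hX : ContMDiffAt I I.tangent 2 (fun q => (⟨q, X q⟩ : TangentBundle I M)) p)
    (hY : ContMDiffAt I I.tangent 2 (fun q => (⟨q, Y q⟩ : TangentBundle I M)) p) :
    mvfderiv I f p (mlieBracket I X Y p) =
      mvfderiv I (fun q => mvfderiv I f q (Y q)) p (X p)
        - mvfderiv I (fun q => mvfderiv I f q (X q)) p (Y p) := by
  refine eq_of_forall_clm_eq fun L => ?_
  have hL : ContMDiffAt I 𝓘(ℝ, ℝ) 2 (fun q => L (f q)) p := L.contMDiffAt.comp p hf
  rw [map_sub, ← mvfderiv_clm_comp L (hf.mdifferentiableAt (by simp)),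
    ← mvfderiv_clm_comp L (h.mdifferentiableAt_mvfderiv_apply' hp hf hY),
    ← mvfderiv_clm_comp L (h.mdifferentiableAt_mvfderiv_apply' hp hf hX),
    mvfderiv_congr (eventually_clm_mvfderiv hf L Y),
    mvfderiv_congr (eventually_clm_mvfderiv hf L X)]
  exact h.mvfderiv_mlieBracket hp hL hX hY

end IsTangentFrameOn

namespace IsHomogeneousFrameOn

variable {g : MetricTensor I M} {br : E →L[ℝ] E →L[ℝ] E} {Q : E →L[ℝ] E →L[ℝ] ℝ}
  {Γ : E →L[ℝ] E →L[ℝ] E}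
  {θ : ∀ q : M, E →L[ℝ] TangentSpace I q} {U : Set M} {p : M}

/-- Tensoriality made explicit. The definition of the curvature tensor uses extensions which need
not be left invariant, so the derivatives of all three coordinate functions have to cancel. Those of
`x` and `y` cancel against the coordinates of `[X, Y]`. The second derivatives of `z` cancel because
`[X, Y] z = X (Y z) - Y (X z)`. `C²` regularity is what the second derivatives need. -/
theorem curvature_eq (h : IsHomogeneousFrameOn g br Q θ U) (hbr : ∀ u v, br u v = -br v u)
    (hQ : ∀ u v, Q u v = Q v u) (hQ' : ∀ u, (∀ v, Q u v = 0) → u = 0) (hΓ : IsKoszul br Q Γ)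
    (hp : p ∈ U) {X Y Z : ∀ q : M, TangentSpace I q}
    (hX : ContMDiffAt I I.tangent 2 (fun q => (⟨q, X q⟩ : TangentBundle I M)) p)
    (hY : ContMDiffAt I I.tangent 2 (fun q => (⟨q, Y q⟩ : TangentBundle I M)) p)
    (hZ : ContMDiffAt I I.tangent 2 (fun q => (⟨q, Z q⟩ : TangentBundle I M)) p) :
    curvature I g X Y Z p = θ p (Γ ((θ p).inverse (X p)) (Γ ((θ p).inverse (Y p)) ((θ p).inverse (Z p)))
      - Γ ((θ p).inverse (Y p)) (Γ ((θ p).inverse (X p)) ((θ p).inverse (Z p)))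
      - Γ (br ((θ p).inverse (X p)) ((θ p).inverse (Y p))) ((θ p).inverse (Z p))) := by
  have coord : ∀ (V : ∀ q : M, TangentSpace I q), ∀ q ∈ U, ∀ᶠ r in 𝓝 q,
      V r = θ r ((θ r).inverse (V r)) := fun V q hq =>
    (h.eventually_apply_inverse hq V).mono fun _ h => h.symm
  have ev : ∀ {V : ∀ q : M, TangentSpace I q},
      ContMDiffAt I I.tangent 2 (fun q => (⟨q, V q⟩ : TangentBundle I M)) p →
      ∀ᶠ q in 𝓝 p, MDifferentiableAt I 𝓘(ℝ, E) (fun r => (θ r).inverse (V r)) q := by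
    intro V hV
    filter_upwards [(contMDiffAt_iff_contMDiffAt_nhds (by simp)).1
      (h.contMDiffAt_coords hp le_rfl hV)] with q hq
    exact hq.mdifferentiableAt (by simp)
  have hz2 := h.contMDiffAt_coords hp le_rfl hZ
  have hx := (ev hX).self_of_nhds
  have hy := (ev hY).self_of_nhds
  have hz := (ev hZ).self_of_nhds
  have step : ∀ {V W : ∀ q : M, TangentSpace I q},
      ContMDiffAt I I.tangent 2 (fun q => (⟨q, V q⟩ : TangentBundle I M)) p →
      ContMDiffAt I I.tangent 2 (fun q => (⟨q, W q⟩ : TangentBundle I M)) p →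
      leviCivita I g V (leviCivita I g W Z) p =
        θ p (mvfderiv I (fun q => mvfderiv I (fun r => (θ r).inverse (Z r)) q (W q)) p (V p)
          + (Γ (mvfderiv I (fun r => (θ r).inverse (W r)) p (V p)) ((θ p).inverse (Z p))
          + Γ ((θ p).inverse (W p)) (mvfderiv I (fun r => (θ r).inverse (Z r)) p (V p)))
          + Γ ((θ p).inverse (V p)) (mvfderiv I (fun r => (θ r).inverse (Z r)) p (W p)
            + Γ ((θ p).inverse (W p)) ((θ p).inverse (Z p)))) := by
    intro V W hV hW
    have h1 : ∀ᶠ q in 𝓝 p, leviCivita I g W Z q =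
        θ q (mvfderiv I (fun r => (θ r).inverse (Z r)) q (W q)
          + Γ ((θ q).inverse (W q)) ((θ q).inverse (Z q))) := by
      filter_upwards [ev hW, ev hZ, h.isOpen.mem_nhds hp] with q h1 h2 h3
      exact h.leviCivita_eq hbr hQ hQ' hΓ h3 h1 (coord W q h3) h2 (coord Z q h3)
    have h2 := h.mdifferentiableAt_mvfderiv_apply' hp hz2 hW
    have hw := (ev hW).self_of_nhds
    have h3 : MDifferentiableAt I 𝓘(ℝ, E)
        (fun q => Γ ((θ q).inverse (W q)) ((θ q).inverse (Z q))) p :=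
      (Γ.mdifferentiableAt.comp p hw).clm_apply hz
    rw [h.leviCivita_eq hbr hQ hQ' hΓ hp (ev hV).self_of_nhds (coord V p hp) (h2.add h3) h1]
    have h4 := mvfderiv_add h2 h3
    have h5 := mvfderiv_bilinear Γ hw hz (V p)
    rw [h4, add_apply, h5]
    rfl
  have hc := h.mdifferentiableAt_coords hp (mdifferentiableAt_mlieBracket hX hY)
  have hcp := h.mlieBracket_apply hbr hp hx (coord X p hp) hy (coord Y p hp)
  have hcp' : (θ p).inverse (mlieBracket I X Y p) = _ :=
    (congrArg (θ p).inverse hcp).trans ((h.isInvertible p hp).inverse_apply_self _)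
  rw [curvature, step hX hY, step hY hX,
    h.leviCivita_eq hbr hQ hQ' hΓ hp hc (coord _ p hp) hz (coord Z p hp), hcp',
    h.mvfderiv_mlieBracket' hp hz2 hX hY, ← map_sub, ← map_sub]
  congr 1
  simp only [map_add, map_sub, add_apply, sub_apply]
  abel

end IsHomogeneousFrameOn

end Frames

/-! ### Levi-Civita connection and Ricci norm on the Lie algebra -/

section LieAlgebraCurvature

variable {L : Type*} [LieRing L] [LieAlgebra ℝ L]

theorem IsScalarProduct.exists_orthonormal_basis {V : Type*} [AddCommGroup V] [Module ℝ V]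
    [FiniteDimensional ℝ V] {B : LinearMap.BilinForm ℝ V} (hB : IsScalarProduct B) :
    ∃ v : Module.Basis (Fin (Module.finrank ℝ V)) ℝ V, OrthonormalFor B v := by
  have hs : LinearMap.IsSymm B := ⟨fun x y => by simpa using hB.1 x y⟩
  have : Invertible (2 : ℝ) := invertibleOfNonzero two_ne_zero
  obtain ⟨v, hv⟩ := LinearMap.BilinForm.exists_orthogonal_basis (B := B) hs
  have hpos : ∀ i, 0 < B (v i) (v i) := fun i => hB.2 _ (v.ne_zero i)
  let w : Fin (Module.finrank ℝ V) → ℝˣ := fun i =>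
    Units.mk0 (√(B (v i) (v i)))⁻¹ (inv_ne_zero (Real.sqrt_pos.2 (hpos i)).ne')
  refine ⟨v.unitsSMul w, fun i j => ?_⟩
  simp only [Module.Basis.unitsSMul_apply, w, Units.smul_mk0, map_smul, LinearMap.smul_apply,
    smul_eq_mul]
  split_ifs with hij
  · subst hij
    rw [← mul_assoc, ← mul_inv, Real.mul_self_sqrt (hpos i).le, inv_mul_cancel₀ (hpos i).ne']
  · rw [hv hij]
    simp

theorem OrthonormalFor.repr_eq {V ι : Type*} [AddCommGroup V] [Module ℝ V] [Fintype ι]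
    [DecidableEq ι] {B : LinearMap.BilinForm ℝ V} {v : Module.Basis ι ℝ V}
    (hv : OrthonormalFor B v) (x : V) (i : ι) : v.repr x i = B x (v i) := by
  conv_rhs => rw [← v.sum_repr x, map_sum, LinearMap.sum_apply]
  simp [hv _ _]

/-- The Koszul formula for the Levi-Civita connection `Γ` of a left invariant metric, in terms of
left invariant vector fields. -/
def IsAlgLeviCivita (Q : LinearMap.BilinForm ℝ L) (Γ : L →ₗ[ℝ] L →ₗ[ℝ] L) : Prop :=
  ∀ x y z, 2 * Q (Γ x y) z = Q ⁅x, y⁆ z - Q ⁅y, z⁆ x + Q ⁅z, x⁆ y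

/-- The curvature tensor of the connection `Γ` on left invariant vector fields. -/
def algCurvature (Γ : L →ₗ[ℝ] L →ₗ[ℝ] L) (x y z : L) : L :=
  Γ x (Γ y z) - Γ y (Γ x z) - Γ ⁅x, y⁆ z

/-- The norm of the Ricci tensor of the connection `Γ`, computed in the orthonormal basis `u`. -/
def algRicciNormSq {ι : Type*} [Fintype ι] (Q : LinearMap.BilinForm ℝ L)
    (Γ : L →ₗ[ℝ] L →ₗ[ℝ] L) (u : ι → L) : ℝ :=
  ∑ i, ∑ j, (∑ k, Q (algCurvature Γ (u k) (u i) (u j)) (u k)) ^ 2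

/-- In an orthonormal basis the Koszul formula prescribes each coefficient of `Γ x y`. Both sides
are linear in the third argument, so the formula extends from the basis to all vectors. -/
theorem IsScalarProduct.exists_isAlgLeviCivita [FiniteDimensional ℝ L]
    {Q : LinearMap.BilinForm ℝ L} (hQ : IsScalarProduct Q) :
    ∃ Γ : L →ₗ[ℝ] L →ₗ[ℝ] L, IsAlgLeviCivita Q Γ := by
  obtain ⟨v, hv⟩ := hQ.exists_orthonormal_basis
  refine ⟨LinearMap.mk₂ ℝ (fun x y => ∑ k,
    ((Q ⁅x, y⁆ (v k) - Q ⁅y, v k⁆ x + Q ⁅v k, x⁆ y) / 2) • v k) ?_ ?_ ?_ ?_, ?_⟩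
  · intro x x' y
    rw [← Finset.sum_add_distrib]
    refine Finset.sum_congr rfl fun k _ => ?_
    rw [← add_smul]
    congr 1
    simp only [add_lie, lie_add, map_add, LinearMap.add_apply]
    ring
  · intro c x y
    rw [Finset.smul_sum]
    refine Finset.sum_congr rfl fun k _ => ?_
    rw [smul_smul]
    congr 1
    simp only [smul_lie, lie_smul, map_smul, LinearMap.smul_apply, smul_eq_mul]
    ring
  · intro x y y'
    rw [← Finset.sum_add_distrib]
    refine Finset.sum_congr rfl fun k _ => ?_
    rw [← add_smul]
    congr 1
    simp only [add_lie, lie_add, map_add, LinearMap.add_apply]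
    ring
  · intro c x y
    rw [Finset.smul_sum]
    refine Finset.sum_congr rfl fun k _ => ?_
    rw [smul_smul]
    congr 1
    simp only [smul_lie, lie_smul, map_smul, LinearMap.smul_apply, smul_eq_mul]
    ring
  · intro x y z
    have h : ∀ k, (2 : ℝ) * Q (∑ k, ((Q ⁅x, y⁆ (v k) - Q ⁅y, v k⁆ x + Q ⁅v k, x⁆ y) / 2) • v k) (v k)
        = Q ⁅x, y⁆ (v k) - Q ⁅y, v k⁆ x + Q ⁅v k, x⁆ y := by
      intro k
      simp only [map_sum, map_smul, LinearMap.sum_apply, LinearMap.smul_apply, hv _ _, smul_eq_mul,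
        mul_ite, mul_one, mul_zero, Finset.sum_ite_eq', Finset.mem_univ, if_true]
      ring
    rw [LinearMap.mk₂_apply]
    set w := ∑ k, ((Q ⁅x, y⁆ (v k) - Q ⁅y, v k⁆ x + Q ⁅v k, x⁆ y) / 2) • v k
    let A : L →ₗ[ℝ] ℝ := (2 : ℝ) • Q w
    let B : L →ₗ[ℝ] ℝ := Q ⁅x, y⁆ - (Q.flip x) ∘ₗ (LieAlgebra.ad ℝ L y : L →ₗ[ℝ] L)
      - (Q.flip y) ∘ₗ (LieAlgebra.ad ℝ L x : L →ₗ[ℝ] L)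
    have hB : ∀ z, B z = Q ⁅x, y⁆ z - Q ⁅y, z⁆ x + Q ⁅z, x⁆ y := by
      intro z
      rw [← lie_skew z x]
      simp [B, sub_eq_add_neg, -lie_skew]
    have hAB : A = B := v.ext fun k => by rw [hB, ← h k]; rfl
    rw [← hB, ← hAB]
    rfl

end LieAlgebraCurvature

/-! ### From a homogeneous frame to the Ricci norm at a point -/

section FrameRicci

variable {E : Type*} [NormedAddCommGroup E] [NormedSpace ℝ E]
  {H : Type*} [TopologicalSpace H] {I : ModelWithCorners ℝ E H}
  {M : Type*} [TopologicalSpace M] [ChartedSpace H M]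
  [CompleteSpace E] [IsManifold I ∞ M] [FiniteDimensional ℝ E]
  {L : Type*} [LieRing L] [LieAlgebra ℝ L]

/-- A bilinear map on `L`, transported to the normed space `E`. -/
def transportForm (e : L ≃ₗ[ℝ] E) (Q : LinearMap.BilinForm ℝ L) : E →L[ℝ] E →L[ℝ] ℝ :=
  (Q.comp (e.symm : E →ₗ[ℝ] L) (e.symm : E →ₗ[ℝ] L)).toContinuousBilinearMap

/-- A bilinear operation on `L`, transported to the normed space `E`. -/
def transportOp (e : L ≃ₗ[ℝ] E) (Γ : L →ₗ[ℝ] L →ₗ[ℝ] L) : E →L[ℝ] E →L[ℝ] E :=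
  ((Γ.compl₁₂ (e.symm : E →ₗ[ℝ] L) (e.symm : E →ₗ[ℝ] L)).compr₂
    (e : L →ₗ[ℝ] E)).toContinuousBilinearMap

theorem transportForm_apply (e : L ≃ₗ[ℝ] E) (Q : LinearMap.BilinForm ℝ L) (x y : E) :
    transportForm e Q x y = Q (e.symm x) (e.symm y) := rfl

theorem transportOp_apply (e : L ≃ₗ[ℝ] E) (Γ : L →ₗ[ℝ] L →ₗ[ℝ] L) (x y : E) :
    transportOp e Γ x y = e (Γ (e.symm x) (e.symm y)) := rfl

/-- The bracket of `L`, transported to the normed space `E`. -/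
def transportBracket (e : L ≃ₗ[ℝ] E) : E →L[ℝ] E →L[ℝ] E :=
  transportOp e (LieModule.toEnd ℝ L L : L →ₗ[ℝ] L →ₗ[ℝ] L)

theorem transportBracket_apply (e : L ≃ₗ[ℝ] E) (x y : E) :
    transportBracket e x y = e ⁅e.symm x, e.symm y⁆ := rfl

/-- The frame at `p` identifies the tangent space isometrically with `L` and carries the curvature
tensor to the algebraic one. The basis is only asserted to exist because `ricciNormSq` computes in
an orthonormal basis taken by choice; the basis of `L` is its image. -/
theorem IsHomogeneousFrameOn.ricciNormSq_eq {g : MetricTensor I M} {e : L ≃ₗ[ℝ] E}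
    {Q : LinearMap.BilinForm ℝ L} {θ : ∀ q : M, E →L[ℝ] TangentSpace I q} {U : Set M} {p : M}
    (h : IsHomogeneousFrameOn g (transportBracket e) (transportForm e Q) θ U) (hp : p ∈ U)
    (hQ : IsScalarProduct Q) {Γ : L →ₗ[ℝ] L →ₗ[ℝ] L} (hΓ : IsAlgLeviCivita Q Γ) :
    ∃ u : Module.Basis (Fin (Module.finrank ℝ E)) ℝ L, OrthonormalFor Q u ∧
      ricciNormSq I g p = algRicciNormSq Q Γ u := by
  have hbr : ∀ u v, transportBracket e u v = -transportBracket e v u := by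
    intro u v
    rw [transportBracket_apply, transportBracket_apply, ← map_neg, lie_skew]
  have hQs : ∀ u v, transportForm e Q u v = transportForm e Q v u := fun u v => hQ.1 _ _
  have hQn : ∀ u, (∀ v, transportForm e Q u v = 0) → u = 0 := by
    intro u hu
    by_contra h0
    exact (hQ.2 (e.symm u) (by simpa using h0)).ne' (hu u)
  have hΓ' : IsKoszul (transportBracket e) (transportForm e Q) (transportOp e Γ) := by
    intro x y z
    simp only [transportForm_apply, transportBracket_apply, transportOp_apply,
      LinearEquiv.symm_apply_apply]
    exact hΓ _ _ _
  obtain ⟨T, hT⟩ := h.isInvertible p hp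
  have hTi : ∀ v, (θ p).inverse v = T.symm v := fun v => by
    rw [← hT, ContinuousLinearMap.inverse_equiv]; rfl
  have hTa : ∀ v, T v = θ p v := fun v => by rw [← hT]; rfl
  let ψ : TangentSpace I p ≃ₗ[ℝ] L := T.symm.toLinearEquiv.trans e.symm
  have hψ : ∀ v w, g p v w = Q (ψ v) (ψ w) := by
    intro v w
    have := h.metric_eq p hp (T.symm v) (T.symm w)
    rw [← hTa, ← hTa, T.apply_symm_apply, T.apply_symm_apply] at this
    exact this
  have hcurv : ∀ u v w, ψ (curvatureAt I g p u v w) = algCurvature Γ (ψ u) (ψ v) (ψ w) := by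
    intro u v w
    have hs : ∀ v : TangentSpace I p, ContMDiffAt I I.tangent 2
        (fun q => (⟨q, FiberBundle.extend E v q⟩ : TangentBundle I M)) p := fun v =>
      FiberBundle.contMDiffAt_extend I E v
    rw [curvatureAt, h.curvature_eq hbr hQs hQn hΓ' hp (hs u) (hs v) (hs w), ← hTa]
    simp only [FiberBundle.extend_apply_self, hTi]
    simp only [ψ, LinearEquiv.trans_apply, algCurvature, transportOp_apply, transportBracket_apply,
      LinearEquiv.symm_apply_apply, map_sub, ContinuousLinearEquiv.coe_toLinearEquiv,
      ContinuousLinearEquiv.symm_apply_apply]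
  have hfin : Module.finrank ℝ L = Module.finrank ℝ E := e.finrank_eq
  have : FiniteDimensional ℝ L := Module.Finite.equiv e.symm
  have hex : ∃ b : Module.Basis (Fin (Module.finrank ℝ E)) ℝ (TangentSpace I p),
      OrthonormalFor (g p) b := by
    obtain ⟨v, hv⟩ := hQ.exists_orthonormal_basis
    refine ⟨(v.reindex (finCongr hfin)).map ψ.symm, fun i j => ?_⟩
    rw [hψ]
    simp [hv _ _]
  rw [ricciNormSq, dif_pos hex]
  set b := hex.choose with hb
  have hbs : OrthonormalFor (g p) b := hex.choose_spec
  refine ⟨b.map ψ, fun i j => ?_, ?_⟩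
  · rw [Module.Basis.map_apply, Module.Basis.map_apply, ← hψ]
    exact hbs i j
  · simp only [algRicciNormSq, ricciAt, hψ, hcurv, Module.Basis.map_apply]

end FrameRicci

/-! ### Left invariant frames and their pullbacks under local isometries -/

section LieGroupFrames

open Filter Topology VectorField

variable {E : Type*} [NormedAddCommGroup E] [NormedSpace ℝ E]
  {H : Type*} [TopologicalSpace H] {I : ModelWithCorners ℝ E H}
  {G : Type*} [TopologicalSpace G] [ChartedSpace H G] [Group G]

variable (I) in
/-- The frame of left invariant vector fields. -/
def leftFrame (q : G) : E →L[ℝ] TangentSpace I q :=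
  (mfderiv I I (fun y : G => q * y) (1 : G) : E →L[ℝ] E)

theorem leftFrame_eq (u : E) :
    (fun q : G => leftFrame I q u) = mulInvariantVectorField (I := I) (G := G) u := rfl

variable [LieGroup I ∞ G]

theorem mfderiv_mul_left_comp (q : G) :
    (mfderiv I I (fun y : G => q⁻¹ * y) q : E →L[ℝ] E).comp
      (mfderiv I I (fun y : G => q * y) (1 : G) : E →L[ℝ] E) = ContinuousLinearMap.id ℝ E := by
  have hd : ∀ a x : G, MDifferentiableAt I I (fun y : G => a * y) x := fun a x =>
    (contMDiff_mul_left (I := I) (n := ∞) (a := a)).mdifferentiable (by simp) x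
  have h1 : mfderiv I I ((fun y : G => q⁻¹ * y) ∘ fun y : G => q * y) (1 : G) = _ :=
    mfderiv_comp (1 : G) (hd q⁻¹ (q * 1)) (hd q 1)
  have h2 : ((fun y : G => q⁻¹ * y) ∘ fun y : G => q * y) = id := by ext; simp
  -- The chain rule produces the derivative at `q * 1` instead of `q`. Its type depends on the
  -- point, so the point is replaced in a statement about operators on the model space `E`.
  have h3 : ∀ x : G, x = q → (mfderiv I I (fun y : G => q⁻¹ * y) x : E →L[ℝ] E) =
      mfderiv I I (fun y : G => q⁻¹ * y) q := by
    rintro x rfl; rfl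
  have h4 : (mfderiv I I (id : G → G) 1 : E →L[ℝ] E) = ContinuousLinearMap.id ℝ E := mfderiv_id
  rw [← h4, ← h2]
  refine Eq.trans ?_ h1.symm
  rw [← h3 (q * 1) (mul_one q)]
  rfl

theorem mfderiv_mul_left_comp' (q : G) :
    (mfderiv I I (fun y : G => q * y) (1 : G) : E →L[ℝ] E).comp
      (mfderiv I I (fun y : G => q⁻¹ * y) q : E →L[ℝ] E) = ContinuousLinearMap.id ℝ E := by
  have hd : ∀ a x : G, MDifferentiableAt I I (fun y : G => a * y) x := fun a x =>
    (contMDiff_mul_left (I := I) (n := ∞) (a := a)).mdifferentiable (by simp) x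
  have h1 : mfderiv I I ((fun y : G => q * y) ∘ fun y : G => q⁻¹ * y) q = _ :=
    mfderiv_comp q (hd q (q⁻¹ * q)) (hd q⁻¹ q)
  have h2 : ((fun y : G => q * y) ∘ fun y : G => q⁻¹ * y) = id := by ext; simp
  have h3 : ∀ x : G, x = 1 → (mfderiv I I (fun y : G => q * y) x : E →L[ℝ] E) =
      mfderiv I I (fun y : G => q * y) 1 := by
    rintro x rfl; rfl
  have h4 : (mfderiv I I (id : G → G) q : E →L[ℝ] E) = ContinuousLinearMap.id ℝ E := mfderiv_id
  rw [← h4, ← h2]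
  refine Eq.trans ?_ h1.symm
  rw [← h3 (q⁻¹ * q) (inv_mul_cancel q)]
  rfl

theorem leftTranslateToOne_leftFrame (q : G) (u : E) :
    leftTranslateToOne I q (leftFrame I q u) = u :=
  congrArg (fun A : E →L[ℝ] E => A u) (mfderiv_mul_left_comp (I := I) q)

variable [CompleteSpace E]

variable (G) in
theorem isTangentFrameOn_leftFrame :
    IsTangentFrameOn (I := I) (leftFrame I : ∀ q : G, E →L[ℝ] TangentSpace I q) Set.univ where
  isOpen := isOpen_univ
  isInvertible q _ := ContinuousLinearMap.IsInvertible.of_inverse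
    (g := (mfderiv I I (fun y : G => q⁻¹ * y) q : E →L[ℝ] E))
    (mfderiv_mul_left_comp' q) (mfderiv_mul_left_comp q)
  contMDiffAt u q _ := by
    exact (contMDiffAt_mulInvariantVectorField (I := I) (G := G) u (g := q)).of_le
      (le_minSmoothness (n := 2))

variable {L : Type*} [LieRing L] [LieAlgebra ℝ L]

/-- An identification of `L` with the Lie algebra of `G`, as an identification with the model
space. -/
def modelEquiv (e : L ≃ₗ⁅ℝ⁆ GroupLieAlgebra I G) : L ≃ₗ[ℝ] E := e.toLinearEquiv

variable [FiniteDimensional ℝ E]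

theorem mlieBracket_leftFrame (e : L ≃ₗ⁅ℝ⁆ GroupLieAlgebra I G) (u v : E) (q : G) :
    mlieBracket I (fun q : G => leftFrame I q u) (fun q => leftFrame I q v) q =
      leftFrame I q (transportBracket (modelEquiv e) u v) := by
  have h := congrFun (mulInvariantVector_mlieBracket (I := I) (G := G) u v) q
  rw [leftFrame_eq, leftFrame_eq, ← h]
  have h2 : transportBracket (modelEquiv e) u v =
      mlieBracket I (mulInvariantVectorField u) (mulInvariantVectorField v) (1 : G) := by
    have h3 : ∀ x y : GroupLieAlgebra I G, e ⁅e.symm x, e.symm y⁆ = ⁅x, y⁆ := fun x y => by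
      rw [LieEquiv.map_lie, LieEquiv.apply_symm_apply, LieEquiv.apply_symm_apply]
    exact h3 u v
  rw [h2]
  rfl

theorem metricOfForm_leftFrame (e : L ≃ₗ⁅ℝ⁆ GroupLieAlgebra I G) (B : LinearMap.BilinForm ℝ L)
    (q : G) (u v : E) :
    metricOfForm I e B q (leftFrame I q u) (leftFrame I q v) =
      transportForm (modelEquiv e) B u v := by
  change B (e.symm (leftTranslateToOne I q (leftFrame I q u)))
    (e.symm (leftTranslateToOne I q (leftFrame I q v))) = _
  rw [leftTranslateToOne_leftFrame, leftTranslateToOne_leftFrame]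
  rfl

theorem isHomogeneousFrameOn_leftFrame (e : L ≃ₗ⁅ℝ⁆ GroupLieAlgebra I G)
    (B : LinearMap.BilinForm ℝ L) :
    IsHomogeneousFrameOn (metricOfForm I e B) (transportBracket (modelEquiv e))
      (transportForm (modelEquiv e) B) (leftFrame I) Set.univ where
  toIsTangentFrameOn := isTangentFrameOn_leftFrame G
  mlieBracket_eq u v q _ := mlieBracket_leftFrame e u v q
  metric_eq q _ u v := metricOfForm_leftFrame e B q u v

/-- The derivative of the local inverse is a two-sided inverse by the chain rule. -/
theorem isInvertible_mfderiv_of_openPartialHomeomorph {Φ : OpenPartialHomeomorph G G}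
    (h1 : ContMDiffOn I I ∞ Φ Φ.source) (h2 : ContMDiffOn I I ∞ Φ.symm Φ.target)
    {q : G} (hq : q ∈ Φ.source) : (mfderiv I I Φ q).IsInvertible := by
  have d1 : MDifferentiableAt I I Φ q :=
    (h1.contMDiffAt (Φ.open_source.mem_nhds hq)).mdifferentiableAt (by simp)
  have d2 : MDifferentiableAt I I Φ.symm (Φ q) :=
    (h2.contMDiffAt (Φ.open_target.mem_nhds (Φ.map_source hq))).mdifferentiableAt (by simp)
  have d1' : MDifferentiableAt I I Φ (Φ.symm (Φ q)) := by rwa [Φ.left_inv hq]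
  have c1 : mfderiv I I (Φ.symm ∘ Φ) q = _ := mfderiv_comp q d2 d1
  have c2 : mfderiv I I (Φ ∘ Φ.symm) (Φ q) = _ := mfderiv_comp (Φ q) d1' d2
  have e1 : (Φ.symm ∘ Φ) =ᶠ[𝓝 q] id := by
    filter_upwards [Φ.open_source.mem_nhds hq] with x hx using Φ.left_inv hx
  have e2 : (Φ ∘ Φ.symm) =ᶠ[𝓝 (Φ q)] id := by
    filter_upwards [Φ.open_target.mem_nhds (Φ.map_source hq)] with x hx using Φ.right_inv hx
  have h3 : ∀ x, x = q → (mfderiv I I Φ x : E →L[ℝ] E) = mfderiv I I Φ q := by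
    rintro x rfl; rfl
  have k1 : (mfderiv I I (Φ.symm ∘ Φ) q : E →L[ℝ] E) = ContinuousLinearMap.id ℝ E :=
    e1.mfderiv_eq.trans mfderiv_id
  have k2 : (mfderiv I I (Φ ∘ Φ.symm) (Φ q) : E →L[ℝ] E) = ContinuousLinearMap.id ℝ E :=
    e2.mfderiv_eq.trans mfderiv_id
  refine ContinuousLinearMap.IsInvertible.of_inverse
    (g := (mfderiv I I Φ.symm (Φ q) : E →L[ℝ] E)) ?_ ?_
  · refine Eq.trans ?_ (c2.symm.trans k2)
    rw [h3 _ (Φ.left_inv hq)]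
    rfl
  · exact c1.symm.trans k1

/-- This replaces the naturality of the Levi-Civita connection. Pullback commutes with Lie brackets,
so the structure constants survive, and the isometry property makes the coefficients of `g` those of
the target metric. Hence `‖Ric‖²` of `g` is given by the algebraic data of the target. -/
theorem isHomogeneousFrameOn_pullback (e : L ≃ₗ⁅ℝ⁆ GroupLieAlgebra I G)
    (B : LinearMap.BilinForm ℝ L) {g : MetricTensor I G} {Φ : OpenPartialHomeomorph G G}
    (h1 : ContMDiffOn I I ∞ Φ Φ.source) (h2 : ContMDiffOn I I ∞ Φ.symm Φ.target)
    (h3 : ∀ x ∈ Φ.source, ∀ u v : TangentSpace I x,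
      metricOfForm I e B (Φ x) (mfderiv I I Φ x u) (mfderiv I I Φ x v) = g x u v) :
    IsHomogeneousFrameOn g (transportBracket (modelEquiv e))
      (transportForm (modelEquiv e) B)
      (fun q => (mfderiv I I Φ q).inverse.comp (leftFrame I (Φ q))) Φ.source where
  isOpen := Φ.open_source
  isInvertible q hq := by
    have hi := isInvertible_mfderiv_of_openPartialHomeomorph h1 h2 hq
    exact hi.inverse.comp ((isTangentFrameOn_leftFrame G).isInvertible (Φ q) (Set.mem_univ _))
  contMDiffAt u q hq := by
    have hi := isInvertible_mfderiv_of_openPartialHomeomorph h1 h2 hq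
    exact ContMDiffAt.mpullback_vectorField_preimage (n := ∞)
      ((isTangentFrameOn_leftFrame G).contMDiffAt u (Φ q) (Set.mem_univ _))
      (h1.contMDiffAt (Φ.open_source.mem_nhds hq)) hi
      (by rw [show (2 : ℕ∞ω) + 1 = ((3 : ℕ∞) : ℕ∞ω) by norm_num]; exact_mod_cast le_top)
  mlieBracket_eq u v q hq := by
    have h := mpullback_mlieBracket (I := I) (I' := I) (n := ∞)
      ((isTangentFrameOn_leftFrame G).mdifferentiableAt (Set.mem_univ (Φ q)) u)
      ((isTangentFrameOn_leftFrame G).mdifferentiableAt (Set.mem_univ (Φ q)) v)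
      (h1.contMDiffAt (Φ.open_source.mem_nhds hq))
      (by rw [minSmoothness_of_isRCLikeNormedField,
        show (2 : ℕ∞ω) = ((2 : ℕ∞) : ℕ∞ω) from rfl]; exact_mod_cast le_top)
    refine h.symm.trans ?_
    rw [mpullback_apply, mlieBracket_leftFrame e]
    rfl
  metric_eq q hq u v := by
    have hi := isInvertible_mfderiv_of_openPartialHomeomorph h1 h2 hq
    rw [← h3 q hq, ← metricOfForm_leftFrame e B (Φ q)]
    congr 1
    · exact congrArg _ (hi.self_apply_inverse _)
    · exact hi.self_apply_inverse _

/-- Left invariant metrics whose Ricci tensors have different norms, as computed in the Lie algebra,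
are not locally isometric. -/
theorem ricciNormVaries_of_algRicciNormSq (e : L ≃ₗ⁅ℝ⁆ GroupLieAlgebra I G) {ε : ℝ}
    (B : ℝ → LinearMap.BilinForm ℝ L) (c : ℝ → ℝ)
    (hB : ∀ t ∈ Set.Ioo (-ε) ε, IsScalarProduct (B t))
    (hc : ∀ t ∈ Set.Ioo (-ε) ε, ∀ Γ, IsAlgLeviCivita (B t) Γ →
      ∀ u : Module.Basis (Fin (Module.finrank ℝ E)) ℝ L, OrthonormalFor (B t) u →
        algRicciNormSq (B t) Γ u = c t)
    (hne : ∃ s ∈ Set.Ioo (-ε) ε, ∃ t ∈ Set.Ioo (-ε) ε, c s ≠ c t) :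
    RicciNormVaries I ε fun t => metricOfForm I e (B t) := by
  have : FiniteDimensional ℝ L := Module.Finite.equiv (modelEquiv e).symm
  refine ⟨c, fun t ht p => ?_, hne, fun s hs t ht hst => ?_⟩
  · obtain ⟨Γ, hΓ⟩ := (hB t ht).exists_isAlgLeviCivita
    obtain ⟨u, hu, h⟩ := (isHomogeneousFrameOn_leftFrame e (B t)).ricciNormSq_eq
      (Set.mem_univ p) (hB t ht) hΓ
    rw [h, hc t ht Γ hΓ u hu]
  · rintro ⟨Φ, ⟨p, hp⟩, h1, h2, h3⟩
    obtain ⟨Γ, hΓ⟩ := (hB s hs).exists_isAlgLeviCivita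
    obtain ⟨Γ', hΓ'⟩ := (hB t ht).exists_isAlgLeviCivita
    obtain ⟨u, hu, h⟩ := (isHomogeneousFrameOn_leftFrame e (B s)).ricciNormSq_eq
      (Set.mem_univ p) (hB s hs) hΓ
    -- `‖Ric‖²` of `g s` at the one point `p` is computed a second time, in the frame pulled back
    -- from the target, and there it equals `c t`.
    obtain ⟨u', hu', h'⟩ := (isHomogeneousFrameOn_pullback e (B t) h1 h2 h3).ricciNormSq_eq
      hp (hB t ht) hΓ'
    rw [hc s hs Γ hΓ u hu] at h
    rw [hc t ht Γ' hΓ' u' hu'] at h'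
    exact hst (h.symm.trans h')

end LieGroupFrames

/-! ### The Ricci tensor as a trace, for unimodular Lie algebras -/

section AlgebraicRicci

variable {L : Type*} [LieRing L] [LieAlgebra ℝ L]

theorem OrthonormalFor.trace_eq_sum {V ι : Type*} [AddCommGroup V] [Module ℝ V] [Fintype ι]
    [DecidableEq ι] {B : LinearMap.BilinForm ℝ V} {v : Module.Basis ι ℝ V}
    (hv : OrthonormalFor B v) (A : Module.End ℝ V) :
    LinearMap.trace ℝ V A = ∑ k, B (A (v k)) (v k) := by
  rw [LinearMap.trace_eq_matrix_trace ℝ v, Matrix.trace]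
  refine Finset.sum_congr rfl fun k _ => ?_
  rw [Matrix.diag_apply, LinearMap.toMatrix_apply, hv.repr_eq]

/-- Parseval's identity. -/
theorem OrthonormalFor.sum_mul {V ι : Type*} [AddCommGroup V] [Module ℝ V] [Fintype ι]
    [DecidableEq ι] {B : LinearMap.BilinForm ℝ V} {v : Module.Basis ι ℝ V}
    (hv : OrthonormalFor B v) (x y : V) : ∑ k, B x (v k) * B y (v k) = B x y := by
  conv_rhs => rw [← v.sum_repr x, map_sum, LinearMap.sum_apply]
  refine Finset.sum_congr rfl fun k _ => ?_
  rw [map_smul, LinearMap.smul_apply, hv.repr_eq, smul_eq_mul]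
  congr 1
  conv_rhs => rw [← v.sum_repr y, map_sum]
  simp [hv _ _, hv.repr_eq]

/-- In this form it shows that a skew operator has trace zero, and that the trace of a symmetric
times a skew operator is zero. -/
theorem IsScalarProduct.trace_eq_of_adjoint {V : Type*} [AddCommGroup V] [Module ℝ V]
    [FiniteDimensional ℝ V] {B : LinearMap.BilinForm ℝ V} (hB : IsScalarProduct B)
    {A A' : Module.End ℝ V} (h : ∀ x y, B (A x) y = B x (A' y)) :
    LinearMap.trace ℝ V A = LinearMap.trace ℝ V A' := by
  obtain ⟨v, hv⟩ := hB.exists_orthonormal_basis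
  rw [hv.trace_eq_sum, hv.trace_eq_sum]
  exact Finset.sum_congr rfl fun k _ => by rw [h, hB.1]

theorem IsScalarProduct.eq_of_forall {V : Type*} [AddCommGroup V] [Module ℝ V]
    {B : LinearMap.BilinForm ℝ V} (hB : IsScalarProduct B) {x y : V} (h : ∀ z, B x z = B y z) :
    x = y := by
  by_contra hne
  have := hB.2 (x - y) (sub_ne_zero.2 hne)
  rw [LinearMap.map_sub₂, h, sub_self] at this
  exact this.false

namespace IsAlgLeviCivita

variable {Q : LinearMap.BilinForm ℝ L} {Γ : L →ₗ[ℝ] L →ₗ[ℝ] L}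

theorem torsion_free (h : IsAlgLeviCivita Q Γ) (hQ : IsScalarProduct Q) (x y : L) :
    Γ x y - Γ y x = ⁅x, y⁆ := by
  refine hQ.eq_of_forall fun z => ?_
  have h1 := h x y z
  have h2 := h y x z
  rw [← lie_skew y x, ← lie_skew z y, ← lie_skew x z] at h2
  simp only [map_neg, map_sub, LinearMap.neg_apply, LinearMap.sub_apply] at h2 ⊢
  linarith

theorem skew (h : IsAlgLeviCivita Q Γ) (hQ : IsScalarProduct Q) (x y z : L) :
    Q (Γ x y) z = -Q y (Γ x z) := by
  have h1 := h x y z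
  have h2 := h x z y
  rw [← lie_skew z y, ← lie_skew y x, ← lie_skew x z] at h2
  rw [hQ.1 y]
  simp only [map_neg, LinearMap.neg_apply] at h2
  linarith

/-- The Ricci tensor of a left invariant metric on a unimodular Lie group. -/
theorem ricci_eq [FiniteDimensional ℝ L] (h : IsAlgLeviCivita Q Γ) (hQ : IsScalarProduct Q)
    (huni : ∀ x : L, LinearMap.trace ℝ L (LieAlgebra.ad ℝ L x) = 0)
    {ι : Type*} [Fintype ι] [DecidableEq ι] {u : Module.Basis ι ℝ L} (hu : OrthonormalFor Q u)
    (y z : L) :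
    ∑ k, Q (algCurvature Γ (u k) y z) (u k) =
      -LinearMap.trace ℝ L ((Γ.flip z : Module.End ℝ L) * (Γ.flip y : Module.End ℝ L)) := by
  -- No torsion: `ad w = ∇_w - ∇w`. The operator `∇_w` is skew and `ad w` is trace-free by
  -- unimodularity, so `∇w` is trace-free too.
  have had : ∀ w : L, (LieAlgebra.ad ℝ L w : Module.End ℝ L) = Γ w - Γ.flip w := by
    intro w
    ext x
    simp [h.torsion_free hQ]
  have htr : ∀ w : L, LinearMap.trace ℝ L (Γ w : Module.End ℝ L) = 0 := by
    intro w
    have h1 : LinearMap.trace ℝ L (Γ w : Module.End ℝ L) =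
        LinearMap.trace ℝ L (-(Γ w) : Module.End ℝ L) :=
      hQ.trace_eq_of_adjoint fun x y => by
        rw [h.skew hQ, LinearMap.neg_apply, map_neg]
    rw [map_neg] at h1
    linarith
  have htr' : ∀ w : L, LinearMap.trace ℝ L (Γ.flip w : Module.End ℝ L) = 0 := by
    intro w
    have h1 := huni w
    rw [had, map_sub, htr] at h1
    linarith
  -- As an operator in its first argument, the curvature is `∇(∇_y z) - ∇_y ∘ ∇z + ∇z ∘ ad y`. In
  -- the trace the first summand vanishes, and the two products of `∇_y` with `∇z` cancel once `ad
  -- y` is split.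
  have hop : ∀ x, algCurvature Γ x y z = ((Γ.flip (Γ y z) : Module.End ℝ L)
      - (Γ y : Module.End ℝ L) * (Γ.flip z : Module.End ℝ L)
      + (Γ.flip z : Module.End ℝ L) * (LieAlgebra.ad ℝ L y : Module.End ℝ L)) x := by
    intro x
    rw [algCurvature, ← lie_skew x y]
    simp [-lie_skew]
  simp only [hop]
  rw [← hu.trace_eq_sum, had, mul_sub, map_add, map_sub, map_sub, htr',
    LinearMap.trace_mul_comm ℝ (Γ y : Module.End ℝ L)]
  ring

end IsAlgLeviCivita

end AlgebraicRicci

/-! ### The deformed metric and the covariant derivatives of left invariant fields -/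

section Deformation

variable {L : Type*} [LieRing L] [LieAlgebra ℝ L]

/-- The endomorphism `x ↦ ∑ᵢ ⟨x, aᵢ⟩ bᵢ`. -/
def rankTwo (g : LinearMap.BilinForm ℝ L) (a b : Fin 2 → L) : Module.End ℝ L :=
  ∑ i, (g.flip (a i)).smulRight (b i)

theorem rankTwo_apply (g : LinearMap.BilinForm ℝ L) (a b : Fin 2 → L) (x : L) :
    rankTwo g a b x = ∑ i, g x (a i) • b i := by
  simp [rankTwo]

theorem trace_rankTwo_mul [FiniteDimensional ℝ L] (g : LinearMap.BilinForm ℝ L) (a b : Fin 2 → L)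
    (A : Module.End ℝ L) :
    LinearMap.trace ℝ L (rankTwo g a b * A) = ∑ i, g (A (b i)) (a i) := by
  have h : rankTwo g a b * A = ∑ i, ((g.flip (a i)).comp A).smulRight (b i) := by
    ext x
    simp [rankTwo_apply]
  rw [h, map_sum]
  exact Finset.sum_congr rfl fun i _ => LinearMap.trace_smulRight _ _

/-- Only the pairings `g(A d_k, a_i)` enter such a product. All nilpotency relations between `λ`,
`μ` and `ad` come from here. -/
theorem rankTwo_mul_mul_rankTwo (g : LinearMap.BilinForm ℝ L) (a b c d : Fin 2 → L)
    (A : Module.End ℝ L) (h : ∀ i k, g (A (d k)) (a i) = 0) :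
    rankTwo g a b * (A * rankTwo g c d) = 0 := by
  ext x
  simp [rankTwo_apply, h]

/-- The data for the deformation `(Id + λ)^* g` of a bi-invariant scalar product: `Z` is an
orthonormal basis of an abelian subalgebra, and `j` has values in the orthogonal complement of this
subalgebra and commutes with it. -/
structure IsDeformation (g : LinearMap.BilinForm ℝ L) (Z j : Fin 2 → L) : Prop where
  scalar : IsScalarProduct g
  inv : ∀ x y z, g ⁅x, y⁆ z = g x ⁅y, z⁆
  lie_Z : ∀ i k, ⁅Z i, Z k⁆ = 0
  lie_j : ∀ i k, ⁅j i, Z k⁆ = 0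
  ortho : ∀ i k, g (j i) (Z k) = 0
  orthonormal : ∀ i k, g (Z i) (Z k) = if i = k then 1 else 0

namespace IsDeformation

variable {g : LinearMap.BilinForm ℝ L} {Z j : Fin 2 → L}

local notation "ad" => fun x => (LieAlgebra.ad ℝ L x : Module.End ℝ L)

theorem lie_Zj (h : IsDeformation g Z j) (i k : Fin 2) : ⁅Z i, j k⁆ = 0 := by
  rw [← lie_skew, h.lie_j, neg_zero]

theorem ortho' (h : IsDeformation g Z j) (i k : Fin 2) : g (Z i) (j k) = 0 := by
  rw [h.scalar.1, h.ortho]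

theorem adjoint (h : IsDeformation g Z j) (a b : Fin 2 → L) (x y : L) :
    g (rankTwo g a b x) y = g x (rankTwo g b a y) := by
  simp only [rankTwo_apply, map_sum, map_smul, LinearMap.sum_apply, LinearMap.smul_apply,
    smul_eq_mul]
  exact Finset.sum_congr rfl fun i _ => by rw [h.scalar.1 y, mul_comm]

theorem skew (h : IsDeformation g Z j) (w x y : L) : g ⁅w, x⁆ y = -g x ⁅w, y⁆ := by
  rw [← lie_skew, map_neg, LinearMap.neg_apply, h.inv]

theorem lam_lam (h : IsDeformation g Z j) : rankTwo g j Z * rankTwo g j Z = 0 := by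
  have := rankTwo_mul_mul_rankTwo g j Z j Z 1 fun i k => h.ortho' k i
  rwa [one_mul] at this

theorem mu_mu (h : IsDeformation g Z j) : rankTwo g Z j * rankTwo g Z j = 0 := by
  have := rankTwo_mul_mul_rankTwo g Z j Z j 1 fun i k => h.ortho k i
  rwa [one_mul] at this

/-- By invariance `g([w, Z_k], j_i) = g(w, [Z_k, j_i])`, and the bracket on the right is zero.
`mu_ad_mu` and `mu_ad_lam` hold for the same reason. The fourth combination `λ ∘ ad w ∘ μ` involves
`[j_k, j_i]` and survives; it is the source of the terms `ad(jᵢ)²`. -/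
theorem lam_ad_lam (h : IsDeformation g Z j) (w : L) :
    rankTwo g j Z * (ad w * rankTwo g j Z) = 0 :=
  rankTwo_mul_mul_rankTwo g j Z j Z _ fun i k => by
    rw [LieAlgebra.ad_apply, h.inv, h.lie_Zj, map_zero]

theorem mu_ad_mu (h : IsDeformation g Z j) (w : L) :
    rankTwo g Z j * (ad w * rankTwo g Z j) = 0 :=
  rankTwo_mul_mul_rankTwo g Z j Z j _ fun i k => by
    rw [LieAlgebra.ad_apply, h.inv, h.lie_j, map_zero]

theorem mu_ad_lam (h : IsDeformation g Z j) (w : L) :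
    rankTwo g Z j * (ad w * rankTwo g j Z) = 0 :=
  rankTwo_mul_mul_rankTwo g Z j j Z _ fun i k => by
    rw [LieAlgebra.ad_apply, h.inv, h.lie_Z, map_zero]

theorem one_add_one_sub (h : IsDeformation g Z j) :
    (1 + rankTwo g j Z) * (1 - rankTwo g j Z) = 1 := by
  rw [add_mul, mul_sub, mul_sub, h.lam_lam]
  simp

theorem one_sub_one_add (h : IsDeformation g Z j) :
    (1 - rankTwo g j Z) * (1 + rankTwo g j Z) = 1 := by
  rw [sub_mul, mul_add, mul_add, h.lam_lam]
  simp

theorem isScalarProduct (h : IsDeformation g Z j) :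
    IsScalarProduct (g.comp (1 + rankTwo g j Z : Module.End ℝ L) (1 + rankTwo g j Z : Module.End ℝ L)) := by
  refine ⟨fun x y => h.scalar.1 _ _, fun x hx => h.scalar.2 _ fun h0 => hx ?_⟩
  have h1 := congrArg (fun A : Module.End ℝ L => A x) h.one_sub_one_add
  change (1 - rankTwo g j Z) ((1 + rankTwo g j Z) x) = x at h1
  rw [← h1, h0, map_zero]

/-- The covariant derivative of the left invariant field `y`, in terms of the operators `λ`, its
transpose `μ`, and the adjoint representation. -/
theorem conj_flip_eq (h : IsDeformation g Z j) {Γ : L →ₗ[ℝ] L →ₗ[ℝ] L}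
    (hΓ : IsAlgLeviCivita
      (g.comp (1 + rankTwo g j Z : Module.End ℝ L) (1 + rankTwo g j Z : Module.End ℝ L)) Γ) (y : L) :
    (2 : ℝ) • ((1 + rankTwo g j Z) *
      ((Γ.flip ((1 - rankTwo g j Z) y) : Module.End ℝ L) * (1 - rankTwo g j Z))) =
    -((rankTwo g j Z * ad ((1 - rankTwo g j Z) y) - ad ((1 - rankTwo g j Z) y) * rankTwo g j Z
      + rankTwo g Z j * ad ((1 - rankTwo g j Z) y) - ad ((1 - rankTwo g j Z) y) * rankTwo g Z j)
      + (ad ((1 + rankTwo g Z j) y) - rankTwo g Z j * ad ((1 + rankTwo g Z j) y)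
        - ad ((1 + rankTwo g Z j) y) * rankTwo g j Z)) := by
  set l := rankTwo g j Z with hl
  set m := rankTwo g Z j with hm
  have hlm : ∀ x y, g (l x) y = g x (m y) := h.adjoint j Z
  have hml : ∀ x y, g (m x) y = g x (l y) := h.adjoint Z j
  set p := ad ((1 - l) y) with hp
  set q := ad ((1 + m) y) with hq
  have hskp : ∀ x z, g (p x) z = -g x (p z) := fun x z => h.skew _ x z
  -- The Koszul formula at the images under `1 - λ` of `x`, `y`, `z`. Each of its three terms is
  -- moved, by transposition and skewness of `ad`, to a form in which `z` stands alone in the second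
  -- slot; the nilpotency relations then remove the products with `λ` or `μ` on both sides.
  have main : (2 : ℝ) • ((1 + l) * ((Γ.flip ((1 - l) y) : Module.End ℝ L) * (1 - l))) =
      -((1 + l) * (p * (1 - l)) - (1 - m) * (p * (1 + m)) + (1 - m) * (q * (1 - l))) := by
    refine LinearMap.ext fun x => h.scalar.eq_of_forall fun z => ?_
    have hK := hΓ ((1 - l) x) ((1 - l) y) ((1 - l) z)
    have hT : ∀ v, (1 + l) ((1 - l) v) = v := fun v =>
      congrArg (fun A : Module.End ℝ L => A v) h.one_add_one_sub
    have hadd : ∀ a b, g ((1 + l) a) b = g a ((1 + m) b) := fun a b => by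
      simp only [LinearMap.add_apply, Module.End.one_apply, map_add, LinearMap.add_apply, hlm]
    have hsub : ∀ a b, g ((1 - l) a) b = g a ((1 - m) b) := fun a b => by
      simp only [LinearMap.sub_apply, Module.End.one_apply, map_sub, LinearMap.sub_apply, hlm]
    simp only [LinearMap.BilinForm.comp_apply, hT] at hK
    have e1 : g ((1 + l) ⁅(1 - l) x, (1 - l) y⁆) z = -g (((1 + l) * (p * (1 - l))) x) z := by
      rw [← lie_skew, map_neg, map_neg, LinearMap.neg_apply]
      rfl
    have e2 : g ((1 + l) ⁅(1 - l) y, (1 - l) z⁆) x = -g (((1 - m) * (p * (1 + m))) x) z := by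
      change g ((1 + l) (p ((1 - l) z))) x = -g ((1 - m) (p ((1 + m) x))) z
      rw [hadd, hskp, hsub, h.scalar.1]
    have e3 : g ((1 + l) ⁅(1 - l) z, (1 - l) x⁆) y = -g (((1 - m) * (q * (1 - l))) x) z := by
      change g ((1 + l) ⁅(1 - l) z, (1 - l) x⁆) y = -g ((1 - m) (q ((1 - l) x))) z
      rw [hadd, h.scalar.1 _ z, ← hsub, h.inv, ← lie_skew, map_neg]
      rfl
    rw [e1, e2, e3] at hK
    have e6 : g (((2 : ℝ) • ((1 + l) * ((Γ.flip ((1 - l) y) : Module.End ℝ L) * (1 - l)))) x) z =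
        2 * g ((1 + l) (Γ ((1 - l) x) ((1 - l) y))) z := by
      rw [LinearMap.smul_apply, map_smul, LinearMap.smul_apply, smul_eq_mul]
      rfl
    rw [e6, hK, LinearMap.neg_apply, map_neg, LinearMap.neg_apply, LinearMap.add_apply, map_add,
      LinearMap.add_apply, LinearMap.sub_apply, map_sub, LinearMap.sub_apply]
    ring
  rw [main]
  have z1 : l * (p * l) = 0 := h.lam_ad_lam _
  have z2 : m * (p * m) = 0 := h.mu_ad_mu _
  have z3 : m * (q * l) = 0 := h.mu_ad_lam _
  congr 1
  simp only [mul_add, add_mul, mul_sub, sub_mul, one_mul, mul_one, z1, z2, z3]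
  abel

end IsDeformation

end Deformation

/-! ### The Ricci operator of the deformed metric -/

section DeformationRicci

variable {L : Type*} [LieRing L] [LieAlgebra ℝ L]

local notation "tr" => LinearMap.trace ℝ L

theorem trace_mul_cycle₄ (A B C D : Module.End ℝ L) :
    tr (A * (B * (C * D))) = tr (B * (C * (D * A))) := by
  rw [LinearMap.trace_mul_comm]
  simp only [mul_assoc]

theorem trace_mul_cycle₃ (A B C : Module.End ℝ L) : tr (A * (B * C)) = tr (B * (C * A)) := by
  rw [LinearMap.trace_mul_comm, mul_assoc]

/-- All sixteen terms are turned cyclically. A term dies when `λλ`, `μμ` or one of the sandwiches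
which are assumed to vanish appears; those with `λ` and `μ` adjacent up to rotation in a
nonvanishing order are left. -/
theorem trace_commutator_mul_commutator {l m p P : Module.End ℝ L} (hl : l * l = 0)
    (hm : m * m = 0) (h1 : l * (p * l) = 0) (h2 : m * (p * m) = 0) (h3 : m * (p * l) = 0)
    (h4 : m * (P * l) = 0) :
    tr ((l * p - p * l + m * p - p * m) * (l * P - P * l + m * P - P * m)) =
      -tr (m * (p * (P * l))) - tr (m * (P * (p * l))) - tr (l * (p * (P * m)))
        - tr (l * (P * (p * m))) := by
  have c1 : tr (p * (l * (l * P))) = 0 := by rw [← mul_assoc l l, hl]; simp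
  have c2 : tr (p * (m * (m * P))) = 0 := by rw [← mul_assoc m m, hm]; simp
  have d1 : tr (l * (p * (P * l))) = 0 := by
    rw [trace_mul_cycle₄, trace_mul_cycle₄, trace_mul_cycle₄, ← mul_assoc l l, hl]; simp
  have d2 : tr (m * (p * (P * m))) = 0 := by
    rw [trace_mul_cycle₄, trace_mul_cycle₄, trace_mul_cycle₄, ← mul_assoc m m, hm]; simp
  have d3 : tr (p * (l * (m * P))) = tr (m * (P * (p * l))) := by
    rw [trace_mul_cycle₄, trace_mul_cycle₄]
  have d4 : tr (p * (m * (l * P))) = tr (l * (P * (p * m))) := by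
    rw [trace_mul_cycle₄, trace_mul_cycle₄]
  have d5 : tr (l * (p * (m * P))) = 0 := by
    rw [trace_mul_cycle₄, trace_mul_cycle₄, ← mul_assoc P, ← mul_assoc m, h4]; simp
  have d6 : tr (p * (m * (P * l))) = 0 := by rw [h4]; simp
  have d7 : tr (p * (l * (P * m))) = 0 := by
    rw [trace_mul_cycle₄, trace_mul_cycle₄, trace_mul_cycle₄, ← mul_assoc p, ← mul_assoc m, h3]; simp
  have d8 : tr (m * (p * (l * P))) = 0 := by rw [← mul_assoc p, ← mul_assoc m, h3]; simp
  have d9 : tr (l * (p * (l * P))) = 0 := by rw [← mul_assoc p, ← mul_assoc l, h1]; simp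
  have d10 : tr (m * (p * (m * P))) = 0 := by rw [← mul_assoc p, ← mul_assoc m, h2]; simp
  have d11 : tr (p * (l * (P * l))) = 0 := by
    rw [trace_mul_cycle₄, trace_mul_cycle₄, trace_mul_cycle₄, ← mul_assoc p, ← mul_assoc l, h1]; simp
  have d12 : tr (p * (m * (P * m))) = 0 := by
    rw [trace_mul_cycle₄, trace_mul_cycle₄, trace_mul_cycle₄, ← mul_assoc p, ← mul_assoc m, h2]; simp
  simp only [add_mul, sub_mul, mul_add, mul_sub, mul_assoc, map_add, map_sub, c1, c2, d1, d2, d3, d4,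
    d5, d6, d7, d8, d9, d10, d11, d12]
  ring

/-- Same method. Its last two terms are of the form which also occurs, with the opposite sign, in
`trace_commutator_mul_commutator`. -/
theorem trace_skew_mul_skew {l m q W : Module.End ℝ L} (h1 : l * (W * l) = 0)
    (h2 : m * (q * m) = 0) :
    tr ((q - m * q - q * l) * (W - m * W - W * l)) =
      tr (q * W) - tr (m * (q * W)) - tr (m * (W * q)) - tr (l * (q * W)) - tr (l * (W * q))
        + tr (m * (q * (W * l))) + tr (m * (W * (q * l))) := by
  have c1 : tr (q * (m * W)) = tr (m * (W * q)) := trace_mul_cycle₃ _ _ _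
  have c2 : tr (q * (W * l)) = tr (l * (q * W)) := (trace_mul_cycle₃ _ _ _).symm
  have c3 : tr (q * (l * W)) = tr (l * (W * q)) := trace_mul_cycle₃ _ _ _
  have c4 : tr (m * (q * (m * W))) = 0 := by rw [← mul_assoc q, ← mul_assoc m, h2]; simp
  have c5 : tr (q * (l * (W * l))) = 0 := by rw [h1]; simp
  have c6 : tr (q * (l * (m * W))) = tr (m * (W * (q * l))) := by
    rw [trace_mul_cycle₄, trace_mul_cycle₄]
  simp only [sub_mul, mul_sub, mul_assoc, map_sub, c1, c2, c3, c4, c5, c6]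
  ring

namespace IsDeformation

variable {g : LinearMap.BilinForm ℝ L} {Z j : Fin 2 → L}

local notation "ad" => fun x => (LieAlgebra.ad ℝ L x : Module.End ℝ L)

theorem lam_lie_j (h : IsDeformation g Z j) (x : L) (i : Fin 2) : ⁅rankTwo g j Z x, j i⁆ = 0 := by
  simp [rankTwo_apply, h.lie_Zj]

theorem mu_lie_Z (h : IsDeformation g Z j) (x : L) (i : Fin 2) : ⁅rankTwo g Z j x, Z i⁆ = 0 := by
  simp [rankTwo_apply, h.lie_j]

/-- `μ ∘ λ` is the sum of the operators `⟨·, jᵢ⟩ jᵢ`. -/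
theorem mu_lam (h : IsDeformation g Z j) : rankTwo g Z j * rankTwo g j Z = rankTwo g j j := by
  ext x
  simp [rankTwo_apply, h.orthonormal]

/-- The operator `½ ∑ᵢ ad(jᵢ)² + ∑ᵢ ad(jᵢ) ad(Zᵢ)`. -/
def shape (Z j : Fin 2 → L) : Module.End ℝ L :=
  (1 / 2 : ℝ) • ∑ i, ad (j i) * ad (j i) + ∑ i, ad (j i) * ad (Z i)

theorem trace_ad [FiniteDimensional ℝ L] (h : IsDeformation g Z j) (x : L) : tr (ad x) = 0 := by
  have h1 : tr (ad x) = tr (-ad x) :=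
    h.scalar.trace_eq_of_adjoint fun y z => by
      rw [LinearMap.neg_apply, map_neg]
      exact h.skew x y z
  rw [map_neg] at h1
  linarith

/-- The left side is `4 tr(∇y ∘ ∇z)` after conjugation. The Killing form of `(1 + μ) y` and `(1 + μ)
z` gives the term with `K`, the traces containing `λ` and `μ` in the surviving order give `∑
ad(jᵢ)²`, and those containing just one of `λ`, `μ` give `∑ ad(jᵢ) ad(Zᵢ)`. -/
theorem trace_conj_mul_conj [FiniteDimensional ℝ L] (h : IsDeformation g Z j)
    {K : Module.End ℝ L} (hK : ∀ x y, tr (ad x * ad y) = -g (K x) y) (y z : L) :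
    tr (((rankTwo g j Z * ad ((1 - rankTwo g j Z) y) - ad ((1 - rankTwo g j Z) y) * rankTwo g j Z
      + rankTwo g Z j * ad ((1 - rankTwo g j Z) y) - ad ((1 - rankTwo g j Z) y) * rankTwo g Z j)
      + (ad ((1 + rankTwo g Z j) y) - rankTwo g Z j * ad ((1 + rankTwo g Z j) y)
        - ad ((1 + rankTwo g Z j) y) * rankTwo g j Z)) *
     ((rankTwo g j Z * ad ((1 - rankTwo g j Z) z) - ad ((1 - rankTwo g j Z) z) * rankTwo g j Z
      + rankTwo g Z j * ad ((1 - rankTwo g j Z) z) - ad ((1 - rankTwo g j Z) z) * rankTwo g Z j)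
      + (ad ((1 + rankTwo g Z j) z) - rankTwo g Z j * ad ((1 + rankTwo g Z j) z)
        - ad ((1 + rankTwo g Z j) z) * rankTwo g j Z))) =
    -g (((1 + rankTwo g j Z) * (K * (1 + rankTwo g Z j)) + (4 : ℝ) • shape Z j) y) z := by
  set l := rankTwo g j Z with hl
  set m := rankTwo g Z j with hm
  have hlm : ∀ x y, g (l x) y = g x (m y) := h.adjoint j Z
  have hml : ∀ x y, g (m x) y = g x (l y) := h.adjoint Z j
  have sk : ∀ w x y, g ((ad w) x) y = -g x ((ad w) y) := fun w x y => h.skew w x y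
  -- The first factor is the commutator of the symmetric `λ + μ` with a skew operator, hence
  -- symmetric; the second factor is skew. The trace of their product vanishes.
  have cross : ∀ a b, tr ((l * ad a - ad a * l + m * ad a - ad a * m) *
      (ad b - m * ad b - ad b * l)) = 0 := by
    intro a b
    have h1 : tr ((l * ad a - ad a * l + m * ad a - ad a * m) * (ad b - m * ad b - ad b * l)) =
        tr (-((ad b - m * ad b - ad b * l) * (l * ad a - ad a * l + m * ad a - ad a * m))) := by
      refine h.scalar.trace_eq_of_adjoint fun x y => ?_
      simp only [Module.End.mul_apply, LinearMap.sub_apply, LinearMap.add_apply, LinearMap.neg_apply,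
        map_sub, map_add, map_neg, hlm, hml, sk]
      ring
    rw [map_neg, LinearMap.trace_mul_comm] at h1
    rw [LinearMap.trace_mul_comm]
    linarith
  -- the terms with `λ ∘ μ` cancel
  have pl : ∀ w, ad ((1 - l) w) * l = ad ((1 + m) w) * l := by
    intro w
    ext x
    simp [hl, hm, rankTwo_apply, h.lie_Z, h.lie_j]
  have mp : ∀ w, m * ad ((1 - l) w) = m * ad ((1 + m) w) := by
    intro w
    refine LinearMap.ext fun x => h.scalar.eq_of_forall fun v => ?_
    have := congrArg (fun A : Module.End ℝ L => g x (A v)) (pl w)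
    simp only [Module.End.mul_apply] at this ⊢
    rw [hml, hml, sk, sk, this]
  have lmterm : ∀ a b, tr (m * (ad ((1 - l) a) * (ad ((1 - l) b) * l))) =
      tr (m * (ad ((1 + m) a) * (ad ((1 + m) b) * l))) := by
    intro a b
    rw [pl, ← mul_assoc m, mp, mul_assoc]
  have mlterm : ∀ a b, tr (l * (ad ((1 - l) a) * (ad ((1 - l) b) * m))) =
      ∑ i, g ⁅j i, ⁅j i, a⁆⁆ b := by
    intro a b
    rw [trace_mul_cycle₄, trace_mul_cycle₄, trace_mul_cycle₄, ← mul_assoc m, h.mu_lam,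
      trace_rankTwo_mul]
    refine Finset.sum_congr rfl fun i _ => ?_
    have e : ∀ w, ⁅(1 - l) w, j i⁆ = -⁅j i, w⁆ := by
      intro w
      simp [sub_lie, hl, h.lam_lie_j]
    simp only [Module.End.mul_apply, LieAlgebra.ad_apply]
    rw [h.skew, e, e, h.skew _ ⁅j i, a⁆]
    simp only [map_neg, LinearMap.neg_apply, neg_neg]
    rw [h.scalar.1]
  have mterm : ∀ a b, tr (m * (ad ((1 + m) a) * ad ((1 + m) b))) = ∑ i, g ⁅j i, ⁅Z i, a⁆⁆ b := by
    intro a b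
    rw [trace_rankTwo_mul]
    refine Finset.sum_congr rfl fun i _ => ?_
    have e : ∀ w, ⁅Z i, (1 + m) w⁆ = ⁅Z i, w⁆ := by
      intro w
      rw [← lie_skew, ← lie_skew (Z i)]
      simp [-lie_skew, hm, h.mu_lie_Z]
    have c : ∀ w : L, ⁅j i, ⁅Z i, w⁆⁆ = ⁅Z i, ⁅j i, w⁆⁆ := by
      intro w
      rw [leibniz_lie, h.lie_j, zero_lie, zero_add]
    simp only [Module.End.mul_apply, LieAlgebra.ad_apply]
    calc g ⁅((1 + m) a : L), ⁅((1 + m) b : L), j i⁆⁆ (Z i) = -g ⁅j i, (1 + m) b⁆ ⁅Z i, a⁆ := by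
          rw [h.skew, ← lie_skew ((1 + m) a) (Z i), e, ← lie_skew ((1 + m) b : L) (j i)]
          simp only [map_neg, LinearMap.neg_apply, neg_neg]
      _ = -g ⁅Z i, (1 + m) b⁆ ⁅j i, a⁆ := by rw [h.skew, h.skew, c]
      _ = g b ⁅j i, ⁅Z i, a⁆⁆ := by rw [e, h.skew, neg_neg, c]
      _ = g ⁅j i, ⁅Z i, a⁆⁆ b := h.scalar.1 _ _
  -- Transposition exchanges `λ` with `μ` and reverses the product; the two signs from skewness
  -- cancel.
  have lterm : ∀ a b : Module.End ℝ L, (∀ x y, g (a x) y = -g x (a y)) →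
      (∀ x y, g (b x) y = -g x (b y)) → tr (l * (a * b)) = tr (m * (b * a)) := by
    intro a b ha hb
    rw [trace_mul_cycle₃ m b a]
    refine h.scalar.trace_eq_of_adjoint fun x y => ?_
    simp only [Module.End.mul_apply]
    rw [hlm, ha, hb, neg_neg]
  have Kterm : tr (ad ((1 + m) y) * ad ((1 + m) z)) = -g (((1 + l) * (K * (1 + m))) y) z := by
    rw [hK]
    simp only [Module.End.mul_apply, LinearMap.add_apply, Module.End.one_apply, map_add, hlm,
      LinearMap.add_apply]
    ring
  have Sterm : g (shape Z j y) z =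
      (1 / 2) * ∑ i, g ⁅j i, ⁅j i, y⁆⁆ z + ∑ i, g ⁅j i, ⁅Z i, y⁆⁆ z := by
    simp [shape, mul_add]
  have sym1 : ∀ i, g ⁅j i, ⁅j i, z⁆⁆ y = g ⁅j i, ⁅j i, y⁆⁆ z := by
    intro i
    rw [h.skew, h.skew, neg_neg, h.scalar.1]
  have sym2 : ∀ i, g ⁅j i, ⁅Z i, z⁆⁆ y = g ⁅j i, ⁅Z i, y⁆⁆ z := by
    intro i
    rw [leibniz_lie, h.lie_j, zero_lie, zero_add, h.skew, h.skew, h.scalar.1 z, neg_neg]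
  have rhs : g (((1 + l) * (K * (1 + m)) + (4 : ℝ) • shape Z j) y) z =
      g (((1 + l) * (K * (1 + m))) y) z + 4 * g (shape Z j y) z := by
    rw [LinearMap.add_apply, map_add, LinearMap.add_apply, LinearMap.smul_apply, map_smul,
      LinearMap.smul_apply, smul_eq_mul]
  rw [add_mul, mul_add, mul_add, map_add, map_add, map_add, cross,
    LinearMap.trace_mul_comm _ (ad ((1 + m) y) - m * ad ((1 + m) y) - ad ((1 + m) y) * l), cross,
    trace_commutator_mul_commutator h.lam_lam h.mu_mu (h.lam_ad_lam _) (h.mu_ad_mu _)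
      (h.mu_ad_lam _) (h.mu_ad_lam _),
    trace_skew_mul_skew (h.lam_ad_lam _) (h.mu_ad_mu _), lmterm, lmterm, mlterm, mlterm, mterm,
    mterm, lterm _ _ (sk _) (sk _), lterm _ _ (sk _) (sk _), mterm, mterm, Kterm, rhs, Sterm]
  simp only [sym1, sym2, ← hl, ← hm]
  ring

end IsDeformation

end DeformationRicci

/-! ### The norm of the Ricci tensor of the deformed metric -/

section DeformationRicciNorm

variable {L : Type*} [LieRing L] [LieAlgebra ℝ L]

local notation "tr" => LinearMap.trace ℝ L

theorem trace_add_mul_add (A B : Module.End ℝ L) :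
    tr ((A + B) * (A + B)) = tr (A * A) + 2 * tr (A * B) + tr (B * B) := by
  rw [add_mul, mul_add, mul_add, map_add, map_add, map_add, LinearMap.trace_mul_comm ℝ B A]
  ring

namespace IsDeformation

variable {g : LinearMap.BilinForm ℝ L} {Z j : Fin 2 → L}

local notation "ad" => fun x => (LieAlgebra.ad ℝ L x : Module.End ℝ L)

/-- `ad(jᵢ)` and `ad(Zᵢ)` are commuting skew operators, so their products are symmetric. -/
theorem shape_adjoint (h : IsDeformation g Z j) (x y : L) :
    g (shape Z j x) y = g x (shape Z j y) := by
  have c : ∀ i, g ⁅j i, ⁅Z i, x⁆⁆ y = g x ⁅j i, ⁅Z i, y⁆⁆ := by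
    intro i
    rw [leibniz_lie, h.lie_j, zero_lie, zero_add, h.skew, h.skew, neg_neg]
  have c' : ∀ i, g ⁅j i, ⁅j i, x⁆⁆ y = g x ⁅j i, ⁅j i, y⁆⁆ := by
    intro i
    rw [h.skew, h.skew, neg_neg]
  simp [shape, c, c']

theorem shape_Z (h : IsDeformation g Z j) (i : Fin 2) : shape Z j (Z i) = 0 := by
  simp [shape, h.lie_Z, h.lie_j]

theorem shape_lam (h : IsDeformation g Z j) : shape Z j * rankTwo g j Z = 0 := by
  ext x
  simp [rankTwo_apply, h.shape_Z]

theorem mu_shape (h : IsDeformation g Z j) : rankTwo g Z j * shape Z j = 0 := by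
  ext x
  have : ∀ i, g (shape Z j x) (Z i) = 0 := fun i => by rw [h.shape_adjoint, h.shape_Z, map_zero]
  simp [rankTwo_apply, this]

theorem trace_shape [FiniteDimensional ℝ L] (h : IsDeformation g Z j)
    {K : Module.End ℝ L} {κ : ℝ} (hK : ∀ x y, tr (ad x * ad y) = -g (K x) y)
    (hKj : ∀ i, K (j i) = κ • j i) : tr (shape Z j) = -(κ / 2) * ∑ i, g (j i) (j i) := by
  simp only [shape, map_add, map_smul, map_sum]
  have h1 : ∀ i, tr (ad (j i) * ad (j i)) = -(κ * g (j i) (j i)) := by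
    intro i
    rw [hK, hKj, map_smul, LinearMap.smul_apply, smul_eq_mul]
  have h2 : ∀ i, tr (ad (j i) * ad (Z i)) = 0 := by
    intro i
    rw [hK, hKj, map_smul, LinearMap.smul_apply, smul_eq_mul, h.ortho]
    simp
  simp only [h1, h2, Fin.sum_univ_two, smul_eq_mul]
  ring

/-- The vectors `Zᵢ` and `jᵢ` are eigenvectors of `K`, and `K` is `κ` on the image of `S`. Since `S
λ = 0 = μ S`, the mixed term reduces to `κ tr S`. In the square of the first summand only powers of
`μ λ = ∑ ⟨·, jᵢ⟩ jᵢ` have nonzero trace, which yields entries of the Gram matrix. -/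
theorem trace_ricci_sq [FiniteDimensional ℝ L] (h : IsDeformation g Z j)
    {K : Module.End ℝ L} {κ κ' : ℝ} (hK : ∀ x y, tr (ad x * ad y) = -g (K x) y)
    (hKZ : ∀ i, K (Z i) = κ' • Z i) (hKj : ∀ i, K (j i) = κ • j i)
    (hKad : ∀ i x, K ⁅j i, x⁆ = κ • ⁅j i, x⁆) :
    tr (((1 / 4 : ℝ) • ((1 + rankTwo g j Z) * (K * (1 + rankTwo g Z j))) + shape Z j) *
      ((1 / 4 : ℝ) • ((1 + rankTwo g j Z) * (K * (1 + rankTwo g Z j))) + shape Z j)) =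
    (1 / 16) * (tr (K * K) + (2 * κ ^ 2 + 2 * κ * κ') * ∑ i, g (j i) (j i)
      + κ ^ 2 * ∑ i, ∑ k, g (j i) (j k) ^ 2)
      - κ ^ 2 / 4 * ∑ i, g (j i) (j i) + tr (shape Z j * shape Z j) := by
  set l := rankTwo g j Z with hl
  set m := rankTwo g Z j with hm
  set S := shape Z j with hS
  have Km : K * m = κ • m := by ext x; simp [hm, rankTwo_apply, hKj, smul_smul, mul_comm]
  have Kl : K * l = κ' • l := by ext x; simp [hl, rankTwo_apply, hKZ, smul_smul, mul_comm]
  have KS : K * S = κ • S := by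
    ext x
    simp [hS, shape, hKad, smul_smul, mul_comm]
  have trl : tr l = 0 := by
    have := trace_rankTwo_mul g j Z 1
    rw [mul_one] at this
    rw [hl, this]
    simp [h.ortho']
  have trm : tr m = 0 := by
    have := trace_rankTwo_mul g Z j 1
    rw [mul_one] at this
    rw [hm, this]
    simp [h.ortho]
  have trml : tr (m * l) = ∑ i, g (j i) (j i) := by
    have := trace_rankTwo_mul g j j 1
    rw [mul_one] at this
    rw [hm, hl, h.mu_lam, this]
    simp
  have trmlml : tr ((m * l) * (m * l)) = ∑ i, ∑ k, g (j i) (j k) ^ 2 := by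
    rw [hm, hl, h.mu_lam, trace_rankTwo_mul]
    refine Finset.sum_congr rfl fun i _ => ?_
    simp [rankTwo_apply, h.scalar.1 (j i), pow_two]
  have KD : K * ((1 + m) * (1 + l)) = K + (κ • m + κ' • l + κ • (m * l)) := by
    rw [add_mul, mul_add, mul_add]
    simp only [one_mul, mul_one, mul_add, Kl, Km, ← mul_assoc K m, smul_mul_assoc]
    abel
  have MS : tr (((1 + l) * (K * (1 + m))) * S) = -(κ ^ 2 / 2) * ∑ i, g (j i) (j i) := by
    have e : ((1 + l) * (K * (1 + m))) * S = (1 + l) * (κ • S) := by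
      rw [mul_assoc, mul_assoc, add_mul 1 m, hm, hS, h.mu_shape, one_mul, add_zero, ← hS, KS]
    rw [e, LinearMap.trace_mul_comm, mul_add, smul_mul_assoc, smul_mul_assoc, hS, hl, h.shape_lam,
      mul_one, smul_zero, add_zero, map_smul, h.trace_shape hK hKj, smul_eq_mul]
    ring
  have MM : tr (((1 + l) * (K * (1 + m))) * ((1 + l) * (K * (1 + m)))) =
      tr (K * K) + (2 * κ ^ 2 + 2 * κ * κ') * ∑ i, g (j i) (j i)
      + κ ^ 2 * ∑ i, ∑ k, g (j i) (j k) ^ 2 := by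
    -- Rotating `1 + λ` to the end leaves the single factor `(1 + μ)(1 + λ)` between copies of `K`.
    have e : tr (((1 + l) * (K * (1 + m))) * ((1 + l) * (K * (1 + m)))) =
        tr ((K * ((1 + m) * (1 + l))) * (K * ((1 + m) * (1 + l)))) := by
      rw [mul_assoc, LinearMap.trace_mul_comm]
      simp only [mul_assoc]
    have hmm : m * m = 0 := h.mu_mu
    have hll : l * l = 0 := h.lam_lam
    have c1 : tr ((κ • m + κ' • l + κ • (m * l)) * K) = κ ^ 2 * tr (m * l) := by
      rw [LinearMap.trace_mul_comm, mul_add, mul_add, mul_smul_comm, mul_smul_comm, mul_smul_comm,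
        ← mul_assoc, Km, Kl]
      simp only [map_add, map_smul, smul_mul_assoc, trl, trm, smul_eq_mul]
      ring
    have c2 : tr ((κ • m + κ' • l + κ • (m * l)) * (κ • m + κ' • l + κ • (m * l))) =
        2 * κ * κ' * tr (m * l) + κ ^ 2 * tr ((m * l) * (m * l)) := by
      have d1 : tr (m * (m * l)) = 0 := by rw [← mul_assoc, hmm]; simp
      have d2 : tr (l * (m * l)) = 0 := by rw [← mul_assoc, LinearMap.trace_mul_comm, ← mul_assoc, hll]; simp
      have d3 : tr (m * (l * m)) = 0 := by rw [← mul_assoc, LinearMap.trace_mul_comm, ← mul_assoc, hmm]; simp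
      simp only [add_mul, mul_add, smul_mul_assoc, mul_smul_comm, map_add, map_smul, smul_eq_mul,
        hmm, hll, map_zero, d1, d2, d3, LinearMap.trace_mul_comm ℝ l m, mul_assoc, mul_zero]
      ring
    rw [e, KD, trace_add_mul_add, LinearMap.trace_mul_comm ℝ K (_ + _), c1, c2, trml, trmlml]
    ring
  rw [trace_add_mul_add]
  simp only [smul_mul_assoc, mul_smul_comm, map_smul, smul_eq_mul, MS, MM]
  ring

/-- The isometry `1 + λ` carries `u` to a `g`-orthonormal basis `v`. In `v` the entries of the Ricci
tensor are those of the symmetric operator `R`, so the sum of their squares is `tr R²`. In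
particular the value does not depend on `u`. -/
theorem algRicciNormSq_eq [FiniteDimensional ℝ L] (h : IsDeformation g Z j)
    {K : Module.End ℝ L} {κ κ' : ℝ} (hK : ∀ x y, tr (ad x * ad y) = -g (K x) y)
    (hKZ : ∀ i, K (Z i) = κ' • Z i) (hKj : ∀ i, K (j i) = κ • j i)
    (hKad : ∀ i x, K ⁅j i, x⁆ = κ • ⁅j i, x⁆) {Γ : L →ₗ[ℝ] L →ₗ[ℝ] L}
    (hΓ : IsAlgLeviCivita
      (g.comp (1 + rankTwo g j Z : Module.End ℝ L) (1 + rankTwo g j Z : Module.End ℝ L)) Γ)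
    {ι : Type*} [Fintype ι] [DecidableEq ι] (u : Module.Basis ι ℝ L)
    (hu : OrthonormalFor
      (g.comp (1 + rankTwo g j Z : Module.End ℝ L) (1 + rankTwo g j Z : Module.End ℝ L)) u) :
    algRicciNormSq
      (g.comp (1 + rankTwo g j Z : Module.End ℝ L) (1 + rankTwo g j Z : Module.End ℝ L)) Γ u =
    (1 / 16) * (tr (K * K) + (2 * κ ^ 2 + 2 * κ * κ') * ∑ i, g (j i) (j i)
      + κ ^ 2 * ∑ i, ∑ k, g (j i) (j k) ^ 2)
      - κ ^ 2 / 4 * ∑ i, g (j i) (j i) + tr (shape Z j * shape Z j) := by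
  rw [← h.trace_ricci_sq hK hKZ hKj hKad]
  set l := rankTwo g j Z with hl
  set m := rankTwo g Z j with hm
  set R : Module.End ℝ L := (1 / 4 : ℝ) • ((1 + l) * (K * (1 + m))) + shape Z j with hR
  have hlm : ∀ x y, g (l x) y = g x (m y) := h.adjoint j Z
  have hml : ∀ x y, g (m x) y = g x (l y) := h.adjoint Z j
  let T : L ≃ₗ[ℝ] L := LinearEquiv.ofLinearMap (1 + l : Module.End ℝ L) (1 - l : Module.End ℝ L)
    h.one_add_one_sub h.one_sub_one_add
  let v := u.map T
  have hv : OrthonormalFor g v := fun i k => by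
    rw [Module.Basis.map_apply, Module.Basis.map_apply]
    exact hu i k
  have huv : ∀ i, u i = (1 - l) (v i) := fun i => (T.symm_apply_apply (u i)).symm
  have hKs : ∀ x y, g (K x) y = g x (K y) := by
    intro x y
    have := hK x y
    rw [LinearMap.trace_mul_comm, hK y x, h.scalar.1 _ x] at this
    linarith
  have hRs : ∀ x y, g (R x) y = g x (R y) := by
    intro x y
    simp only [hR, LinearMap.add_apply, LinearMap.smul_apply, Module.End.mul_apply,
      Module.End.one_apply, map_add, map_smul, hlm, hml, hKs, h.shape_adjoint]
    ring
  have hric : ∀ i k, ∑ n, (g.comp (1 + l : Module.End ℝ L) (1 + l : Module.End ℝ L))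
      (algCurvature Γ (u n) (u i) (u k)) (u n) = g (R (v i)) (v k) := by
    intro i k
    rw [hΓ.ricci_eq h.isScalarProduct h.trace_ad hu, LinearMap.trace_mul_comm]
    have hN := fun y => h.conj_flip_eq hΓ y
    have htr := h.trace_conj_mul_conj hK (v i) (v k)
    rw [← neg_mul_neg, ← hN, ← hN] at htr
    rw [← hl, ← huv, ← huv] at htr
    have e : ∀ A B : Module.End ℝ L, tr ((2 : ℝ) • ((1 + l) * (A * (1 - l))) *
        (2 : ℝ) • ((1 + l) * (B * (1 - l)))) = 4 * tr (A * B) := by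
      intro A B
      have e1 : ((1 + l) * (A * (1 - l))) * ((1 + l) * (B * (1 - l))) =
          (1 + l) * ((A * B) * (1 - l)) := by
        have : (1 - l) * ((1 + l) * (B * (1 - l))) = B * (1 - l) := by
          rw [← mul_assoc (1 - l), h.one_sub_one_add, one_mul]
        rw [mul_assoc, mul_assoc, this, mul_assoc]
      rw [smul_mul_assoc, mul_smul_comm, map_smul, map_smul, e1, LinearMap.trace_mul_comm, mul_assoc,
        h.one_sub_one_add, mul_one, smul_eq_mul, smul_eq_mul]
      ring
    rw [e] at htr
    have e' : ((1 + l) * (K * (1 + m)) + (4 : ℝ) • shape Z j) = (4 : ℝ) • R := by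
      rw [hR, smul_add, smul_smul]
      norm_num
    rw [e', LinearMap.smul_apply, map_smul, LinearMap.smul_apply, smul_eq_mul] at htr
    linarith
  rw [algRicciNormSq]
  simp only [hric]
  rw [hv.trace_eq_sum]
  refine Finset.sum_congr rfl fun i _ => ?_
  rw [Module.End.mul_apply, hRs, ← hv.sum_mul]
  exact Finset.sum_congr rfl fun k _ => pow_two _

end IsDeformation

/-- The metrics `(Id + λ(t))^* g` given by a bi-invariant scalar product `g` and commuting data
`Z`, `J t`, such that the Gram matrix of `J t` is constant. -/
theorem ricciNormVaries_deformedForm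
    {E : Type*} [NormedAddCommGroup E] [NormedSpace ℝ E] [FiniteDimensional ℝ E] [CompleteSpace E]
    {H : Type*} [TopologicalSpace H] (I : ModelWithCorners ℝ E H) [I.Boundaryless]
    {G : Type*} [TopologicalSpace G] [ChartedSpace H G] [Group G] [LieGroup I ∞ G]
    (e : L ≃ₗ⁅ℝ⁆ GroupLieAlgebra I G) {V : Type*} [AddCommGroup V] [Module ℝ V]
    {g : LinearMap.BilinForm ℝ L} {inc : V →ₗ[ℝ] L} {Z : Fin 2 → V} {ε : ℝ} {J : ℝ → V →ₗ[ℝ] L}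
    {K : Module.End ℝ L} {κ κ' : ℝ}
    (hdef : ∀ t ∈ Set.Ioo (-ε) ε, IsDeformation g (fun i => inc (Z i)) fun i => J t (Z i))
    (hK : ∀ x y : L, LinearMap.trace ℝ L (LieAlgebra.ad ℝ L x * LieAlgebra.ad ℝ L y) = -g (K x) y)
    (hKZ : ∀ i, K (inc (Z i)) = κ' • inc (Z i))
    (hKj : ∀ t ∈ Set.Ioo (-ε) ε, ∀ i, K (J t (Z i)) = κ • J t (Z i))
    (hKad : ∀ t ∈ Set.Ioo (-ε) ε, ∀ i x, K ⁅J t (Z i), x⁆ = κ • ⁅J t (Z i), x⁆)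
    (hgram : ∀ s ∈ Set.Ioo (-ε) ε, ∀ t ∈ Set.Ioo (-ε) ε, ∀ i k,
      g (J s (Z i)) (J s (Z k)) = g (J t (Z i)) (J t (Z k)))
    (hne : ∃ s ∈ Set.Ioo (-ε) ε, ∃ t ∈ Set.Ioo (-ε) ε,
      LinearMap.trace ℝ L
        (IsDeformation.shape (fun i => inc (Z i)) (fun i => J s (Z i)) *
          IsDeformation.shape (fun i => inc (Z i)) (fun i => J s (Z i))) ≠
      LinearMap.trace ℝ L
        (IsDeformation.shape (fun i => inc (Z i)) (fun i => J t (Z i)) *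
          IsDeformation.shape (fun i => inc (Z i)) (fun i => J t (Z i)))) :
    RicciNormVaries I ε fun t => metricOfForm I e (deformedForm g inc Z (J t)) := by
  have : FiniteDimensional ℝ L := Module.Finite.equiv (modelEquiv e).symm
  -- The constant `c t` is left as a hole; unification fills it with the closed formula for the
  -- norm.
  refine ricciNormVaries_of_algRicciNormSq e (fun t => deformedForm g inc Z (J t))
    (fun t => _) (fun t ht => (hdef t ht).isScalarProduct)
    (fun t ht Γ hΓ u hu =>
      (hdef t ht).algRicciNormSq_eq hK hKZ (hKj t ht) (hKad t ht) hΓ u hu) ?_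
  obtain ⟨s, hs, t, ht, hst⟩ := hne
  refine ⟨s, hs, t, ht, fun h => hst ?_⟩
  simp only [hgram s hs t ht] at h
  linarith

end DeformationRicciNorm

/-! ### Traces of the operators `X ↦ M X N` on matrices -/

section Sandwich

variable {ι R : Type*} [Fintype ι] [DecidableEq ι] [CommRing R]

/-- The endomorphism `X ↦ M X N` of the space of matrices. -/
def sandwich (M N : Matrix ι ι R) : Module.End R (Matrix ι ι R) :=
  LinearMap.mulLeft R M * LinearMap.mulRight R N

theorem sandwich_apply (M N X : Matrix ι ι R) : sandwich M N X = M * (X * N) := rfl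

theorem sandwich_mul_sandwich (M N M' N' : Matrix ι ι R) :
    sandwich M N * sandwich M' N' = sandwich (M * M') (N' * N) := by
  ext1 X
  simp [sandwich_apply, mul_assoc]

theorem trace_end_matrix (F : Module.End R (Matrix ι ι R)) :
    LinearMap.trace R _ F = ∑ i, ∑ k, F (Matrix.single i k 1) i k := by
  rw [LinearMap.trace_eq_matrix_trace R (Matrix.stdBasis R ι ι), Matrix.trace,
    Fintype.sum_prod_type]
  refine Finset.sum_congr rfl fun i _ => Finset.sum_congr rfl fun k _ => ?_
  rw [Matrix.diag_apply, LinearMap.toMatrix_apply, Matrix.stdBasis_eq_single]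
  rfl

/-- As a tensor product the operator is `M ⊗ Nᵀ`. -/
theorem trace_sandwich (M N : Matrix ι ι R) :
    LinearMap.trace R _ (sandwich M N) = M.trace * N.trace := by
  rw [trace_end_matrix, Matrix.trace, Matrix.trace, Finset.sum_mul_sum]
  refine Finset.sum_congr rfl fun i _ => Finset.sum_congr rfl fun k _ => ?_
  simp [sandwich_apply, Matrix.mul_apply, Matrix.single_apply, ite_and]

/-- Transposition flips the two tensor factors, which turns the product of two traces into the trace
of a product. -/
theorem trace_sandwich_mul_transpose (M N : Matrix ι ι R) :
    LinearMap.trace R _ (sandwich M N * (Matrix.transposeLinearEquiv ι ι R R : _ →ₗ[R] _)) =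
      (M * Nᵀ).trace := by
  rw [trace_end_matrix, Matrix.trace]
  refine Finset.sum_congr rfl fun i _ => ?_
  rw [Matrix.diag_apply, Matrix.mul_apply]
  refine Finset.sum_congr rfl fun k _ => ?_
  simp [sandwich_apply, Matrix.mul_apply, Matrix.single_apply, ite_and]

theorem ad_eq_sandwich (M : Matrix ι ι R) :
    (LieAlgebra.ad R (Matrix ι ι R) M : Module.End R (Matrix ι ι R)) =
      sandwich M 1 - sandwich 1 M := by
  ext1 X
  simp [sandwich_apply, Ring.lie_def]

end Sandwich

/-! ### Traces of products of adjoint operators on `𝔰𝔬` -/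

section SpecialOrthogonal

variable {ι : Type*} [Fintype ι] [DecidableEq ι]

theorem soLie_transpose (X : soLie ι) : (X : Matrix ι ι ℝ)ᵀ = -(X : Matrix ι ι ℝ) :=
  (LieAlgebra.Orthogonal.mem_so ι ℝ _).1 X.2

/-- The projection of a matrix to its skew-symmetric part. -/
def skewPart : Matrix ι ι ℝ →ₗ[ℝ] soLie ι where
  toFun M := ⟨(1 / 2 : ℝ) • (M - Mᵀ), by
    rw [LieAlgebra.Orthogonal.mem_so]
    simp [Matrix.transpose_smul, ← smul_neg]⟩
  map_add' M N := by
    ext1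
    change (1 / 2 : ℝ) • (M + N - (M + N)ᵀ) = (1 / 2 : ℝ) • (M - Mᵀ) + (1 / 2 : ℝ) • (N - Nᵀ)
    rw [Matrix.transpose_add]
    module
  map_smul' c M := by
    ext1
    change (1 / 2 : ℝ) • (c • M - (c • M)ᵀ) = c • ((1 / 2 : ℝ) • (M - Mᵀ))
    rw [Matrix.transpose_smul]
    module

theorem coe_skewPart (M : Matrix ι ι ℝ) :
    (skewPart M : Matrix ι ι ℝ) = (1 / 2 : ℝ) • (M - Mᵀ) := rfl

theorem skewPart_coe (X : soLie ι) : skewPart (X : Matrix ι ι ℝ) = X := by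
  ext1
  rw [coe_skewPart, soLie_transpose]
  module

/-- The trace of the restriction of `F` to the space of skew-symmetric matrices. -/
theorem trace_soLie {f : Module.End ℝ (soLie ι)} {F : Module.End ℝ (Matrix ι ι ℝ)}
    (h : ∀ X, (f X : Matrix ι ι ℝ) = F X) :
    LinearMap.trace ℝ _ f = (1 / 2) * (LinearMap.trace ℝ _ F -
      LinearMap.trace ℝ _ (F * (Matrix.transposeLinearEquiv ι ι ℝ ℝ : _ →ₗ[ℝ] _))) := by
  let i : soLie ι →ₗ[ℝ] Matrix ι ι ℝ := (soLie ι).toSubmodule.subtype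
  -- Factoring `f` through all matrices and rotating puts the projection `½ (1 - transposition)`
  -- behind `F`.
  have h1 : f = (skewPart : Matrix ι ι ℝ →ₗ[ℝ] soLie ι) ∘ₗ (F ∘ₗ i) := by
    ext1 X
    change f X = skewPart (F X)
    rw [← h, skewPart_coe]
  have h2 : (F ∘ₗ i) ∘ₗ (skewPart : Matrix ι ι ℝ →ₗ[ℝ] soLie ι) =
      (1 / 2 : ℝ) • (F - F * (Matrix.transposeLinearEquiv ι ι ℝ ℝ : _ →ₗ[ℝ] _)) := by
    ext1 M
    change F ((1 / 2 : ℝ) • (M - Mᵀ)) = (1 / 2 : ℝ) • (F M - F Mᵀ)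
    rw [map_smul, map_sub]
  rw [h1, LinearMap.trace_comp_comm', h2, map_smul, map_sub, smul_eq_mul]

theorem trace_soLie_coe (X : soLie ι) : (X : Matrix ι ι ℝ).trace = 0 := by
  have h := congrArg Matrix.trace (soLie_transpose X)
  rw [Matrix.trace_transpose, Matrix.trace_neg] at h
  linarith

theorem trace_ad_mul_ad_soLie (A B : soLie ι) :
    LinearMap.trace ℝ _ (LieAlgebra.ad ℝ (soLie ι) A * LieAlgebra.ad ℝ (soLie ι) B) =
      (Fintype.card ι - 2) * ((A : Matrix ι ι ℝ) * (B : Matrix ι ι ℝ)).trace := by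
  rw [trace_soLie (F := LieAlgebra.ad ℝ (Matrix ι ι ℝ) (A : Matrix ι ι ℝ) *
    LieAlgebra.ad ℝ (Matrix ι ι ℝ) (B : Matrix ι ι ℝ)) fun X => rfl]
  have hA := trace_soLie_coe A
  have hB := trace_soLie_coe B
  have tA := soLie_transpose A
  have tB := soLie_transpose B
  generalize (A : Matrix ι ι ℝ) = a at *
  generalize (B : Matrix ι ι ℝ) = b at *
  have c1 := Matrix.trace_mul_comm b a
  simp only [ad_eq_sandwich, mul_sub, sub_mul, sandwich_mul_sandwich, map_sub, trace_sandwich,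
    trace_sandwich_mul_transpose, mul_one, one_mul, Matrix.trace_one, hA, hB, c1,
    Matrix.transpose_mul, Matrix.transpose_one, tA, tB, Matrix.neg_mul, Matrix.mul_neg,
    Matrix.trace_neg, neg_neg]
  ring

/-- The trace of a product of four operators of the adjoint representation of `𝔰𝔬`. -/
def soQuartic (A B C D : Matrix ι ι ℝ) : ℝ :=
  (Fintype.card ι - 4) * (A * (B * (C * D))).trace - 2 * (A * (B * (D * C))).trace
    - 2 * (A * (C * (B * D))).trace + (A * B).trace * (C * D).trace
    + (A * C).trace * (B * D).trace + (A * D).trace * (B * C).trace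

/-- Each `ad` is a difference of left and right multiplication, so the trace over all matrices, as
well as the one twisted by transposition, is a sum of sixteen explicit terms. By cyclicity, and
because reversal leaves the trace of a product of four skew matrices unchanged, just three quartic
traces are distinct. -/
theorem trace_ad_quartic_soLie (A B C D : soLie ι) :
    LinearMap.trace ℝ _ (LieAlgebra.ad ℝ (soLie ι) A * (LieAlgebra.ad ℝ (soLie ι) B *
      (LieAlgebra.ad ℝ (soLie ι) C * LieAlgebra.ad ℝ (soLie ι) D))) =
      soQuartic (A : Matrix ι ι ℝ) B C D := by
  rw [trace_soLie (F := LieAlgebra.ad ℝ (Matrix ι ι ℝ) (A : Matrix ι ι ℝ) *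
    (LieAlgebra.ad ℝ (Matrix ι ι ℝ) (B : Matrix ι ι ℝ) *
    (LieAlgebra.ad ℝ (Matrix ι ι ℝ) (C : Matrix ι ι ℝ) *
    LieAlgebra.ad ℝ (Matrix ι ι ℝ) (D : Matrix ι ι ℝ)))) fun X => rfl, soQuartic]
  have hA := trace_soLie_coe A
  have hB := trace_soLie_coe B
  have hC := trace_soLie_coe C
  have hD := trace_soLie_coe D
  have tA := soLie_transpose A
  have tB := soLie_transpose B
  have tC := soLie_transpose C
  have tD := soLie_transpose D
  generalize (A : Matrix ι ι ℝ) = a at *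
  generalize (B : Matrix ι ι ℝ) = b at *
  generalize (C : Matrix ι ι ℝ) = c at *
  generalize (D : Matrix ι ι ℝ) = d at *
  have cyc : ∀ w x y z : Matrix ι ι ℝ, (w * (x * (y * z))).trace = (x * (y * (z * w))).trace := by
    intro w x y z
    rw [Matrix.trace_mul_comm]
    simp only [mul_assoc]
  have rev : ∀ w x y z : Matrix ι ι ℝ, wᵀ = -w → xᵀ = -x → yᵀ = -y → zᵀ = -z →
      (w * (x * (y * z))).trace = (z * (y * (x * w))).trace := by
    intro w x y z hw hx hy hz
    rw [← Matrix.trace_transpose]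
    simp only [Matrix.transpose_mul, hw, hx, hy, hz, Matrix.neg_mul, Matrix.mul_neg, neg_neg,
      mul_assoc]
  have p1 := Matrix.trace_mul_comm b a
  have p2 := Matrix.trace_mul_comm c a
  have p3 := Matrix.trace_mul_comm d a
  have p4 := Matrix.trace_mul_comm c b
  have p5 := Matrix.trace_mul_comm d b
  have p6 := Matrix.trace_mul_comm d c
  have q1 : (b * (c * (d * a))).trace = (a * (b * (c * d))).trace := (cyc _ _ _ _).symm
  have q2 : (d * (c * (b * a))).trace = (a * (b * (c * d))).trace := rev _ _ _ _ tD tC tB tA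
  have q3 : (d * (a * (b * c))).trace = (a * (b * (c * d))).trace := cyc _ _ _ _
  have q4 : (c * (d * (a * b))).trace = (a * (b * (c * d))).trace := by rw [cyc, cyc]
  have r1 : (a * (c * (d * b))).trace = (a * (b * (d * c))).trace := by
    rw [rev _ _ _ _ tA tC tD tB, cyc, cyc, cyc]
  have r2 : (b * (a * (c * d))).trace = (a * (b * (d * c))).trace := by
    rw [cyc, r1]
  have r3 : (c * (a * (b * d))).trace = (a * (b * (d * c))).trace := cyc _ _ _ _
  have s1 : (a * (d * (b * c))).trace = (a * (c * (b * d))).trace := by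
    rw [rev _ _ _ _ tA tD tB tC, cyc, cyc, cyc]
  have s2 : (b * (c * (a * d))).trace = (a * (c * (b * d))).trace := by
    rw [cyc, cyc, s1]
  have s3 : (b * (d * (a * c))).trace = (a * (c * (b * d))).trace := by
    rw [cyc, cyc]
  have u1 : ∀ x y z : Matrix ι ι ℝ, xᵀ = -x → yᵀ = -y → zᵀ = -z →
      (x * (y * z)).trace = -(z * (y * x)).trace := by
    intro x y z hx hy hz
    rw [← Matrix.trace_transpose]
    simp only [Matrix.transpose_mul, hx, hy, hz, Matrix.neg_mul, Matrix.mul_neg, neg_neg,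
      mul_assoc, Matrix.trace_neg]
  simp only [ad_eq_sandwich, mul_sub, sub_mul, sandwich_mul_sandwich, map_sub, trace_sandwich,
    trace_sandwich_mul_transpose, mul_one, one_mul, Matrix.trace_one, hA, hB, hC, hD,
    Matrix.transpose_mul, Matrix.transpose_one, tA, tB, tC, tD, Matrix.neg_mul, Matrix.mul_neg,
    Matrix.trace_neg, neg_neg, mul_assoc]
  simp only [p1, p2, p3, p4, p5, p6, q1, q2, q3, q4, r1, r2, r3, s1, s2, s3]
  ring

end SpecialOrthogonal

/-! ### `Ad`-invariant forms on `𝔰𝔬(n)`, `n ≥ 5` -/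

section OrthogonalForms

variable {ι : Type*} [Fintype ι] [DecidableEq ι]

/-- The signed permutation matrices. -/
def signedPerm (σ : Equiv.Perm ι) (ε : ι → ℝ) : Matrix ι ι ℝ :=
  Matrix.diagonal ε * σ.permMatrix ℝ

theorem signedPerm_conj (σ : Equiv.Perm ι) (ε : ι → ℝ) (X : Matrix ι ι ℝ) (a b : ι) :
    (signedPerm σ ε * X * star (signedPerm σ ε)) a b = ε a * ε b * X (σ a) (σ b) := by
  have h : ∀ i k, signedPerm σ ε i k = if σ i = k then ε i else 0 := by
    intro i k
    rw [signedPerm, Matrix.diagonal_mul, Equiv.Perm.permMatrix, PEquiv.toMatrix_apply]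
    simp
  simp only [Matrix.mul_apply, Matrix.star_apply, h]
  simp
  ring

theorem signedPerm_mem {σ : Equiv.Perm ι} {ε : ι → ℝ} (hε : ∀ i, ε i * ε i = 1)
    (hdet : (∏ i, ε i) * (Equiv.Perm.sign σ : ℤ) = 1) :
    signedPerm σ ε ∈ Matrix.specialOrthogonalGroup ι ℝ := by
  rw [Matrix.mem_specialOrthogonalGroup_iff]
  constructor
  · rw [Matrix.mem_orthogonalGroup_iff]
    ext a b
    have := signedPerm_conj σ ε 1 a b
    rw [mul_one, Matrix.star_eq_conjTranspose, Matrix.conjTranspose_eq_transpose_of_trivial] at this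
    rw [this, Matrix.one_apply, Matrix.one_apply]
    by_cases hab : a = b
    · subst hab; simp [hε]
    · simp [hab]
  · rw [signedPerm, Matrix.det_mul, Matrix.det_diagonal, Matrix.det_permutation]
    exact_mod_cast hdet

variable {B : LinearMap.BilinForm ℝ (soLie ι)}

/-- `E_ab = (e_ab - e_ba) / 2`. -/
def soUnit (a b : ι) : soLie ι := skewPart (Matrix.single a b 1)

theorem coe_soUnit (a b i k : ι) : (soUnit a b : Matrix ι ι ℝ) i k =
    1 / 2 * ((if a = i ∧ b = k then 1 else 0) - if a = k ∧ b = i then 1 else 0) := by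
  rw [soUnit, coe_skewPart]
  simp [Matrix.single_apply, and_comm]

theorem soUnit_self (a : ι) : soUnit a a = 0 := by
  ext i k
  rw [coe_soUnit]
  simp [and_comm]

theorem soUnit_swap (a b : ι) : soUnit b a = -soUnit a b := by
  ext i k
  change (soUnit b a : Matrix ι ι ℝ) i k = -(soUnit a b : Matrix ι ι ℝ) i k
  rw [coe_soUnit, coe_soUnit]
  simp only [and_comm]
  ring

theorem soUnit_conj (σ : Equiv.Perm ι) {ε : ι → ℝ} (a b : ι) :
    ((ε a * ε b) • soUnit a b : soLie ι) =
      (signedPerm σ ε * (soUnit (σ a) (σ b) : Matrix ι ι ℝ) * star (signedPerm σ ε)) := by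
  ext i k
  rw [signedPerm_conj, coe_soUnit]
  change (ε a * ε b) * (soUnit a b : Matrix ι ι ℝ) i k = _
  rw [coe_soUnit]
  simp only [EmbeddingLike.apply_eq_iff_eq]
  by_cases h1 : a = i ∧ b = k
  · obtain ⟨rfl, rfl⟩ := h1
    by_cases h2 : a = b
    · subst h2; simp
    · simp [h2]
  · by_cases h2 : a = k ∧ b = i
    · obtain ⟨rfl, rfl⟩ := h2
      simp [h1]
      ring
    · simp [h1, h2]

theorem AdInvariant.soUnit_eq (hB : AdInvariant (soLie ι) (Matrix.specialOrthogonalGroup ι ℝ) B)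
    {σ : Equiv.Perm ι} {ε : ι → ℝ} (hε : ∀ i, ε i * ε i = 1)
    (hdet : (∏ i, ε i) * (Equiv.Perm.sign σ : ℤ) = 1) (a b c d : ι) :
    (ε a * ε b) * (ε c * ε d) * B (soUnit a b) (soUnit c d) =
      B (soUnit (σ a) (σ b)) (soUnit (σ c) (σ d)) := by
  rw [← hB _ (signedPerm_mem hε hdet) _ _ _ _ (soUnit_conj σ a b) (soUnit_conj σ c d)]
  simp only [map_smul, LinearMap.smul_apply, smul_eq_mul]
  ring

/-- The hypothesis says that the sign change at `x` multiplies the value by `-1`. Alone it has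
determinant `-1`; as `n ≥ 5`, there is an index `y` outside the at most four given ones, and
changing the sign at `y` as well restores determinant `1` without affecting the value. -/
theorem AdInvariant.soUnit_eq_zero (hι : 5 ≤ Fintype.card ι)
    (hB : AdInvariant (soLie ι) (Matrix.specialOrthogonalGroup ι ℝ) B) {a b c d x : ι}
    (hx : (if a = x then (-1 : ℝ) else 1) * (if b = x then -1 else 1) *
      ((if c = x then -1 else 1) * (if d = x then -1 else 1)) = -1) :
    B (soUnit a b) (soUnit c d) = 0 := by
  have hcard : (({a, b, c, d} : Finset ι)).card < Fintype.card ι :=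
    lt_of_le_of_lt Finset.card_le_four hι
  obtain ⟨y, hy⟩ : ∃ y, y ∉ ({a, b, c, d} : Finset ι) := by
    by_contra! h
    have := Finset.eq_univ_iff_forall.2 h
    rw [this, Finset.card_univ] at hcard
    exact hcard.false
  simp only [Finset.mem_insert, Finset.mem_singleton, not_or] at hy
  obtain ⟨hya, hyb, hyc, hyd⟩ := hy
  have hxy : y ≠ x := by
    rintro rfl
    rw [if_neg (Ne.symm hya), if_neg (Ne.symm hyb), if_neg (Ne.symm hyc), if_neg (Ne.symm hyd)] at hx
    norm_num at hx
  let ε : ι → ℝ := fun i => (if i = x then -1 else 1) * (if i = y then -1 else 1)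
  have hε : ∀ i, ε i * ε i = 1 := by
    intro i
    simp only [ε]
    split_ifs <;> norm_num
  have hdet : (∏ i, ε i) * (Equiv.Perm.sign (1 : Equiv.Perm ι) : ℤ) = 1 := by
    simp only [ε, Finset.prod_mul_distrib, Finset.prod_ite_eq', Finset.mem_univ, if_true]
    simp
  have h := hB.soUnit_eq hε hdet a b c d
  simp only [ε, if_neg (Ne.symm hya), if_neg (Ne.symm hyb), if_neg (Ne.symm hyc),
    if_neg (Ne.symm hyd), mul_one, hx, Equiv.Perm.one_apply] at h
  linarith

/-- A permutation takes `(a, b)` to `(c, d)`. If it is odd, the sign at `a` corrects the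
determinant, and this sign enters the value only through its square. -/
theorem AdInvariant.soUnit_self_eq
    (hB : AdInvariant (soLie ι) (Matrix.specialOrthogonalGroup ι ℝ) B) {a b c d : ι} (hab : a ≠ b)
    (hcd : c ≠ d) : B (soUnit a b) (soUnit a b) = B (soUnit c d) (soUnit c d) := by
  let σ : Equiv.Perm ι := Equiv.swap (Equiv.swap a c b) d * Equiv.swap a c
  have hσa : σ a = c := by
    simp only [σ, Equiv.Perm.mul_apply, Equiv.swap_apply_left]
    refine Equiv.swap_apply_of_ne_of_ne (fun h => hab ?_) hcd
    have := congrArg (Equiv.swap a c) h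
    rwa [Equiv.swap_apply_right, Equiv.swap_apply_self] at this
  have hσb : σ b = d := by
    simp only [σ, Equiv.Perm.mul_apply, Equiv.swap_apply_left]
  let ε : ι → ℝ := fun i => if i = a then ((Equiv.Perm.sign σ : ℤ) : ℝ) else 1
  have hs : ((Equiv.Perm.sign σ : ℤ) : ℝ) * ((Equiv.Perm.sign σ : ℤ) : ℝ) = 1 := by
    rcases Int.units_eq_one_or (Equiv.Perm.sign σ) with h | h <;> simp [h]
  have hε : ∀ i, ε i * ε i = 1 := by
    intro i
    simp only [ε]
    split_ifs
    · exact hs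
    · norm_num
  have h := hB.soUnit_eq (σ := σ) hε (by simpa [ε] using hs) a b a b
  rw [hσa, hσb] at h
  rw [← h]
  have : ε a * ε b * (ε a * ε b) = (ε a * ε a) * (ε b * ε b) := by ring
  rw [this, hε, hε]
  ring

/-- The `Ad`-invariant bilinear forms on `𝔰𝔬(n)`, `n ≥ 5`, are the multiples of the trace form. -/
theorem AdInvariant.exists_eq_trace (hι : 5 ≤ Fintype.card ι)
    (hB : AdInvariant (soLie ι) (Matrix.specialOrthogonalGroup ι ℝ) B) :
    ∃ c : ℝ, ∀ X Y : soLie ι, B X Y = -c * ((X : Matrix ι ι ℝ) * (Y : Matrix ι ι ℝ)).trace := by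
  have : Nontrivial ι := Fintype.one_lt_card_iff_nontrivial.1 (by omega)
  obtain ⟨p, q, hpq⟩ := exists_pair_ne ι
  set r := B (soUnit p q) (soUnit p q) with hr
  -- For `E = (e_pq - e_qp)/2` one has `tr(E²) = -1/2`, whence the factor `2`.
  refine ⟨2 * r, fun X Y => ?_⟩
  let T : LinearMap.BilinForm ℝ (soLie ι) := LinearMap.mk₂ ℝ
    (fun X Y => -(2 * r) * ((X : Matrix ι ι ℝ) * (Y : Matrix ι ι ℝ)).trace)
    (fun X X' Y => by
      change -(2 * r) * (((X : Matrix ι ι ℝ) + X') * (Y : Matrix ι ι ℝ)).trace = _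
      rw [add_mul, Matrix.trace_add]; ring)
    (fun c X Y => by
      change -(2 * r) * ((c • (X : Matrix ι ι ℝ)) * (Y : Matrix ι ι ℝ)).trace = _
      rw [Matrix.smul_mul, Matrix.trace_smul, smul_eq_mul, smul_eq_mul]; ring)
    (fun X Y Y' => by
      change -(2 * r) * ((X : Matrix ι ι ℝ) * ((Y : Matrix ι ι ℝ) + Y')).trace = _
      rw [mul_add, Matrix.trace_add]; ring)
    (fun c X Y => by
      change -(2 * r) * ((X : Matrix ι ι ℝ) * (c • (Y : Matrix ι ι ℝ))).trace = _
      rw [Matrix.mul_smul, Matrix.trace_smul, smul_eq_mul, smul_eq_mul]; ring)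
  have hunit : ∀ a b c d, B (soUnit a b) (soUnit c d) = T (soUnit a b) (soUnit c d) := by
    intro a b c d
    have hT : T (soUnit a b) (soUnit c d) = r * ((if a = c ∧ b = d then 1 else 0) -
        if a = d ∧ b = c then 1 else 0) := by
      change -(2 * r) * (((1 / 2 : ℝ) • (Matrix.single a b (1 : ℝ) - (Matrix.single a b 1)ᵀ)) *
        ((1 / 2 : ℝ) • (Matrix.single c d (1 : ℝ) - (Matrix.single c d 1)ᵀ))).trace = _
      have h1 : ∀ a b c d : ι, (Matrix.single a b (1 : ℝ) * Matrix.single c d 1).trace =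
          if a = d ∧ b = c then 1 else 0 := by
        intro a b c d
        by_cases hbc : b = c
        · subst hbc
          by_cases had : a = d
          · subst had; simp
          · simp [had, Matrix.trace_single_eq_of_ne]
        · simp [hbc]
      simp only [Matrix.transpose_single, Matrix.smul_mul, Matrix.mul_smul, Matrix.trace_smul,
        mul_sub, sub_mul, Matrix.trace_sub, h1, smul_eq_mul, and_comm (a := b = d),
        and_comm (a := b = c)]
      ring
    rw [hT]
    by_cases hab : a = b
    · subst hab
      simp [soUnit_self, and_comm]
    by_cases hcd : c = d
    · subst hcd
      simp [soUnit_self]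
    by_cases hac : a = c
    · subst hac
      by_cases hbd : b = d
      · subst hbd
        simp [hB.soUnit_self_eq hab hpq, hr, hab]
      · rw [hB.soUnit_eq_zero hι (x := b)]
        · simp [hbd, hcd]
        · simp [hab, Ne.symm hbd]
    · by_cases had : a = d
      · subst had
        by_cases hbc : b = c
        · subst hbc
          rw [soUnit_swap b a, map_neg, LinearMap.neg_apply, hB.soUnit_self_eq hcd hpq]
          simp [hr, hab]
        · rw [hB.soUnit_eq_zero hι (x := b)]
          · simp [hac, hbc]
          · simp [hab, Ne.symm hbc]
      · rw [hB.soUnit_eq_zero hι (x := a)]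
        · simp [hac, had]
        · simp [Ne.symm hab, Ne.symm hac, Ne.symm had]
  -- The elements `soUnit a b` span but are not a basis. The two forms are compared on all matrices,
  -- after composition with the projection, where the matrix units form a basis.
  have key : B.compl₁₂ (skewPart : Matrix ι ι ℝ →ₗ[ℝ] soLie ι) skewPart =
      T.compl₁₂ (skewPart : Matrix ι ι ℝ →ₗ[ℝ] soLie ι) skewPart := by
    refine (Matrix.stdBasis ℝ ι ι).ext fun ⟨a, b⟩ => (Matrix.stdBasis ℝ ι ι).ext fun ⟨c, d⟩ => ?_
    rw [Matrix.stdBasis_eq_single, Matrix.stdBasis_eq_single]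
    exact hunit a b c d
  have := congrArg (fun F => F (X : Matrix ι ι ℝ) (Y : Matrix ι ι ℝ)) key
  simp only [LinearMap.compl₁₂_apply, skewPart_coe] at this
  exact this

end OrthogonalForms

/-! ### Polarized trace identities for isospectral families -/

section IsospectralTraces

variable {ι 𝕜 : Type*} [Fintype ι] [DecidableEq ι] [RCLike 𝕜]

theorem trace_add_sq_sub (X Y : Matrix ι ι 𝕜) :
    ((X + Y) ^ 2).trace - ((X - Y) ^ 2).trace = 4 * (X * Y).trace := by
  have h := Matrix.trace_mul_comm Y X
  simp only [pow_two, add_mul, mul_add, sub_mul, mul_sub, Matrix.trace_add, Matrix.trace_sub, h]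
  ring

theorem trace_add_cube_sub (X Y : Matrix ι ι 𝕜) :
    ((X + Y) ^ 3).trace - ((X - Y) ^ 3).trace = 2 * (Y ^ 3).trace + 6 * (X * (X * Y)).trace := by
  have h1 : (X * (Y * X)).trace = (X * (X * Y)).trace := by
    rw [← mul_assoc, Matrix.trace_mul_comm]
  have h2 : (Y * (X * X)).trace = (X * (X * Y)).trace := by
    rw [Matrix.trace_mul_comm, mul_assoc]
  simp only [pow_succ, pow_zero, one_mul, add_mul, mul_add, sub_mul, mul_sub, Matrix.trace_add,
    Matrix.trace_sub, mul_assoc, h1, h2]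
  ring

theorem trace_add_quartic_add (X Y : Matrix ι ι 𝕜) :
    ((X + Y) ^ 4).trace + ((X - Y) ^ 4).trace = 2 * (X ^ 4).trace + 2 * (Y ^ 4).trace
      + 4 * (2 * (X * (X * (Y * Y))).trace + (X * (Y * (X * Y))).trace) := by
  have cyc : ∀ w x y z : Matrix ι ι 𝕜, (w * (x * (y * z))).trace = (x * (y * (z * w))).trace := by
    intro w x y z
    rw [Matrix.trace_mul_comm]
    simp only [mul_assoc]
  have h1 : (X * (Y * (Y * X))).trace = (X * (X * (Y * Y))).trace := (cyc _ _ _ _).symm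
  have h2 : (Y * (X * (X * Y))).trace = (X * (X * (Y * Y))).trace := cyc _ _ _ _
  have h3 : (Y * (Y * (X * X))).trace = (X * (X * (Y * Y))).trace := by rw [cyc, cyc]
  have h4 : (Y * (X * (Y * X))).trace = (X * (Y * (X * Y))).trace := cyc _ _ _ _
  simp only [pow_succ, pow_zero, one_mul, add_mul, mul_add, sub_mul, mul_sub, Matrix.trace_add,
    Matrix.trace_sub, mul_assoc, h1, h2, h3, h4]
  ring

namespace IsIsospectralFamily

variable {V : Type*} [AddCommGroup V] [Module ℝ V] {𝔪 : LieSubalgebra ℝ (Matrix ι ι 𝕜)}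
  {K : Submonoid (Matrix ι ι 𝕜)} {Z : Fin 2 → V} {ε : ℝ} {j : ℝ → V →ₗ[ℝ] 𝔪}

theorem trace_pow_eq (h : IsIsospectralFamily 𝔪 K Z ε j) (hK : ∀ A ∈ K, star A * A = 1)
    {s t : ℝ} (hs : s ∈ Set.Ioo (-ε) ε) (ht : t ∈ Set.Ioo (-ε) ε) (z : V) (n : ℕ) :
    ((j s z : Matrix ι ι 𝕜) ^ n).trace = ((j t z : Matrix ι ι 𝕜) ^ n).trace := by
  obtain ⟨A, hA, h1⟩ := h.isospectral t ht s hs z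
  have h2 : ∀ n : ℕ, (A * (j t z : Matrix ι ι 𝕜) * star A) ^ n * A =
      A * (j t z : Matrix ι ι 𝕜) ^ n := by
    intro n
    induction n with
    | zero => simp
    | succ n ih =>
      rw [pow_succ, mul_assoc _ _ A, mul_assoc _ (star A) A, hK A hA, mul_one, ← mul_assoc, ih,
        pow_succ, mul_assoc]
  have h3 : A * star A = 1 := mul_eq_one_comm.1 (hK A hA)
  calc ((j s z : Matrix ι ι 𝕜) ^ n).trace
      = ((A * (j t z : Matrix ι ι 𝕜) * star A) ^ n * A * star A).trace := by
        rw [mul_assoc _ A, h3, mul_one, h1]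
    _ = ((j t z : Matrix ι ι 𝕜) ^ n).trace := by
        rw [h2, Matrix.trace_mul_comm, ← mul_assoc, hK A hA, one_mul]

/-- Polarization: `u + v` and `u - v` are both admissible arguments, and the traces of all powers of
`j_z` are conjugation invariant. The cubic and the quartic versions below use the same pair of
arguments. -/
theorem trace_mul_eq (h : IsIsospectralFamily 𝔪 K Z ε j) (hK : ∀ A ∈ K, star A * A = 1)
    {s t : ℝ} (hs : s ∈ Set.Ioo (-ε) ε) (ht : t ∈ Set.Ioo (-ε) ε) (u v : V) :
    ((j s u : Matrix ι ι 𝕜) * (j s v : Matrix ι ι 𝕜)).trace =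
      ((j t u : Matrix ι ι 𝕜) * (j t v : Matrix ι ι 𝕜)).trace := by
  have e1 := trace_add_sq_sub (j s u : Matrix ι ι 𝕜) (j s v)
  have e2 := trace_add_sq_sub (j t u : Matrix ι ι 𝕜) (j t v)
  have p := h.trace_pow_eq hK hs ht (u + v) 2
  have m := h.trace_pow_eq hK hs ht (u - v) 2
  simp only [map_add, map_sub] at p m
  change ((_ + _) ^ 2 : Matrix ι ι 𝕜).trace = ((_ + _) ^ 2 : Matrix ι ι 𝕜).trace at p
  change ((_ - _) ^ 2 : Matrix ι ι 𝕜).trace = ((_ - _) ^ 2 : Matrix ι ι 𝕜).trace at m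
  have : (4 : 𝕜) ≠ 0 := by norm_num
  refine mul_left_cancel₀ this ?_
  rw [← e1, ← e2, p, m]

theorem trace_cubic_eq (h : IsIsospectralFamily 𝔪 K Z ε j) (hK : ∀ A ∈ K, star A * A = 1)
    {s t : ℝ} (hs : s ∈ Set.Ioo (-ε) ε) (ht : t ∈ Set.Ioo (-ε) ε) (u v : V) :
    ((j s u : Matrix ι ι 𝕜) * ((j s u : Matrix ι ι 𝕜) * (j s v : Matrix ι ι 𝕜))).trace =
      ((j t u : Matrix ι ι 𝕜) * ((j t u : Matrix ι ι 𝕜) * (j t v : Matrix ι ι 𝕜))).trace := by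
  have e1 := trace_add_cube_sub (j s u : Matrix ι ι 𝕜) (j s v)
  have e2 := trace_add_cube_sub (j t u : Matrix ι ι 𝕜) (j t v)
  have p := h.trace_pow_eq hK hs ht (u + v) 3
  have m := h.trace_pow_eq hK hs ht (u - v) 3
  have r := h.trace_pow_eq hK hs ht v 3
  simp only [map_add, map_sub] at p m
  change ((_ + _) ^ 3 : Matrix ι ι 𝕜).trace = ((_ + _) ^ 3 : Matrix ι ι 𝕜).trace at p
  change ((_ - _) ^ 3 : Matrix ι ι 𝕜).trace = ((_ - _) ^ 3 : Matrix ι ι 𝕜).trace at m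
  have : (6 : 𝕜) ≠ 0 := by norm_num
  refine mul_left_cancel₀ this ?_
  rw [p, m] at e1
  rw [r] at e1
  linear_combination e2 - e1

/-- This combination is the coefficient of bidegree `(2, 2)` in the trace of the fourth power.
Isospectrality fixes the combination but neither summand separately, which leaves room for
`tr(X²Y²)` to vary. -/
theorem trace_quartic_eq (h : IsIsospectralFamily 𝔪 K Z ε j) (hK : ∀ A ∈ K, star A * A = 1)
    {s t : ℝ} (hs : s ∈ Set.Ioo (-ε) ε) (ht : t ∈ Set.Ioo (-ε) ε) (u v : V) :
    2 * ((j s u : Matrix ι ι 𝕜) * (j s u * ((j s v : Matrix ι ι 𝕜) * j s v))).trace +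
        ((j s u : Matrix ι ι 𝕜) * (j s v * ((j s u : Matrix ι ι 𝕜) * j s v))).trace =
      2 * ((j t u : Matrix ι ι 𝕜) * (j t u * ((j t v : Matrix ι ι 𝕜) * j t v))).trace +
        ((j t u : Matrix ι ι 𝕜) * (j t v * ((j t u : Matrix ι ι 𝕜) * j t v))).trace := by
  have e1 := trace_add_quartic_add (j s u : Matrix ι ι 𝕜) (j s v)
  have e2 := trace_add_quartic_add (j t u : Matrix ι ι 𝕜) (j t v)
  have p := h.trace_pow_eq hK hs ht (u + v) 4
  have m := h.trace_pow_eq hK hs ht (u - v) 4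
  have r := h.trace_pow_eq hK hs ht v 4
  have q := h.trace_pow_eq hK hs ht u 4
  simp only [map_add, map_sub] at p m
  change ((_ + _) ^ 4 : Matrix ι ι 𝕜).trace = ((_ + _) ^ 4 : Matrix ι ι 𝕜).trace at p
  change ((_ - _) ^ 4 : Matrix ι ι 𝕜).trace = ((_ - _) ^ 4 : Matrix ι ι 𝕜).trace at m
  have : (4 : 𝕜) ≠ 0 := by norm_num
  refine mul_left_cancel₀ this ?_
  rw [p, m, r, q] at e1
  linear_combination e2 - e1

/-- Expanding `tr((X² + Y²)²)` gives two invariant traces of fourth powers and `2 tr(X²Y²)`, so the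
latter carries all the variation. -/
theorem exists_trace_ne (h : IsIsospectralFamily 𝔪 K Z ε j) (hK : ∀ A ∈ K, star A * A = 1) :
    ∃ s ∈ Set.Ioo (-ε) ε, ∃ t ∈ Set.Ioo (-ε) ε,
      ((j s (Z 0) : Matrix ι ι 𝕜) * (j s (Z 0) * ((j s (Z 1) : Matrix ι ι 𝕜) * j s (Z 1)))).trace ≠
      ((j t (Z 0) : Matrix ι ι 𝕜) * (j t (Z 0) * ((j t (Z 1) : Matrix ι ι 𝕜) * j t (Z 1)))).trace := by
  obtain ⟨s, hs, t, ht, hne⟩ := h.nonconstant ε h.pos le_rfl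
  refine ⟨s, hs, t, ht, fun heq => hne ?_⟩
  have e : ∀ X Y : Matrix ι ι 𝕜, ((X ^ 2 + Y ^ 2) ^ 2).trace =
      (X ^ 4).trace + (Y ^ 4).trace + 2 * (X * (X * (Y * Y))).trace := by
    intro X Y
    have h3 : (Y * (Y * (X * X))).trace = (X * (X * (Y * Y))).trace := by
      rw [← mul_assoc, Matrix.trace_mul_comm, mul_assoc]
    simp only [pow_succ, pow_zero, one_mul, add_mul, mul_add, Matrix.trace_add, mul_assoc, h3]
    ring
  rw [quarticTrace, quarticTrace, e, e, heq, h.trace_pow_eq hK hs ht, h.trace_pow_eq hK hs ht]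

end IsIsospectralFamily

end IsospectralTraces

/-! ### Criteria for simple algebras and for products with abelian ones -/

section Criteria

variable {E : Type*} [NormedAddCommGroup E] [NormedSpace ℝ E] [FiniteDimensional ℝ E]
  [CompleteSpace E] {H : Type*} [TopologicalSpace H] (I : ModelWithCorners ℝ E H) [I.Boundaryless]
  {G : Type*} [TopologicalSpace G] [ChartedSpace H G] [Group G] [LieGroup I ∞ G]
  {L : Type*} [LieRing L] [LieAlgebra ℝ L]

theorem trace_shape_mul_shape (Z j : Fin 2 → L) :
    LinearMap.trace ℝ L (IsDeformation.shape Z j * IsDeformation.shape Z j) =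
      (1 / 4) * ∑ i, ∑ k, LinearMap.trace ℝ L (LieAlgebra.ad ℝ L (j i) * (LieAlgebra.ad ℝ L (j i) *
        (LieAlgebra.ad ℝ L (j k) * LieAlgebra.ad ℝ L (j k))))
      + ∑ i, ∑ k, LinearMap.trace ℝ L (LieAlgebra.ad ℝ L (j i) * (LieAlgebra.ad ℝ L (j i) *
        (LieAlgebra.ad ℝ L (j k) * LieAlgebra.ad ℝ L (Z k))))
      + ∑ i, ∑ k, LinearMap.trace ℝ L (LieAlgebra.ad ℝ L (j i) * (LieAlgebra.ad ℝ L (Z i) *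
        (LieAlgebra.ad ℝ L (j k) * LieAlgebra.ad ℝ L (Z k)))) := by
  rw [IsDeformation.shape, trace_add_mul_add]
  simp only [smul_mul_assoc, mul_smul_comm, map_smul, Finset.sum_mul_sum, map_sum, mul_assoc,
    smul_eq_mul]
  ring

/-- The case of a bi-invariant scalar product which is a multiple of the Killing form. -/
theorem ricciNormVaries_of_killing
    (e : L ≃ₗ⁅ℝ⁆ GroupLieAlgebra I G) {V : Type*} [AddCommGroup V] [Module ℝ V]
    {g : LinearMap.BilinForm ℝ L} {inc : V →ₗ[ℝ] L} {Z : Fin 2 → V} {ε : ℝ} {J : ℝ → V →ₗ[ℝ] L}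
    {κ : ℝ}
    (hdef : ∀ t ∈ Set.Ioo (-ε) ε, IsDeformation g (fun i => inc (Z i)) fun i => J t (Z i))
    (hK : ∀ x y : L, LinearMap.trace ℝ L (LieAlgebra.ad ℝ L x * LieAlgebra.ad ℝ L y) = -(κ * g x y))
    (hgram : ∀ s ∈ Set.Ioo (-ε) ε, ∀ t ∈ Set.Ioo (-ε) ε, ∀ i k,
      g (J s (Z i)) (J s (Z k)) = g (J t (Z i)) (J t (Z k)))
    (hne : ∃ s ∈ Set.Ioo (-ε) ε, ∃ t ∈ Set.Ioo (-ε) ε,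
      LinearMap.trace ℝ L
        (IsDeformation.shape (fun i => inc (Z i)) (fun i => J s (Z i)) *
          IsDeformation.shape (fun i => inc (Z i)) (fun i => J s (Z i))) ≠
      LinearMap.trace ℝ L
        (IsDeformation.shape (fun i => inc (Z i)) (fun i => J t (Z i)) *
          IsDeformation.shape (fun i => inc (Z i)) (fun i => J t (Z i)))) :
    RicciNormVaries I ε fun t => metricOfForm I e (deformedForm g inc Z (J t)) :=
  ricciNormVaries_deformedForm I e (K := κ • LinearMap.id) (κ := κ) (κ' := κ) hdef
    (fun x y => by simp [hK]) (fun _ => rfl) (fun _ _ _ => rfl) (fun _ _ _ _ => rfl) hgram hne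

/-- The case of a product with an abelian Lie algebra. -/
theorem ricciNormVaries_prod {𝔱 : Type*} [LieRing 𝔱] [LieAlgebra ℝ 𝔱] [IsLieAbelian 𝔱]
    (e : (L × 𝔱) ≃ₗ⁅ℝ⁆ GroupLieAlgebra I G) {h : LinearMap.BilinForm ℝ L}
    {k : LinearMap.BilinForm ℝ 𝔱} (hh : IsScalarProduct h) (hk : IsScalarProduct k)
    (hinv : ∀ x y z, h ⁅x, y⁆ z = h x ⁅y, z⁆)
    {Z : Fin 2 → 𝔱} (hZ : OrthonormalFor k Z) {ε : ℝ} {j : ℝ → 𝔱 →ₗ[ℝ] L} {κ : ℝ}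
    (hK : ∀ x y : L, LinearMap.trace ℝ L (LieAlgebra.ad ℝ L x * LieAlgebra.ad ℝ L y) = -(κ * h x y))
    (hgram : ∀ s ∈ Set.Ioo (-ε) ε, ∀ t ∈ Set.Ioo (-ε) ε, ∀ i k,
      h (j s (Z i)) (j s (Z k)) = h (j t (Z i)) (j t (Z k)))
    (hne : ∃ s ∈ Set.Ioo (-ε) ε, ∃ t ∈ Set.Ioo (-ε) ε,
      LinearMap.trace ℝ L (IsDeformation.shape 0 (fun i => j s (Z i)) *
        IsDeformation.shape 0 (fun i => j s (Z i))) ≠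
      LinearMap.trace ℝ L (IsDeformation.shape 0 (fun i => j t (Z i)) *
        IsDeformation.shape 0 (fun i => j t (Z i)))) :
    RicciNormVaries I ε fun t => metricOfForm I e
      (deformedForm (formProd h k) (LinearMap.inr ℝ _ 𝔱) Z (LinearMap.inl ℝ _ 𝔱 ∘ₗ j t)) := by
  have hfin : FiniteDimensional ℝ (L × 𝔱) := Module.Finite.equiv (modelEquiv e).symm
  have : FiniteDimensional ℝ L := Module.Finite.of_surjective (LinearMap.fst ℝ L 𝔱)
    LinearMap.fst_surjective
  have : FiniteDimensional ℝ 𝔱 := Module.Finite.of_surjective (LinearMap.snd ℝ L 𝔱)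
    LinearMap.snd_surjective
  have hg : ∀ x y : L × 𝔱, formProd h k x y = h x.1 y.1 + k x.2 y.2 := fun x y => rfl
  have hlie : ∀ x y : L × 𝔱, ⁅x, y⁆ = (⁅x.1, y.1⁆, 0) := fun x y =>
    Prod.ext rfl (trivial_lie_zero 𝔱 𝔱 x.2 y.2)
  have had : ∀ x : L × 𝔱, (LieAlgebra.ad ℝ (L × 𝔱) x : Module.End ℝ (L × 𝔱)) =
      LinearMap.prodMap (LieAlgebra.ad ℝ L x.1) 0 := by
    intro x
    refine LinearMap.ext fun y => ?_
    rw [LieAlgebra.ad_apply, hlie]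
    rfl
  have hmul : ∀ A B : Module.End ℝ L, (LinearMap.prodMap A (0 : Module.End ℝ 𝔱) : Module.End ℝ (L × 𝔱)) *
      LinearMap.prodMap B (0 : Module.End ℝ 𝔱) = LinearMap.prodMap (A * B) 0 := by
    intro A B
    refine LinearMap.ext fun y => ?_
    simp
  have htr : ∀ A : Module.End ℝ L, LinearMap.trace ℝ (L × 𝔱)
      (LinearMap.prodMap A (0 : Module.End ℝ 𝔱)) = LinearMap.trace ℝ L A := by
    intro A
    rw [LinearMap.trace_prodMap']
    simp
  have hscal : IsScalarProduct (formProd h k) := by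
    refine ⟨fun x y => by rw [hg, hg, hh.1, hk.1], fun x hx => ?_⟩
    rw [hg]
    have h0 : ∀ y, 0 ≤ h y y := fun y => by
      by_cases hy : y = 0
      · simp [hy]
      · exact (hh.2 y hy).le
    have k0 : ∀ y, 0 ≤ k y y := fun y => by
      by_cases hy : y = 0
      · simp [hy]
      · exact (hk.2 y hy).le
    by_cases h1 : x.1 = 0
    · have h2 : x.2 ≠ 0 := fun h2 => hx (Prod.ext h1 h2)
      exact add_pos_of_nonneg_of_pos (h0 _) (hk.2 _ h2)
    · exact add_pos_of_pos_of_nonneg (hh.2 _ h1) (k0 _)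
  -- The Killing form is degenerate on the abelian factor: `K` is `κ` on `L` and `0` on `𝔱`, so `κ'
  -- = 0`.
  refine ricciNormVaries_deformedForm I e (K := LinearMap.prodMap (κ • LinearMap.id) 0) (κ := κ)
    (κ' := 0) (fun t _ => ⟨hscal, ?_, ?_, ?_, ?_, ?_⟩) ?_ ?_ ?_ ?_ ?_ ?_
  · intro x y z
    simp [hlie, hg, hinv]
  · intro i k
    simp [hlie]
  · intro i k
    simp [hlie]
  · intro i k
    simp [hg]
  · intro i k
    simpa [hg] using hZ i k
  · intro x y
    rw [had, had, hmul, htr, hK, hg]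
    simp
  · intro i
    simp
  · intro t _ i
    simp
  · intro t _ i x
    simp [hlie]
  · intro s hs t ht i k
    simpa [hg] using hgram s hs t ht i k
  -- The elements `Zᵢ` are central, so their adjoint operators are zero and `S` only sees `j`.
  · have hshape : ∀ t, LinearMap.trace ℝ (L × 𝔱)
        (IsDeformation.shape (fun i => LinearMap.inr ℝ L 𝔱 (Z i))
          (fun i => (LinearMap.inl ℝ L 𝔱 ∘ₗ j t) (Z i)) *
        IsDeformation.shape (fun i => LinearMap.inr ℝ L 𝔱 (Z i))
          (fun i => (LinearMap.inl ℝ L 𝔱 ∘ₗ j t) (Z i))) =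
        LinearMap.trace ℝ L (IsDeformation.shape 0 (fun i => j t (Z i)) *
        IsDeformation.shape 0 (fun i => j t (Z i))) := by
      intro t
      rw [trace_shape_mul_shape, trace_shape_mul_shape]
      simp only [had, hmul, htr]
      rfl
    simpa only [hshape] using hne

end Criteria

/-! ### Variation of `tr S²` on `𝔰𝔬(n)` -/

section OrthogonalCriterion

variable {ι : Type*} [Fintype ι] [DecidableEq ι]

theorem soQuartic_pairs (X Y : Matrix ι ι ℝ) :
    soQuartic X X Y Y = (Fintype.card ι - 6) * (X * (X * (Y * Y))).trace
      - 2 * (X * (Y * (X * Y))).trace + (X * X).trace * (Y * Y).trace + 2 * (X * Y).trace ^ 2 := by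
  rw [soQuartic]
  ring

/-- As `W` commutes with `X` and `Y`, the three quartic traces coincide and the coefficient is `n -
4 - 2 - 2 = n - 8`. -/
theorem soQuartic_cubic {X Y W : Matrix ι ι ℝ} (hX : X * W = W * X) (hY : Y * W = W * Y)
    (tX : (X * W).trace = 0) (tY : (Y * W).trace = 0) :
    soQuartic X X Y W = (Fintype.card ι - 8) * (X * (X * (Y * W))).trace := by
  have h1 : (X * (Y * (X * W))).trace = (X * (X * (Y * W))).trace := by
    rw [hX, ← mul_assoc Y, ← mul_assoc X, Matrix.trace_mul_comm]
  rw [soQuartic, tX, tY, ← hY, h1]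
  ring

theorem soQuartic_mixed {X X' W W' : Matrix ι ι ℝ} (h1 : X' * W = W * X')
    (t1 : (X * W).trace = 0) (t2 : (X * W').trace = 0)  :
    soQuartic X W X' W' = (Fintype.card ι - 6) * (X * (X' * (W * W'))).trace
      - 2 * (X' * (X * (W * W'))).trace + (X * X').trace * (W * W').trace := by
  have e1 : W * (X' * W') = X' * (W * W') := by rw [← mul_assoc, ← h1, mul_assoc]
  have e2 : (X * (W * (W' * X'))).trace = (X' * (X * (W * W'))).trace := by
    rw [Matrix.trace_mul_comm X', ← mul_assoc W, ← mul_assoc X]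
  rw [soQuartic, t1, t2, e1, e2]
  ring

/-- The parts of `tr S²` which involve `W`, and the products of quadratic traces, agree for `X` and
`X'` by hypothesis. There remain the terms `(n - 6) tr(X₀²X₁²) - 2 tr(X₀X₁X₀X₁)`, occurring twice
with the factor `1/4`. Since `2 tr(X₀²X₁²) + tr(X₀X₁X₀X₁)` is fixed, the second trace contributes
`4` to the coefficient of the first: `(n - 6 + 4)/2 = (n - 2)/2`. -/
theorem trace_shape_sq_sub_soLie {X X' W : Fin 2 → soLie ι}
    (hXW : ∀ i k, (X i * W k : Matrix ι ι ℝ) = W k * X i)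
    (hXW' : ∀ i k, (X' i * W k : Matrix ι ι ℝ) = W k * X' i)
    (tXW : ∀ i k, (X i * W k : Matrix ι ι ℝ).trace = 0)
    (tXW' : ∀ i k, (X' i * W k : Matrix ι ι ℝ).trace = 0)
    (h2 : ∀ i k, (X i * X k : Matrix ι ι ℝ).trace = (X' i * X' k : Matrix ι ι ℝ).trace)
    (h3 : ∀ i k, (X i * (X i * (X k * W k)) : Matrix ι ι ℝ).trace =
      (X' i * (X' i * (X' k * W k)) : Matrix ι ι ℝ).trace)
    (h4 : ∀ i k, 2 * (X i * (X i * (X k * X k)) : Matrix ι ι ℝ).trace +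
      (X i * (X k * (X i * X k)) : Matrix ι ι ℝ).trace =
      2 * (X' i * (X' i * (X' k * X' k)) : Matrix ι ι ℝ).trace +
      (X' i * (X' k * (X' i * X' k)) : Matrix ι ι ℝ).trace)
    (h22 : ∀ i k p q, (X i * (X k * (W p * W q)) : Matrix ι ι ℝ).trace =
      (X' i * (X' k * (W p * W q)) : Matrix ι ι ℝ).trace) :
    LinearMap.trace ℝ _ (IsDeformation.shape W X * IsDeformation.shape W X) -
      LinearMap.trace ℝ _ (IsDeformation.shape W X' * IsDeformation.shape W X') =
    (Fintype.card ι - 2) / 2 * ((X 0 * (X 0 * (X 1 * X 1)) : Matrix ι ι ℝ).trace -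
      (X' 0 * (X' 0 * (X' 1 * X' 1)) : Matrix ι ι ℝ).trace) := by
  have c : ∀ Y : Fin 2 → soLie ι, (Y 1 * (Y 1 * (Y 0 * Y 0)) : Matrix ι ι ℝ).trace =
      (Y 0 * (Y 0 * (Y 1 * Y 1)) : Matrix ι ι ℝ).trace := by
    intro Y
    rw [← mul_assoc, Matrix.trace_mul_comm, mul_assoc]
  have d : ∀ Y : Fin 2 → soLie ι, (Y 1 * (Y 0 * (Y 1 * Y 0)) : Matrix ι ι ℝ).trace =
      (Y 0 * (Y 1 * (Y 0 * Y 1)) : Matrix ι ι ℝ).trace := by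
    intro Y
    rw [Matrix.trace_mul_comm]
    simp only [mul_assoc]
  simp only [trace_shape_mul_shape, trace_ad_quartic_soLie, soQuartic_pairs,
    soQuartic_cubic (hXW _ _) (hXW _ _) (tXW _ _) (tXW _ _),
    soQuartic_cubic (hXW' _ _) (hXW' _ _) (tXW' _ _) (tXW' _ _),
    soQuartic_mixed (hXW _ _) (tXW _ _) (tXW _ _), soQuartic_mixed (hXW' _ _) (tXW' _ _) (tXW' _ _),
    h2, h3, h22, Fin.sum_univ_two, c, d]
  -- For equal indices the fixed combination is `3 tr(Xᵢ⁴)`, which settles the diagonal terms.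
  have e01 := h4 0 1
  have e0 := h4 0 0
  have e1 := h4 1 1
  have f0 : (X 0 * (X 0 * (X 0 * X 0)) : Matrix ι ι ℝ).trace =
    (X' 0 * (X' 0 * (X' 0 * X' 0)) : Matrix ι ι ℝ).trace := by linarith
  have f1 : (X 1 * (X 1 * (X 1 * X 1)) : Matrix ι ι ℝ).trace =
    (X' 1 * (X' 1 * (X' 1 * X' 1)) : Matrix ι ι ℝ).trace := by linarith
  rw [f0, f1]
  linear_combination (-1 : ℝ) * e01

theorem IsScalarProduct.exists_eq_trace_soLie {g : LinearMap.BilinForm ℝ (soLie ι)}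
    (hι : 5 ≤ Fintype.card ι) (hg : IsScalarProduct g)
    (hinv : AdInvariant (soLie ι) (Matrix.specialOrthogonalGroup ι ℝ) g) :
    ∃ c : ℝ, c ≠ 0 ∧ ∀ X Y : soLie ι, g X Y = -c * (X * Y : Matrix ι ι ℝ).trace := by
  obtain ⟨c, hc⟩ := hinv.exists_eq_trace hι
  refine ⟨c, ?_, hc⟩
  rintro rfl
  have : Nontrivial ι := Fintype.one_lt_card_iff_nontrivial.1 (by omega)
  obtain ⟨p, q, hpq⟩ := exists_pair_ne ι
  have hne : soUnit p q ≠ 0 := by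
    intro h
    have := congrArg (fun X : soLie ι => (X : Matrix ι ι ℝ) p q) h
    simp [coe_soUnit, hpq] at this
  have := hg.2 _ hne
  rw [hc] at this
  simp at this

theorem soLie_trace_form_inv {g : LinearMap.BilinForm ℝ (soLie ι)} {c : ℝ}
    (hc : ∀ X Y : soLie ι, g X Y = -c * (X * Y : Matrix ι ι ℝ).trace) (x y z : soLie ι) :
    g ⁅x, y⁆ z = g x ⁅y, z⁆ := by
  rw [hc, hc]
  change -c * ((x * y - y * x : Matrix ι ι ℝ) * z).trace =
    -c * (x * (y * z - z * y) : Matrix ι ι ℝ).trace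
  have : (y * (x * z) : Matrix ι ι ℝ).trace = (x * (z * y) : Matrix ι ι ℝ).trace := by
    rw [Matrix.trace_mul_comm, mul_assoc]
  rw [sub_mul, mul_sub, Matrix.trace_sub, Matrix.trace_sub, mul_assoc, mul_assoc, this]

theorem soLie_killing {g : LinearMap.BilinForm ℝ (soLie ι)} {c : ℝ} (hc0 : c ≠ 0)
    (hc : ∀ X Y : soLie ι, g X Y = -c * (X * Y : Matrix ι ι ℝ).trace) (x y : soLie ι) :
    LinearMap.trace ℝ _ (LieAlgebra.ad ℝ (soLie ι) x * LieAlgebra.ad ℝ (soLie ι) y) =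
      -((Fintype.card ι - 2) / c * g x y) := by
  rw [trace_ad_mul_ad_soLie, hc]
  field_simp

variable {E : Type*} [NormedAddCommGroup E] [NormedSpace ℝ E] [FiniteDimensional ℝ E]
  [CompleteSpace E] {H : Type*} [TopologicalSpace H] (I : ModelWithCorners ℝ E H) [I.Boundaryless]
  {G : Type*} [TopologicalSpace G] [ChartedSpace H G] [Group G] [LieGroup I ∞ G]

/-- The common criterion for both embeddings into a larger `𝔰𝔬(n)`. The hypotheses `h3` and `h22`
concern the interaction of `J` with the torus: they are trivial when these occupy disjoint blocks,
but have content when the torus contains the complex structure. -/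
theorem ricciNormVaries_soLie (hι : 5 ≤ Fintype.card ι)
    (e : soLie ι ≃ₗ⁅ℝ⁆ GroupLieAlgebra I G) {V : Type*} [AddCommGroup V] [Module ℝ V]
    {g : LinearMap.BilinForm ℝ (soLie ι)} (hg : IsScalarProduct g)
    (hinv : AdInvariant (soLie ι) (Matrix.specialOrthogonalGroup ι ℝ) g)
    {inc : V →ₗ[ℝ] soLie ι} {Z : Fin 2 → V} (hZ : OrthonormalFor (g.comp inc inc) Z)
    {ε : ℝ} {J : ℝ → V →ₗ[ℝ] soLie ι}
    (hZZ : ∀ i k, (inc (Z i) * inc (Z k) : Matrix ι ι ℝ) = inc (Z k) * inc (Z i))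
    (hJZ : ∀ t i k, (J t (Z i) * inc (Z k) : Matrix ι ι ℝ) = inc (Z k) * J t (Z i))
    (tJZ : ∀ t i k, (J t (Z i) * inc (Z k) : Matrix ι ι ℝ).trace = 0)
    (h2 : ∀ s ∈ Set.Ioo (-ε) ε, ∀ t ∈ Set.Ioo (-ε) ε, ∀ i k,
      (J s (Z i) * J s (Z k) : Matrix ι ι ℝ).trace = (J t (Z i) * J t (Z k) : Matrix ι ι ℝ).trace)
    (h3 : ∀ s ∈ Set.Ioo (-ε) ε, ∀ t ∈ Set.Ioo (-ε) ε, ∀ i k,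
      (J s (Z i) * (J s (Z i) * (J s (Z k) * inc (Z k))) : Matrix ι ι ℝ).trace =
        (J t (Z i) * (J t (Z i) * (J t (Z k) * inc (Z k))) : Matrix ι ι ℝ).trace)
    (h4 : ∀ s ∈ Set.Ioo (-ε) ε, ∀ t ∈ Set.Ioo (-ε) ε, ∀ i k,
      2 * (J s (Z i) * (J s (Z i) * (J s (Z k) * J s (Z k))) : Matrix ι ι ℝ).trace +
        (J s (Z i) * (J s (Z k) * (J s (Z i) * J s (Z k))) : Matrix ι ι ℝ).trace =
      2 * (J t (Z i) * (J t (Z i) * (J t (Z k) * J t (Z k))) : Matrix ι ι ℝ).trace +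
        (J t (Z i) * (J t (Z k) * (J t (Z i) * J t (Z k))) : Matrix ι ι ℝ).trace)
    (h22 : ∀ s ∈ Set.Ioo (-ε) ε, ∀ t ∈ Set.Ioo (-ε) ε, ∀ i k p q,
      (J s (Z i) * (J s (Z k) * (inc (Z p) * inc (Z q))) : Matrix ι ι ℝ).trace =
        (J t (Z i) * (J t (Z k) * (inc (Z p) * inc (Z q))) : Matrix ι ι ℝ).trace)
    (hne : ∃ s ∈ Set.Ioo (-ε) ε, ∃ t ∈ Set.Ioo (-ε) ε,
      (J s (Z 0) * (J s (Z 0) * (J s (Z 1) * J s (Z 1))) : Matrix ι ι ℝ).trace ≠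
        (J t (Z 0) * (J t (Z 0) * (J t (Z 1) * J t (Z 1))) : Matrix ι ι ℝ).trace) :
    RicciNormVaries I ε fun t => metricOfForm I e (deformedForm g inc Z (J t)) := by
  obtain ⟨c, hc0, hc⟩ := hg.exists_eq_trace_soLie hι hinv
  have hlie : ∀ x y : soLie ι, (x * y : Matrix ι ι ℝ) = y * x → ⁅x, y⁆ = 0 := by
    intro x y h
    ext1
    change (x * y - y * x : Matrix ι ι ℝ) = 0
    rw [h, sub_self]
  refine ricciNormVaries_of_killing I e
    (fun t _ => ⟨hg, soLie_trace_form_inv hc, fun i k => hlie _ _ (hZZ i k),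
      fun i k => hlie _ _ (hJZ t i k), fun i k => by rw [hc, tJZ, mul_zero], hZ⟩)
    (soLie_killing hc0 hc) (fun s hs t ht i k => by rw [hc, hc, h2 s hs t ht]) ?_
  obtain ⟨s, hs, t, ht, hst⟩ := hne
  refine ⟨s, hs, t, ht, fun h => hst ?_⟩
  have h5 := trace_shape_sq_sub_soLie (X := fun i => J s (Z i)) (X' := fun i => J t (Z i))
    (W := fun i => inc (Z i)) (hJZ s) (hJZ t) (tJZ s) (tJZ t) (h2 s hs t ht) (h3 s hs t ht)
    (h4 s hs t ht) (h22 s hs t ht)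
  rw [h, sub_self] at h5
  have hn : ((Fintype.card ι : ℝ) - 2) / 2 ≠ 0 := by
    have : (5 : ℝ) ≤ Fintype.card ι := by exact_mod_cast hι
    have : (0 : ℝ) < (Fintype.card ι - 2) / 2 := by linarith
    exact this.ne'
  exact sub_eq_zero.1 ((mul_eq_zero.1 h5.symm).resolve_left hn)

/-- The case of `SO(m) × T²`. -/
theorem ricciNormVaries_soLie_prod (hι : 5 ≤ Fintype.card ι)
    {𝔱 : Type*} [LieRing 𝔱] [LieAlgebra ℝ 𝔱] [IsLieAbelian 𝔱]
    (e : (soLie ι × 𝔱) ≃ₗ⁅ℝ⁆ GroupLieAlgebra I G) {h : LinearMap.BilinForm ℝ (soLie ι)}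
    (hh : IsScalarProduct h)
    (hinv : AdInvariant (soLie ι) (Matrix.specialOrthogonalGroup ι ℝ) h)
    {k : LinearMap.BilinForm ℝ 𝔱} (hk : IsScalarProduct k)
    {Z : Fin 2 → 𝔱} (hZ : OrthonormalFor k Z) {ε : ℝ} {j : ℝ → 𝔱 →ₗ[ℝ] soLie ι}
    (hj : IsIsospectralFamily (soLie ι) (Matrix.orthogonalGroup ι ℝ) Z ε j) :
    RicciNormVaries I ε fun t => metricOfForm I e
      (deformedForm (formProd h k) (LinearMap.inr ℝ _ 𝔱) Z (LinearMap.inl ℝ _ 𝔱 ∘ₗ j t)) := by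
  obtain ⟨c, hc0, hc⟩ := hh.exists_eq_trace_soLie hι hinv
  have hK : ∀ A ∈ Matrix.orthogonalGroup ι ℝ, star A * A = 1 := fun A hA =>
    (Matrix.mem_orthogonalGroup_iff' ι ℝ).1 hA
  refine ricciNormVaries_prod I e hh hk (soLie_trace_form_inv hc) hZ (soLie_killing hc0 hc)
    (fun s hs t ht i k => by rw [hc, hc, hj.trace_mul_eq hK hs ht]) ?_
  obtain ⟨s, hs, t, ht, hst⟩ := hj.exists_trace_ne hK
  refine ⟨s, hs, t, ht, fun h => hst ?_⟩
  have h5 := trace_shape_sq_sub_soLie (X := fun i => j s (Z i)) (X' := fun i => j t (Z i))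
    (W := 0) (fun i k => by simp) (fun i k => by simp) (fun i k => by simp) (fun i k => by simp)
    (fun i k => hj.trace_mul_eq hK hs ht _ _) (fun i k => by simp)
    (fun i k => hj.trace_quartic_eq hK hs ht _ _) (fun i k p q => by simp)
  rw [h, sub_self] at h5
  have hn : ((Fintype.card ι : ℝ) - 2) / 2 ≠ 0 := by
    have : (5 : ℝ) ≤ Fintype.card ι := by exact_mod_cast hι
    have : (0 : ℝ) < (Fintype.card ι - 2) / 2 := by linarith
    exact this.ne'
  exact sub_eq_zero.1 ((mul_eq_zero.1 h5.symm).resolve_left hn)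

end OrthogonalCriterion

/-! ### Real traces of complex-linear and antilinear maps -/

section RealTrace

variable {V : Type*} [AddCommGroup V] [Module ℂ V] [Module ℝ V] [IsScalarTower ℝ ℂ V]

/-- The real trace of a complex-linear endomorphism. -/
theorem trace_restrictScalars_complex {n : Type*} [Fintype n] [DecidableEq n]
    (b : Module.Basis n ℂ V) (F : V →ₗ[ℂ] V) :
    LinearMap.trace ℝ V (F.restrictScalars ℝ) = 2 * (LinearMap.trace ℂ V F).re := by
  rw [LinearMap.trace_eq_matrix_trace ℝ (Complex.basisOneI.smulTower b),
    LinearMap.trace_eq_matrix_trace ℂ b, Matrix.trace, Matrix.trace, Fintype.sum_prod_type,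
    Fin.sum_univ_two, Complex.re_sum, Finset.mul_sum, ← Finset.sum_add_distrib]
  refine Finset.sum_congr rfl fun i _ => ?_
  simp only [Matrix.diag_apply, LinearMap.toMatrix_apply, Module.Basis.smulTower_repr,
    Module.Basis.smulTower_apply, LinearMap.coe_restrictScalars, map_smul]
  simp
  ring

/-- The real trace of an antilinear endomorphism vanishes. -/
theorem trace_eq_zero_of_antilinear {F : V →ₗ[ℝ] V}
    (hF : ∀ v, F (Complex.I • v) = -(Complex.I • F v)) : LinearMap.trace ℝ V F = 0 := by
  -- Let `m` be multiplication by `i`. Antilinearity gives `F = m F m`, while `m² = -1` gives `F =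
  -- -F m m`; cyclicity of the trace makes these two expressions opposite.
  let m : Module.End ℝ V := (LinearMap.lsmul ℂ V Complex.I).restrictScalars ℝ
  have h1 : (F : Module.End ℝ V) = -(F * m * m) := by
    ext v
    change F v = -F (Complex.I • Complex.I • v)
    rw [smul_smul, Complex.I_mul_I, neg_smul, one_smul, map_neg, neg_neg]
  have h2 : (F : Module.End ℝ V) = m * (F * m) := by
    ext v
    change F v = Complex.I • F (Complex.I • v)
    rw [hF, smul_neg, smul_smul, Complex.I_mul_I, neg_smul, one_smul, neg_neg]
  have h3 : LinearMap.trace ℝ V F = -LinearMap.trace ℝ V F := by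
    conv_lhs => rw [h1, map_neg, LinearMap.trace_mul_comm, ← h2]
  linarith

end RealTrace

/-! ### Traces of products of adjoint operators on `𝔰𝔲` -/

section SpecialUnitary

variable {ι : Type*} [Fintype ι] [DecidableEq ι]

theorem suLie_conjTranspose (X : suLie ι) : (X : Matrix ι ι ℂ)ᴴ = -(X : Matrix ι ι ℂ) :=
  (mem_suLie.1 X.2).1

theorem trace_suLie_coe (X : suLie ι) : (X : Matrix ι ι ℂ).trace = 0 :=
  (mem_suLie.1 X.2).2

/-- The projection of a matrix to the trace-free part of its skew-Hermitian part. -/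
def suPart [Nonempty ι] : Matrix ι ι ℂ →ₗ[ℝ] suLie ι where
  toFun M := ⟨(1 / 2 : ℝ) • (M - Mᴴ) - ((1 / 2 : ℝ) • (M - Mᴴ).trace / Fintype.card ι) • 1, by
    rw [mem_suLie]
    constructor
    · have h : star ((M - Mᴴ).trace) = -(M - Mᴴ).trace := by
        rw [← Matrix.trace_conjTranspose, Matrix.conjTranspose_sub, Matrix.conjTranspose_conjTranspose,
          ← Matrix.trace_neg, neg_sub]
      have h' : star ((1 / 2 : ℝ) • (M - Mᴴ).trace / (Fintype.card ι : ℂ)) =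
          -((1 / 2 : ℝ) • (M - Mᴴ).trace / (Fintype.card ι : ℂ)) := by
        rw [star_div₀, star_smul, h, smul_neg, neg_div, star_trivial, star_natCast]
      rw [Matrix.conjTranspose_sub, Matrix.conjTranspose_smul, Matrix.conjTranspose_smul, h',
        Matrix.conjTranspose_sub, Matrix.conjTranspose_conjTranspose, Matrix.conjTranspose_one]
      simp only [star_trivial]
      module
    · rw [Matrix.trace_sub, Matrix.trace_smul, Matrix.trace_smul, Matrix.trace_one, smul_eq_mul,
        div_mul_cancel₀ _ (Nat.cast_ne_zero.2 Fintype.card_ne_zero), sub_self]⟩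
  map_add' M N := by
    ext1
    change (1 / 2 : ℝ) • (M + N - (M + N)ᴴ)
        - ((1 / 2 : ℝ) • (M + N - (M + N)ᴴ).trace / (Fintype.card ι : ℂ)) • (1 : Matrix ι ι ℂ) =
      ((1 / 2 : ℝ) • (M - Mᴴ) - ((1 / 2 : ℝ) • (M - Mᴴ).trace / (Fintype.card ι : ℂ)) • 1) +
      ((1 / 2 : ℝ) • (N - Nᴴ) - ((1 / 2 : ℝ) • (N - Nᴴ).trace / (Fintype.card ι : ℂ)) • 1)
    have h : M + N - (M + N)ᴴ = (M - Mᴴ) + (N - Nᴴ) := by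
      rw [Matrix.conjTranspose_add]; abel
    rw [h, Matrix.trace_add, smul_add, smul_add, add_div, add_smul]
    abel
  map_smul' c M := by
    ext1
    change (1 / 2 : ℝ) • (c • M - (c • M)ᴴ)
        - ((1 / 2 : ℝ) • (c • M - (c • M)ᴴ).trace / (Fintype.card ι : ℂ)) • (1 : Matrix ι ι ℂ) =
      c • ((1 / 2 : ℝ) • (M - Mᴴ) - ((1 / 2 : ℝ) • (M - Mᴴ).trace / (Fintype.card ι : ℂ)) • 1)
    have h : c • M - (c • M)ᴴ = c • (M - Mᴴ) := by
      rw [Matrix.conjTranspose_smul, smul_sub, star_trivial]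
    rw [h, Matrix.trace_smul]
    generalize M - Mᴴ = N
    rw [smul_sub, smul_comm (1 / 2 : ℝ) c, smul_comm (1 / 2 : ℝ) c, smul_div_assoc c, smul_assoc]

theorem coe_suPart [Nonempty ι] (M : Matrix ι ι ℂ) : (suPart M : Matrix ι ι ℂ) =
    (1 / 2 : ℝ) • (M - Mᴴ) - ((1 / 2 : ℝ) • (M - Mᴴ).trace / Fintype.card ι : ℂ) • 1 := rfl

theorem suPart_coe [Nonempty ι] (X : suLie ι) : suPart (X : Matrix ι ι ℂ) = X := by
  ext1
  rw [coe_suPart, suLie_conjTranspose, sub_neg_eq_add, Matrix.trace_add, trace_suLie_coe]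
  simp only [add_zero, smul_zero, zero_div, zero_smul, sub_zero]
  module

/-- The trace of the restriction to `𝔰𝔲` of a complex-linear endomorphism. -/
theorem trace_suLie [Nonempty ι] {f : Module.End ℝ (suLie ι)} {F : Module.End ℂ (Matrix ι ι ℂ)}
    (h : ∀ X, (f X : Matrix ι ι ℂ) = F X) (h1 : F 1 = 0) :
    LinearMap.trace ℝ _ f = (LinearMap.trace ℂ _ F).re := by
  let i : suLie ι →ₗ[ℝ] Matrix ι ι ℂ := (suLie ι).toSubmodule.subtype
  let F' : Module.End ℝ (Matrix ι ι ℂ) := LinearMap.restrictScalars ℝ F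
  let C : Module.End ℝ (Matrix ι ι ℂ) :=
    { toFun := fun M => Mᴴ
      map_add' := Matrix.conjTranspose_add
      map_smul' := fun c M => by
        rw [Matrix.conjTranspose_smul, star_trivial, RingHom.id_apply] }
  have h2 : f = (suPart : Matrix ι ι ℂ →ₗ[ℝ] suLie ι) ∘ₗ (F' ∘ₗ i) := by
    ext1 X
    change f X = suPart (F X)
    rw [← h, suPart_coe]
  -- The projection to `𝔰𝔲` also subtracts a multiple of `1`, which `F` kills. The part of the
  -- composite involving the conjugate transpose is antilinear, hence has real trace zero.
  have h3 : (F' ∘ₗ i) ∘ₗ (suPart : Matrix ι ι ℂ →ₗ[ℝ] suLie ι) = (1 / 2 : ℝ) • (F' - F' * C) := by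
    ext1 M
    change F ((1 / 2 : ℝ) • (M - Mᴴ) - ((1 / 2 : ℝ) • (M - Mᴴ).trace / Fintype.card ι : ℂ) • 1) =
      (1 / 2 : ℝ) • (F M - F Mᴴ)
    rw [map_sub, map_smul F, h1, smul_zero, sub_zero]
    change F' ((1 / 2 : ℝ) • (M - Mᴴ)) = _
    rw [map_smul, map_sub]
    rfl
  have h4 : LinearMap.trace ℝ _ (F' * C) = 0 := by
    refine trace_eq_zero_of_antilinear fun M => ?_
    change F ((Complex.I • M)ᴴ) = -(Complex.I • F Mᴴ)
    rw [Matrix.conjTranspose_smul, map_smul]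
    simp
  rw [h2, LinearMap.trace_comp_comm', h3, map_smul, map_sub, h4, sub_zero, smul_eq_mul,
    trace_restrictScalars_complex (Matrix.stdBasis ℂ ι ι)]
  ring

theorem trace_mul_im_suLie (A B : suLie ι) : ((A * B : Matrix ι ι ℂ).trace).im = 0 := by
  have h : star ((A * B : Matrix ι ι ℂ).trace) = (A * B : Matrix ι ι ℂ).trace := by
    rw [← Matrix.trace_conjTranspose, Matrix.conjTranspose_mul, suLie_conjTranspose,
      suLie_conjTranspose, neg_mul_neg, Matrix.trace_mul_comm]
  exact Complex.conj_eq_iff_im.1 h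

theorem trace_ad_mul_ad_suLie [Nonempty ι] (A B : suLie ι) :
    LinearMap.trace ℝ _ (LieAlgebra.ad ℝ (suLie ι) A * LieAlgebra.ad ℝ (suLie ι) B) =
      2 * Fintype.card ι * ((A * B : Matrix ι ι ℂ).trace).re := by
  rw [trace_suLie (F := LieAlgebra.ad ℂ (Matrix ι ι ℂ) (A : Matrix ι ι ℂ) *
    LieAlgebra.ad ℂ (Matrix ι ι ℂ) (B : Matrix ι ι ℂ)) (fun X => rfl) (by
      simp [Ring.lie_def])]
  have hA := trace_suLie_coe A
  have hB := trace_suLie_coe B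
  have c1 := Matrix.trace_mul_comm (B : Matrix ι ι ℂ) (A : Matrix ι ι ℂ)
  simp only [ad_eq_sandwich, mul_sub, sub_mul, sandwich_mul_sandwich, map_sub, trace_sandwich,
    mul_one, one_mul, Matrix.trace_one, hA, hB, c1]
  simp
  ring

/-- The trace of a product of four operators of the adjoint representation of `𝔰𝔲`. -/
def suQuartic (A B C D : Matrix ι ι ℂ) : ℝ :=
  2 * Fintype.card ι * ((A * (B * (C * D))).trace).re
    + 2 * (((A * B).trace).re * ((C * D).trace).re
    + ((A * C).trace).re * ((B * D).trace).re + ((A * D).trace).re * ((B * C).trace).re)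

/-- Single traces vanish and traces of pairs are real. The two terms with all four factors on one
side are complex conjugates, because reversing the order is conjugate transposition; this gives `2n`
times a real part. -/
theorem trace_ad_quartic_suLie [Nonempty ι] (A B C D : suLie ι) :
    LinearMap.trace ℝ _ (LieAlgebra.ad ℝ (suLie ι) A * (LieAlgebra.ad ℝ (suLie ι) B *
      (LieAlgebra.ad ℝ (suLie ι) C * LieAlgebra.ad ℝ (suLie ι) D))) =
      suQuartic (A : Matrix ι ι ℂ) B C D := by
  rw [trace_suLie (F := LieAlgebra.ad ℂ (Matrix ι ι ℂ) (A : Matrix ι ι ℂ) *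
    (LieAlgebra.ad ℂ (Matrix ι ι ℂ) (B : Matrix ι ι ℂ) *
    (LieAlgebra.ad ℂ (Matrix ι ι ℂ) (C : Matrix ι ι ℂ) *
    LieAlgebra.ad ℂ (Matrix ι ι ℂ) (D : Matrix ι ι ℂ)))) (fun X => rfl) (by
      simp [Ring.lie_def]), suQuartic]
  have hA := trace_suLie_coe A
  have hB := trace_suLie_coe B
  have hC := trace_suLie_coe C
  have hD := trace_suLie_coe D
  have p1 := Matrix.trace_mul_comm (B : Matrix ι ι ℂ) A
  have p2 := Matrix.trace_mul_comm (C : Matrix ι ι ℂ) A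
  have p3 := Matrix.trace_mul_comm (D : Matrix ι ι ℂ) A
  have p4 := Matrix.trace_mul_comm (C : Matrix ι ι ℂ) B
  have p5 := Matrix.trace_mul_comm (D : Matrix ι ι ℂ) B
  have p6 := Matrix.trace_mul_comm (D : Matrix ι ι ℂ) C
  have i1 := trace_mul_im_suLie A B
  have i2 := trace_mul_im_suLie A C
  have i3 := trace_mul_im_suLie A D
  have rev : ((D * (C * (B * A)) : Matrix ι ι ℂ).trace).re =
      ((A * (B * (C * D)) : Matrix ι ι ℂ).trace).re := by
    have : (D * (C * (B * A)) : Matrix ι ι ℂ).trace =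
        star ((A * (B * (C * D)) : Matrix ι ι ℂ).trace) := by
      rw [← Matrix.trace_conjTranspose]
      simp only [Matrix.conjTranspose_mul, suLie_conjTranspose, Matrix.neg_mul, Matrix.mul_neg,
        neg_neg, mul_assoc]
    rw [this]
    rfl
  simp only [ad_eq_sandwich, mul_sub, sub_mul, sandwich_mul_sandwich, map_sub, trace_sandwich,
    mul_one, one_mul, Matrix.trace_one, hA, hB, hC, hD, mul_assoc, p1, p2, p3, p4, p5, p6,
    mul_zero, zero_mul, sub_zero, Complex.sub_re, Complex.mul_re, i1, i2, i3, rev,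
    Complex.natCast_re, Complex.natCast_im, Complex.zero_re]
  ring

end SpecialUnitary

/-! ### `Ad`-invariant scalar products on `𝔰𝔲(n)` -/

section UnitaryForms

variable {ι : Type*} [Fintype ι] [DecidableEq ι]

/-- The permutation matrices with coefficients `ε`. -/
def weightedPerm (σ : Equiv.Perm ι) (ε : ι → ℂ) : Matrix ι ι ℂ :=
  Matrix.diagonal ε * σ.permMatrix ℂ

theorem weightedPerm_conj (σ : Equiv.Perm ι) (ε : ι → ℂ) (X : Matrix ι ι ℂ) (a b : ι) :
    (weightedPerm σ ε * X * star (weightedPerm σ ε)) a b = ε a * star (ε b) * X (σ a) (σ b) := by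
  have h : ∀ i k, weightedPerm σ ε i k = if σ i = k then ε i else 0 := by
    intro i k
    rw [weightedPerm, Matrix.diagonal_mul, Equiv.Perm.permMatrix, PEquiv.toMatrix_apply]
    simp
  simp only [Matrix.mul_apply, Matrix.star_apply, h]
  simp [apply_ite]
  ring

theorem weightedPerm_conj_diagonal {σ : Equiv.Perm ι} {ε : ι → ℂ} (hε : ∀ i, ε i * star (ε i) = 1)
    (v : ι → ℂ) :
    weightedPerm σ ε * Matrix.diagonal v * star (weightedPerm σ ε) = Matrix.diagonal (v ∘ σ) := by
  ext a b
  rw [weightedPerm_conj, Matrix.diagonal_apply, Matrix.diagonal_apply]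
  by_cases hab : a = b
  · subst hab
    rw [hε, one_mul, if_pos rfl, if_pos rfl]
    rfl
  · simp [hab]

theorem weightedPerm_mem {σ : Equiv.Perm ι} {ε : ι → ℂ} (hε : ∀ i, ε i * star (ε i) = 1)
    (hdet : (∏ i, ε i) * (Equiv.Perm.sign σ : ℤ) = 1) :
    weightedPerm σ ε ∈ Matrix.specialUnitaryGroup ι ℂ := by
  rw [Matrix.mem_specialUnitaryGroup_iff, Matrix.mem_unitaryGroup_iff]
  constructor
  · have := weightedPerm_conj_diagonal (σ := σ) hε 1
    rwa [Matrix.diagonal_one', mul_one] at this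
  · rw [weightedPerm, Matrix.det_mul, Matrix.det_diagonal, Matrix.det_permutation]
    exact_mod_cast hdet

/-- The diagonal matrix with entries `i (v_k - mean)`, as an element of `𝔰𝔲`. -/
def suDiagonal [Nonempty ι] : (ι → ℝ) →ₗ[ℝ] suLie ι :=
  suPart ∘ₗ
    { toFun := fun v => Matrix.diagonal fun i => Complex.I * v i
      map_add' := fun v w => by
        rw [Matrix.diagonal_add]
        congr 1
        ext i
        simp [mul_add]
      map_smul' := fun c v => by
        rw [RingHom.id_apply, ← Matrix.diagonal_smul]
        congr 1
        ext i
        simp [mul_left_comm] }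

theorem coe_suDiagonal [Nonempty ι] (v : ι → ℝ) : (suDiagonal v : Matrix ι ι ℂ) =
    Matrix.diagonal fun i => Complex.I * (v i - (∑ k, v k : ℝ) / Fintype.card ι) := by
  change (suPart (Matrix.diagonal fun i => Complex.I * v i) : Matrix ι ι ℂ) = _
  have h : (Matrix.diagonal fun i => Complex.I * v i : Matrix ι ι ℂ)ᴴ =
      -Matrix.diagonal fun i => Complex.I * v i := by
    rw [Matrix.diagonal_conjTranspose, Matrix.diagonal_neg]
    congr 1
    ext i
    simp
  rw [coe_suPart, h, sub_neg_eq_add, ← two_smul ℝ, smul_smul, Matrix.trace_smul, smul_smul]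
  norm_num
  rw [← Matrix.diagonal_one, ← Matrix.diagonal_smul, Matrix.diagonal_sub]
  congr 1
  ext i
  simp [← Finset.mul_sum]
  ring

variable {B : LinearMap.BilinForm ℝ (suLie ι)}

theorem AdInvariant.suDiagonal_comp [Nonempty ι]
    (hB : AdInvariant (suLie ι) (Matrix.specialUnitaryGroup ι ℂ) B) (σ : Equiv.Perm ι)
    (v w : ι → ℝ) :
    B (suDiagonal (v ∘ σ)) (suDiagonal (w ∘ σ)) = B (suDiagonal v) (suDiagonal w) := by
  obtain ⟨p⟩ := ‹Nonempty ι›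
  have : Nonempty ι := ⟨p⟩
  let ε : ι → ℂ := fun i => if i = p then ((Equiv.Perm.sign σ : ℤ) : ℂ) else 1
  have hs : ((Equiv.Perm.sign σ : ℤ) : ℂ) * ((Equiv.Perm.sign σ : ℤ) : ℂ) = 1 := by
    rcases Int.units_eq_one_or (Equiv.Perm.sign σ) with h | h <;> simp [h]
  have hε : ∀ i, ε i * star (ε i) = 1 := by
    intro i
    simp only [ε]
    split_ifs
    · simpa using hs
    · simp
  have hconj : ∀ v : ι → ℝ, (suDiagonal (v ∘ σ) : Matrix ι ι ℂ) =
      weightedPerm σ ε * (suDiagonal v : Matrix ι ι ℂ) * star (weightedPerm σ ε) := by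
    intro v
    rw [coe_suDiagonal, coe_suDiagonal, weightedPerm_conj_diagonal hε]
    congr 1
    ext i
    simp only [Function.comp_apply, Equiv.sum_comp σ v]
  exact hB _ (weightedPerm_mem hε (by simpa [ε] using hs)) _ _ _ _ (hconj v) (hconj w)

theorem exists_perm_pair {a b c d : ι} (hab : a ≠ b) (hcd : c ≠ d) :
    ∃ σ : Equiv.Perm ι, σ a = c ∧ σ b = d := by
  refine ⟨Equiv.swap (Equiv.swap a c b) d * Equiv.swap a c, ?_, ?_⟩
  · simp only [Equiv.Perm.mul_apply, Equiv.swap_apply_left]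
    refine Equiv.swap_apply_of_ne_of_ne (fun h => hab ?_) hcd
    have := congrArg (Equiv.swap a c) h
    rwa [Equiv.swap_apply_right, Equiv.swap_apply_self] at this
  · simp only [Equiv.Perm.mul_apply, Equiv.swap_apply_left]

/-- Permutation invariance leaves two values, one for equal and one for distinct indices. On vectors
with sum zero the constant part of the matrix drops out and a multiple of the Euclidean norm
remains. -/
theorem AdInvariant.exists_suDiagonal_eq [Nontrivial ι]
    (hB : AdInvariant (suLie ι) (Matrix.specialUnitaryGroup ι ℂ) B) :
    ∃ c : ℝ, ∀ v : ι → ℝ, ∑ i, v i = 0 → B (suDiagonal v) (suDiagonal v) = c * ∑ i, v i ^ 2 := by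
  obtain ⟨p, q, hpq⟩ := exists_pair_ne ι
  let b : ι → ι → ℝ := fun i k =>
    B (suDiagonal (Pi.single i 1)) (suDiagonal (Pi.single k 1))
  have hperm : ∀ (σ : Equiv.Perm ι) i k, b (σ i) (σ k) = b i k := by
    intro σ i k
    have h : ∀ i, (Pi.single (σ i) (1 : ℝ) : ι → ℝ) ∘ σ = Pi.single i 1 := by
      intro i
      ext l
      simp [Pi.single_apply]
    have := hB.suDiagonal_comp σ (Pi.single (σ i) 1) (Pi.single (σ k) 1)
    rw [h, h] at this
    exact this.symm
  have h1 : ∀ i, b i i = b p p := by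
    intro i
    have := hperm (Equiv.swap p i) p p
    rwa [Equiv.swap_apply_left] at this
  have h2 : ∀ i k, i ≠ k → b i k = b p q := by
    intro i k hik
    obtain ⟨σ, hp, hq⟩ := exists_perm_pair hpq hik
    have := hperm σ p q
    rwa [hp, hq] at this
  refine ⟨b p p - b p q, fun v hv => ?_⟩
  have hsum : v = ∑ i, v i • (Pi.single i (1 : ℝ) : ι → ℝ) := by
    ext l
    simp [Pi.single_apply]
  have h3 : B (suDiagonal v) (suDiagonal v) = ∑ i, ∑ k, v i * v k * b i k := by
    conv_lhs => rw [hsum]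
    simp only [map_sum, map_smul, LinearMap.sum_apply, LinearMap.smul_apply, smul_eq_mul,
      Finset.mul_sum, b, mul_assoc]
    rw [Finset.sum_comm]
    exact Finset.sum_congr rfl fun i _ => Finset.sum_congr rfl fun k _ => mul_left_comm _ _ _
  have h4 : ∀ i k, b i k = b p q + if i = k then b p p - b p q else 0 := by
    intro i k
    split_ifs with hik
    · subst hik
      rw [h1]; ring
    · rw [h2 i k hik, add_zero]
  calc B (suDiagonal v) (suDiagonal v)
      = ∑ i, ∑ k, (v i * v k * b p q + if i = k then v i * v k * (b p p - b p q) else 0) := by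
        rw [h3]
        refine Finset.sum_congr rfl fun i _ => Finset.sum_congr rfl fun k _ => ?_
        rw [h4, mul_add, mul_ite, mul_zero]
    _ = (∑ i, v i) * (∑ k, v k) * b p q + ∑ i, v i * v i * (b p p - b p q) := by
        simp only [Finset.sum_add_distrib, Finset.sum_ite_eq, Finset.mem_univ, if_true]
        rw [Finset.sum_mul_sum, Finset.sum_mul]
        simp only [Finset.sum_mul]
    _ = (b p p - b p q) * ∑ i, v i ^ 2 := by
        rw [hv, zero_mul, zero_mul, zero_add, Finset.mul_sum]
        exact Finset.sum_congr rfl fun i _ => by ring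

/-- The elements of `𝔰𝔲` are conjugate to diagonal matrices. -/
theorem suLie_exists_diagonal [Nonempty ι] (X : suLie ι) :
    ∃ A ∈ Matrix.specialUnitaryGroup ι ℂ, ∃ v : ι → ℝ, ∑ i, v i = 0 ∧
      (X : Matrix ι ι ℂ) = A * (suDiagonal v : Matrix ι ι ℂ) * star A := by
  obtain ⟨p⟩ := ‹Nonempty ι›
  have : Nonempty ι := ⟨p⟩
  have hH : ((-Complex.I) • (X : Matrix ι ι ℂ)).IsHermitian := by
    rw [Matrix.IsHermitian, Matrix.conjTranspose_smul, suLie_conjTranspose]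
    simp
  set v := hH.eigenvalues with hv
  set U : Matrix ι ι ℂ := (hH.eigenvectorUnitary : Matrix ι ι ℂ) with hU
  have hU1 : star U * U = 1 := Matrix.UnitaryGroup.star_mul_self _
  have hU2 : U * star U = 1 := mul_eq_one_comm.1 hU1
  have hspec : (-Complex.I) • (X : Matrix ι ι ℂ) =
      U * Matrix.diagonal (fun i => (v i : ℂ)) * star U := by
    have := hH.spectral_theorem
    rw [Unitary.conjStarAlgAut_apply] at this
    exact this
  have hX : (X : Matrix ι ι ℂ) = U * Matrix.diagonal (fun i => Complex.I * v i) * star U := by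
    have h1 : (Matrix.diagonal fun i => Complex.I * (v i : ℂ)) =
        Complex.I • Matrix.diagonal (fun i => (v i : ℂ)) := by
      rw [← Matrix.diagonal_smul]
      rfl
    rw [h1, Matrix.mul_smul, Matrix.smul_mul, ← hspec, smul_smul]
    simp
  have hsum : ∑ i, v i = 0 := by
    have h1 := trace_suLie_coe X
    rw [hX, Matrix.trace_mul_comm, ← mul_assoc, hU1, one_mul, Matrix.trace_diagonal,
      ← Finset.mul_sum] at h1
    have h2 := (mul_eq_zero.1 h1).resolve_left Complex.I_ne_zero
    exact_mod_cast h2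
  have hdet : U.det * star U.det = 1 := by
    have := congrArg Matrix.det hU2
    rwa [Matrix.det_mul, Matrix.star_eq_conjTranspose, Matrix.det_conjTranspose,
      Matrix.det_one] at this
  -- The unitary matrix from the spectral theorem has some determinant of modulus one; a diagonal
  -- factor with its conjugate at one place brings it into `SU` and commutes with the diagonal
  -- matrix.
  let ε : ι → ℂ := fun i => if i = p then star U.det else 1
  have hε : ∀ i, ε i * star (ε i) = 1 := by
    intro i
    simp only [ε]
    split_ifs
    · rw [star_star, mul_comm]; exact hdet
    · simp
  have hD := fun w => weightedPerm_conj_diagonal (σ := 1) hε w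
  have hDu : weightedPerm 1 ε * star (weightedPerm 1 ε) = 1 := by
    have := hD 1
    rwa [Matrix.diagonal_one', mul_one] at this
  refine ⟨U * weightedPerm 1 ε, ?_, v, hsum, ?_⟩
  · rw [Matrix.mem_specialUnitaryGroup_iff, Matrix.mem_unitaryGroup_iff]
    constructor
    · rw [star_mul, mul_assoc, ← mul_assoc _ (star _) (star U), hDu, one_mul, hU2]
    · rw [Matrix.det_mul, weightedPerm, Matrix.det_mul, Matrix.det_diagonal, Matrix.det_permutation]
      simpa [ε] using hdet
  · rw [coe_suDiagonal, hsum]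
    have e : U * weightedPerm 1 ε * (Matrix.diagonal fun i => Complex.I * (v i - (0 : ℝ) / Fintype.card ι))
        * star (U * weightedPerm 1 ε) = U * (weightedPerm 1 ε *
          (Matrix.diagonal fun i => Complex.I * (v i - (0 : ℝ) / Fintype.card ι)) *
          star (weightedPerm 1 ε)) * star U := by
      rw [star_mul]
      simp only [mul_assoc]
    rw [e, hD, hX]
    simp

/-- The `Ad`-invariant scalar products on `𝔰𝔲` are the multiples of the trace form. -/
theorem IsScalarProduct.exists_eq_trace_suLie [Nontrivial ι] (hs : IsScalarProduct B)
    (hB : AdInvariant (suLie ι) (Matrix.specialUnitaryGroup ι ℂ) B) :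
    ∃ c : ℝ, c ≠ 0 ∧ ∀ X Y : suLie ι, B X Y = -c * ((X * Y : Matrix ι ι ℂ).trace).re := by
  obtain ⟨c, hc⟩ := hB.exists_suDiagonal_eq
  -- It suffices to know the quadratic form, and conjugation reduces it to diagonal matrices.
  -- Polarization follows at the end.
  have hq : ∀ X : suLie ι, B X X = -c * ((X * X : Matrix ι ι ℂ).trace).re := by
    intro X
    obtain ⟨A, hA, v, hv, hX⟩ := suLie_exists_diagonal X
    rw [hB A hA _ _ _ _ hX hX, hc v hv]
    have hA1 : star A * A = 1 := Matrix.mem_unitaryGroup_iff'.1 hA.1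
    have h1 : (X * X : Matrix ι ι ℂ).trace =
        ((suDiagonal v : Matrix ι ι ℂ) * (suDiagonal v : Matrix ι ι ℂ)).trace := by
      rw [hX, Matrix.trace_mul_comm]
      have : A * (suDiagonal v : Matrix ι ι ℂ) * star A * (A * (suDiagonal v : Matrix ι ι ℂ) * star A) =
          A * ((suDiagonal v : Matrix ι ι ℂ) * (suDiagonal v : Matrix ι ι ℂ) * star A) := by
        simp only [mul_assoc]
        rw [← mul_assoc (star A) A, hA1, one_mul]
      rw [this, Matrix.trace_mul_comm, mul_assoc, hA1, mul_one]
    rw [h1, coe_suDiagonal, hv, Matrix.diagonal_mul_diagonal, Matrix.trace_diagonal, Complex.re_sum,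
      Finset.mul_sum, Finset.mul_sum]
    refine Finset.sum_congr rfl fun i _ => ?_
    simp [pow_two]
  refine ⟨c, ?_, fun X Y => ?_⟩
  · rintro rfl
    obtain ⟨p, q, hpq⟩ := exists_pair_ne ι
    have hne : (suDiagonal (Pi.single p 1) : suLie ι) ≠ 0 := by
      intro h
      have h1 := congrArg (fun X : suLie ι => (X : Matrix ι ι ℂ) p p - (X : Matrix ι ι ℂ) q q) h
      simp [coe_suDiagonal, Pi.single_apply, hpq.symm] at h1
      rw [← mul_add, sub_add_cancel, mul_one] at h1
      exact Complex.I_ne_zero h1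
    have := hs.2 _ hne
    rw [hq] at this
    simp at this
  · have h1 := hq (X + Y)
    have h2 : (((X + Y : suLie ι) * (X + Y : suLie ι) : Matrix ι ι ℂ).trace) =
        (X * X : Matrix ι ι ℂ).trace + 2 * (X * Y : Matrix ι ι ℂ).trace
          + (Y * Y : Matrix ι ι ℂ).trace := by
      change ((X + Y : Matrix ι ι ℂ) * (X + Y)).trace = _
      rw [add_mul, mul_add, mul_add, Matrix.trace_add, Matrix.trace_add, Matrix.trace_add,
        Matrix.trace_mul_comm (Y : Matrix ι ι ℂ) X]
      ring
    rw [h2, map_add, map_add, LinearMap.add_apply, LinearMap.add_apply, hq X, hq Y, hs.1 Y X] at h1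
    simp only [Complex.add_re, Complex.mul_re, Complex.re_ofNat, Complex.im_ofNat, zero_mul,
      sub_zero] at h1
    linarith

end UnitaryForms

/-! ### Variation of `tr S²` on `𝔰𝔲(n)` and the unitary cases -/

section UnitaryCriterion

variable {ι : Type*} [Fintype ι] [DecidableEq ι]

/-- The quartic `ad`-trace contains no alternating trace `tr(XYXY)` here, so `2n tr(X₀²X₁²)`,
counted twice with factor `1/4`, gives the coefficient `n`. The terms with `W` vanish along with the
products `X W`. -/
theorem trace_shape_sq_sub_suLie [Nonempty ι] {X X' W : Fin 2 → suLie ι}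
    (hXW : ∀ i k, (X i * W k : Matrix ι ι ℂ) = 0) (hXW' : ∀ i k, (X' i * W k : Matrix ι ι ℂ) = 0)
    (h2 : ∀ i k, (X i * X k : Matrix ι ι ℂ).trace = (X' i * X' k : Matrix ι ι ℂ).trace)
    (h4 : ∀ i, (X i * (X i * (X i * X i)) : Matrix ι ι ℂ).trace =
      (X' i * (X' i * (X' i * X' i)) : Matrix ι ι ℂ).trace) :
    LinearMap.trace ℝ _ (IsDeformation.shape W X * IsDeformation.shape W X) -
      LinearMap.trace ℝ _ (IsDeformation.shape W X' * IsDeformation.shape W X') =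
    Fintype.card ι * ((X 0 * (X 0 * (X 1 * X 1)) : Matrix ι ι ℂ).trace.re -
      (X' 0 * (X' 0 * (X' 1 * X' 1)) : Matrix ι ι ℂ).trace.re) := by
  have c : ∀ Y : Fin 2 → suLie ι, (Y 1 * (Y 1 * (Y 0 * Y 0)) : Matrix ι ι ℂ).trace =
      (Y 0 * (Y 0 * (Y 1 * Y 1)) : Matrix ι ι ℂ).trace := by
    intro Y
    rw [← mul_assoc, Matrix.trace_mul_comm, mul_assoc]
  simp only [trace_shape_mul_shape, trace_ad_quartic_suLie, suQuartic, hXW, hXW', h2, h4,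
    Fin.sum_univ_two, c, mul_zero, Matrix.trace_zero, Complex.zero_re]
  ring

theorem suLie_trace_form_inv {g : LinearMap.BilinForm ℝ (suLie ι)} {c : ℝ}
    (hc : ∀ X Y : suLie ι, g X Y = -c * (X * Y : Matrix ι ι ℂ).trace.re) (x y z : suLie ι) :
    g ⁅x, y⁆ z = g x ⁅y, z⁆ := by
  rw [hc, hc]
  change -c * ((x * y - y * x : Matrix ι ι ℂ) * z).trace.re =
    -c * (x * (y * z - z * y) : Matrix ι ι ℂ).trace.re
  have : (y * (x * z) : Matrix ι ι ℂ).trace = (x * (z * y) : Matrix ι ι ℂ).trace := by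
    rw [Matrix.trace_mul_comm, mul_assoc]
  rw [sub_mul, mul_sub, Matrix.trace_sub, Matrix.trace_sub, mul_assoc, mul_assoc, this]

theorem suLie_killing [Nonempty ι] {g : LinearMap.BilinForm ℝ (suLie ι)} {c : ℝ} (hc0 : c ≠ 0)
    (hc : ∀ X Y : suLie ι, g X Y = -c * (X * Y : Matrix ι ι ℂ).trace.re) (x y : suLie ι) :
    LinearMap.trace ℝ _ (LieAlgebra.ad ℝ (suLie ι) x * LieAlgebra.ad ℝ (suLie ι) y) =
      -(2 * Fintype.card ι / c * g x y) := by
  rw [trace_ad_mul_ad_suLie, hc]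
  field_simp

/-- The `ad`-traces only see real parts, whereas nonconstancy is known for complex numbers; this
closes the gap. -/
theorem trace_pairs_im_suLie (X Y : suLie ι) : (X * (X * (Y * Y)) : Matrix ι ι ℂ).trace.im = 0 := by
  have h : star ((X * (X * (Y * Y)) : Matrix ι ι ℂ).trace) =
      (X * (X * (Y * Y)) : Matrix ι ι ℂ).trace := by
    rw [← Matrix.trace_conjTranspose]
    simp only [Matrix.conjTranspose_mul, suLie_conjTranspose, Matrix.neg_mul, Matrix.mul_neg, neg_neg]
    rw [mul_assoc, mul_assoc, ← mul_assoc, Matrix.trace_mul_comm, mul_assoc]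
  exact Complex.conj_eq_iff_im.1 h

theorem specialUnitaryGroup_star_mul_self :
    ∀ A ∈ Matrix.specialUnitaryGroup ι ℂ, star A * A = 1 := fun _ hA =>
  Matrix.mem_unitaryGroup_iff'.1 hA.1

theorem IsIsospectralFamily.exists_trace_re_ne {V : Type*} [AddCommGroup V] [Module ℝ V]
    {Z : Fin 2 → V} {ε : ℝ} {j : ℝ → V →ₗ[ℝ] suLie ι}
    (h : IsIsospectralFamily (suLie ι) (Matrix.specialUnitaryGroup ι ℂ) Z ε j) :
    ∃ s ∈ Set.Ioo (-ε) ε, ∃ t ∈ Set.Ioo (-ε) ε,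
      (j s (Z 0) * (j s (Z 0) * (j s (Z 1) * j s (Z 1))) : Matrix ι ι ℂ).trace.re ≠
      (j t (Z 0) * (j t (Z 0) * (j t (Z 1) * j t (Z 1))) : Matrix ι ι ℂ).trace.re := by
  obtain ⟨s, hs, t, ht, hst⟩ := h.exists_trace_ne specialUnitaryGroup_star_mul_self
  refine ⟨s, hs, t, ht, fun hre => hst (Complex.ext hre ?_)⟩
  rw [trace_pairs_im_suLie, trace_pairs_im_suLie]

theorem IsIsospectralFamily.trace_fourth_eq {V : Type*} [AddCommGroup V] [Module ℝ V]
    {Z : Fin 2 → V} {ε : ℝ} {j : ℝ → V →ₗ[ℝ] suLie ι}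
    (h : IsIsospectralFamily (suLie ι) (Matrix.specialUnitaryGroup ι ℂ) Z ε j)
    {s t : ℝ} (hs : s ∈ Set.Ioo (-ε) ε) (ht : t ∈ Set.Ioo (-ε) ε) (z : V) :
    (j s z * (j s z * (j s z * j s z)) : Matrix ι ι ℂ).trace =
      (j t z * (j t z * (j t z * j t z)) : Matrix ι ι ℂ).trace := by
  have := h.trace_pow_eq specialUnitaryGroup_star_mul_self hs ht z 4
  simpa only [pow_succ, pow_zero, one_mul, mul_assoc] using this

variable {E : Type*} [NormedAddCommGroup E] [NormedSpace ℝ E] [FiniteDimensional ℝ E]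
  [CompleteSpace E] {H : Type*} [TopologicalSpace H] (I : ModelWithCorners ℝ E H) [I.Boundaryless]
  {G : Type*} [TopologicalSpace G] [ChartedSpace H G] [Group G] [LieGroup I ∞ G]

/-- The case of `SU(m) × T²`. -/
theorem ricciNormVaries_suLie_prod [Nontrivial ι]
    {𝔱 : Type*} [LieRing 𝔱] [LieAlgebra ℝ 𝔱] [IsLieAbelian 𝔱]
    (e : (suLie ι × 𝔱) ≃ₗ⁅ℝ⁆ GroupLieAlgebra I G) {h : LinearMap.BilinForm ℝ (suLie ι)}
    (hh : IsScalarProduct h)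
    (hinv : AdInvariant (suLie ι) (Matrix.specialUnitaryGroup ι ℂ) h)
    {k : LinearMap.BilinForm ℝ 𝔱} (hk : IsScalarProduct k)
    {Z : Fin 2 → 𝔱} (hZ : OrthonormalFor k Z) {ε : ℝ} {j : ℝ → 𝔱 →ₗ[ℝ] suLie ι}
    (hj : IsIsospectralFamily (suLie ι) (Matrix.specialUnitaryGroup ι ℂ) Z ε j) :
    RicciNormVaries I ε fun t => metricOfForm I e
      (deformedForm (formProd h k) (LinearMap.inr ℝ _ 𝔱) Z (LinearMap.inl ℝ _ 𝔱 ∘ₗ j t)) := by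
  obtain ⟨c, hc0, hc⟩ := hh.exists_eq_trace_suLie hinv
  have hK := specialUnitaryGroup_star_mul_self (ι := ι)
  refine ricciNormVaries_prod I e hh hk (suLie_trace_form_inv hc) hZ (suLie_killing hc0 hc)
    (fun s hs t ht i k => by rw [hc, hc, hj.trace_mul_eq hK hs ht]) ?_
  obtain ⟨s, hs, t, ht, hst⟩ := hj.exists_trace_re_ne
  refine ⟨s, hs, t, ht, fun h => hst ?_⟩
  have h5 := trace_shape_sq_sub_suLie (X := fun i => j s (Z i)) (X' := fun i => j t (Z i))
    (W := 0) (fun i k => by simp) (fun i k => by simp)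
    (fun i k => hj.trace_mul_eq hK hs ht _ _) (fun i => hj.trace_fourth_eq hs ht _)
  rw [h, sub_self] at h5
  exact sub_eq_zero.1 ((mul_eq_zero.1 h5.symm).resolve_left
    (Nat.cast_ne_zero.2 Fintype.card_ne_zero))

theorem trace_fromBlocks_eq {κ R : Type*} [Fintype κ] [AddCommMonoid R] (A : Matrix ι ι R)
    (B : Matrix ι κ R) (C : Matrix κ ι R) (D : Matrix κ κ R) :
    (Matrix.fromBlocks A B C D).trace = A.trace + D.trace := by
  simp [Matrix.trace, Fintype.sum_sum_type]

theorem coe_suUpper {κ : Type*} [Fintype κ] [DecidableEq κ] (X : suLie ι) :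
    (suUpper ι κ X : Matrix (ι ⊕ κ) (ι ⊕ κ) ℂ) = Matrix.fromBlocks X 0 0 0 := rfl

theorem coe_suLowerOf {κ : Type*} [Fintype κ] [DecidableEq κ] (𝔥 : LieSubalgebra ℝ (suLie κ))
    (Y : 𝔥) : (suLowerOf ι 𝔥 Y : Matrix (ι ⊕ κ) (ι ⊕ κ) ℂ) =
      Matrix.fromBlocks 0 0 0 ((Y : suLie κ) : Matrix κ κ ℂ) := rfl

/-- The case of `SU(m + k)`, with `𝔥` an abelian subalgebra of `𝔰𝔲(k)`. -/
theorem ricciNormVaries_suLie_block [Nontrivial ι] {κ : Type*} [Fintype κ] [DecidableEq κ]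
    (e : suLie (ι ⊕ κ) ≃ₗ⁅ℝ⁆ GroupLieAlgebra I G)
    {g : LinearMap.BilinForm ℝ (suLie (ι ⊕ κ))} (hg : IsScalarProduct g)
    (hinv : AdInvariant (suLie (ι ⊕ κ)) (Matrix.specialUnitaryGroup (ι ⊕ κ) ℂ) g)
    (𝔥 : LieSubalgebra ℝ (suLie κ)) [IsLieAbelian 𝔥]
    {Z : Fin 2 → 𝔥} (hZ : OrthonormalFor (g.comp (suLowerOf ι 𝔥) (suLowerOf ι 𝔥)) Z)
    {ε : ℝ} {j : ℝ → 𝔥 →ₗ[ℝ] suLie ι}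
    (hj : IsIsospectralFamily (suLie ι) (Matrix.specialUnitaryGroup ι ℂ) Z ε j) :
    RicciNormVaries I ε fun t => metricOfForm I e
      (deformedForm g (suLowerOf ι 𝔥) Z (suUpper ι κ ∘ₗ j t)) := by
  have : Nontrivial (ι ⊕ κ) := Sum.inl_injective.nontrivial
  obtain ⟨c, hc0, hc⟩ := hg.exists_eq_trace_suLie hinv
  have hK := specialUnitaryGroup_star_mul_self (ι := ι)
  have hJZ : ∀ t i k, ((suUpper ι κ ∘ₗ j t) (Z i) * suLowerOf ι 𝔥 (Z k) :
      Matrix (ι ⊕ κ) (ι ⊕ κ) ℂ) = 0 := by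
    intro t i k
    simp [coe_suUpper, coe_suLowerOf, Matrix.fromBlocks_multiply]
  have hZJ : ∀ t i k, (suLowerOf ι 𝔥 (Z k) * (suUpper ι κ ∘ₗ j t) (Z i) :
      Matrix (ι ⊕ κ) (ι ⊕ κ) ℂ) = 0 := by
    intro t i k
    simp [coe_suUpper, coe_suLowerOf, Matrix.fromBlocks_multiply]
  have hJJ : ∀ t i k, ((suUpper ι κ ∘ₗ j t) (Z i) * (suUpper ι κ ∘ₗ j t) (Z k) :
      Matrix (ι ⊕ κ) (ι ⊕ κ) ℂ).trace = (j t (Z i) * j t (Z k) : Matrix ι ι ℂ).trace := by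
    intro t i k
    simp [coe_suUpper, Matrix.fromBlocks_multiply, trace_fromBlocks_eq]
  have hJJJJ : ∀ t i k, ((suUpper ι κ ∘ₗ j t) (Z i) * ((suUpper ι κ ∘ₗ j t) (Z i) *
      ((suUpper ι κ ∘ₗ j t) (Z k) * (suUpper ι κ ∘ₗ j t) (Z k))) :
      Matrix (ι ⊕ κ) (ι ⊕ κ) ℂ).trace =
      (j t (Z i) * (j t (Z i) * (j t (Z k) * j t (Z k))) : Matrix ι ι ℂ).trace := by
    intro t i k
    simp [coe_suUpper, Matrix.fromBlocks_multiply, trace_fromBlocks_eq]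
  have hlie : ∀ x y : suLie (ι ⊕ κ), (x * y : Matrix (ι ⊕ κ) (ι ⊕ κ) ℂ) = y * x → ⁅x, y⁆ = 0 := by
    intro x y h
    ext1
    change (x * y - y * x : Matrix (ι ⊕ κ) (ι ⊕ κ) ℂ) = 0
    rw [h, sub_self]
  have hZZ : ∀ i k, (suLowerOf ι 𝔥 (Z i) * suLowerOf ι 𝔥 (Z k) : Matrix (ι ⊕ κ) (ι ⊕ κ) ℂ) =
      suLowerOf ι 𝔥 (Z k) * suLowerOf ι 𝔥 (Z i) := by
    intro i k
    have h0 : ⁅Z i, Z k⁆ = 0 := trivial_lie_zero 𝔥 𝔥 _ _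
    have h1 := congrArg (fun x : 𝔥 => ((x : suLie κ) : Matrix κ κ ℂ)) h0
    have h2 : (((Z i : suLie κ) : Matrix κ κ ℂ) * ((Z k : suLie κ) : Matrix κ κ ℂ)) =
        ((Z k : suLie κ) : Matrix κ κ ℂ) * ((Z i : suLie κ) : Matrix κ κ ℂ) := sub_eq_zero.1 h1
    simp [coe_suLowerOf, Matrix.fromBlocks_multiply, h2]
  refine ricciNormVaries_of_killing I e
    (fun t _ => ⟨hg, suLie_trace_form_inv hc, fun i k => hlie _ _ (hZZ i k),
      fun i k => hlie _ _ ((hJZ t i k).trans (hZJ t i k).symm),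
      fun i k => by rw [hc, hJZ]; simp, hZ⟩)
    (suLie_killing hc0 hc)
    (fun s hs t ht i k => by
      rw [hc, hc, hJJ, hJJ,
        hj.trace_mul_eq hK hs ht]) ?_
  obtain ⟨s, hs, t, ht, hst⟩ := hj.exists_trace_re_ne
  refine ⟨s, hs, t, ht, fun h => hst ?_⟩
  have h5 := trace_shape_sq_sub_suLie (X := fun i => (suUpper ι κ ∘ₗ j s) (Z i))
    (X' := fun i => (suUpper ι κ ∘ₗ j t) (Z i))
    (W := fun i => suLowerOf ι 𝔥 (Z i)) (hJZ s) (hJZ t)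
    (fun i k => by
      rw [hJJ, hJJ, hj.trace_mul_eq hK hs ht])
    (fun i => by
      rw [hJJJJ, hJJJJ, hj.trace_fourth_eq hs ht])
  rw [h, sub_self, hJJJJ, hJJJJ] at h5
  exact sub_eq_zero.1 ((mul_eq_zero.1 h5.symm).resolve_left
    (Nat.cast_ne_zero.2 Fintype.card_ne_zero))

end UnitaryCriterion

/-! ### Block embeddings into `𝔰𝔬(n)` and the torus with complex structure -/

section BlockDiagonal

variable {ι κ : Type*} [Fintype ι] [DecidableEq ι] [Fintype κ] [DecidableEq κ]
  {E : Type*} [NormedAddCommGroup E] [NormedSpace ℝ E] [FiniteDimensional ℝ E]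
  [CompleteSpace E] {H : Type*} [TopologicalSpace H] (I : ModelWithCorners ℝ E H) [I.Boundaryless]
  {G : Type*} [TopologicalSpace G] [ChartedSpace H G] [Group G] [LieGroup I ∞ G]

theorem coe_soUpper (X : soLie ι) :
    (soUpper ι κ X : Matrix (ι ⊕ κ) (ι ⊕ κ) ℝ) = Matrix.fromBlocks X 0 0 0 := rfl

theorem coe_soLower (Y : soLie κ) :
    (soLower ι κ Y : Matrix (ι ⊕ κ) (ι ⊕ κ) ℝ) = Matrix.fromBlocks 0 0 0 Y := rfl

theorem coe_soLowerOf (𝔥 : LieSubalgebra ℝ (soLie κ)) (Y : 𝔥) :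
    (soLowerOf ι 𝔥 Y : Matrix (ι ⊕ κ) (ι ⊕ κ) ℝ) =
      Matrix.fromBlocks 0 0 0 ((Y : soLie κ) : Matrix κ κ ℝ) := rfl

/-- The case of `SO(m + k)`, with `𝔥` an abelian subalgebra of `𝔰𝔬(k)`. -/
theorem ricciNormVaries_soLie_block (hcard : 5 ≤ Fintype.card (ι ⊕ κ))
    (e : soLie (ι ⊕ κ) ≃ₗ⁅ℝ⁆ GroupLieAlgebra I G)
    {g : LinearMap.BilinForm ℝ (soLie (ι ⊕ κ))} (hg : IsScalarProduct g)
    (hinv : AdInvariant (soLie (ι ⊕ κ)) (Matrix.specialOrthogonalGroup (ι ⊕ κ) ℝ) g)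
    (𝔥 : LieSubalgebra ℝ (soLie κ)) [IsLieAbelian 𝔥]
    {Z : Fin 2 → 𝔥} (hZ : OrthonormalFor (g.comp (soLowerOf ι 𝔥) (soLowerOf ι 𝔥)) Z)
    {ε : ℝ} {j : ℝ → 𝔥 →ₗ[ℝ] soLie ι}
    (hj : IsIsospectralFamily (soLie ι) (Matrix.orthogonalGroup ι ℝ) Z ε j) :
    RicciNormVaries I ε fun t => metricOfForm I e
      (deformedForm g (soLowerOf ι 𝔥) Z (soUpper ι κ ∘ₗ j t)) := by
  have hK : ∀ A ∈ Matrix.orthogonalGroup ι ℝ, star A * A = 1 := fun A hA =>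
    (Matrix.mem_orthogonalGroup_iff' ι ℝ).1 hA
  refine ricciNormVaries_soLie I hcard e hg hinv hZ ?_ ?_ ?_ ?_ ?_ ?_ ?_ ?_
  · intro i k
    have h0 : ⁅Z i, Z k⁆ = 0 := trivial_lie_zero 𝔥 𝔥 _ _
    have h1 := congrArg (fun x : 𝔥 => ((x : soLie κ) : Matrix κ κ ℝ)) h0
    have h2 : (((Z i : soLie κ) : Matrix κ κ ℝ) * ((Z k : soLie κ) : Matrix κ κ ℝ)) =
        ((Z k : soLie κ) : Matrix κ κ ℝ) * ((Z i : soLie κ) : Matrix κ κ ℝ) := sub_eq_zero.1 h1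
    simp [coe_soLowerOf, Matrix.fromBlocks_multiply, h2]
  · intro t i k
    simp [coe_soUpper, coe_soLowerOf, Matrix.fromBlocks_multiply]
  · intro t i k
    simp [coe_soUpper, coe_soLowerOf, Matrix.fromBlocks_multiply]
  · intro s hs t ht i k
    simpa [coe_soUpper, Matrix.fromBlocks_multiply, trace_fromBlocks_eq] using
      hj.trace_mul_eq hK hs ht (Z i) (Z k)
  · intro s hs t ht i k
    simp [coe_soUpper, coe_soLowerOf, Matrix.fromBlocks_multiply]
  · intro s hs t ht i k
    simpa [coe_soUpper, Matrix.fromBlocks_multiply, trace_fromBlocks_eq] using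
      hj.trace_quartic_eq hK hs ht (Z i) (Z k)
  · intro s hs t ht i k p q
    simp [coe_soUpper, coe_soLowerOf, Matrix.fromBlocks_multiply]
  · simpa [coe_soUpper, Matrix.fromBlocks_multiply, trace_fromBlocks_eq] using
      hj.exists_trace_ne hK

/-- The real `2n × 2n` matrix of a complex `n × n` matrix. -/
def realMatrix (M : Matrix ι ι ℂ) : Matrix (ι ⊕ ι) (ι ⊕ ι) ℝ :=
  Matrix.fromBlocks (M.map Complex.re) (-M.map Complex.im) (M.map Complex.im) (M.map Complex.re)

theorem realMatrix_mul (M N : Matrix ι ι ℂ) :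
    realMatrix M * realMatrix N = realMatrix (M * N) := by
  have hre : (M * N).map Complex.re =
      M.map Complex.re * N.map Complex.re - M.map Complex.im * N.map Complex.im := by
    ext a b
    simp [Matrix.mul_apply, Finset.sum_sub_distrib]
  have him : (M * N).map Complex.im =
      M.map Complex.re * N.map Complex.im + M.map Complex.im * N.map Complex.re := by
    ext a b
    simp [Matrix.mul_apply, Finset.sum_add_distrib]
  rw [realMatrix, realMatrix, realMatrix, Matrix.fromBlocks_multiply, hre, him]
  congr 1
  · simp [sub_eq_add_neg]
  · simp only [Matrix.mul_neg, Matrix.neg_mul, neg_add]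
  · abel
  · simp only [Matrix.mul_neg]
    abel

theorem trace_realMatrix (M : Matrix ι ι ℂ) : (realMatrix M).trace = 2 * M.trace.re := by
  rw [realMatrix, trace_fromBlocks_eq, Matrix.trace, Matrix.trace, Complex.re_sum]
  simp [two_mul]

theorem coe_complexStructure :
    (complexStructure ι : Matrix (ι ⊕ ι) (ι ⊕ ι) ℝ) = realMatrix (Complex.I • 1) := by
  change Matrix.fromBlocks 0 (-1) 1 0 = _
  rw [realMatrix]
  congr 1 <;> ext a b <;> by_cases hab : a = b <;> simp [hab, Matrix.one_apply]

/-- On the upper block every element of the torus is the realification of an imaginary scalar, so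
traces against realified matrices reduce to complex traces in `𝔰𝔲(m)`. -/
theorem torusJ_coe {z : soLie ((ι ⊕ ι) ⊕ Fin 2)} (hz : z ∈ torusJ ι) :
    ∃ (a : ℝ) (S : soLie (Fin 2)), (z : Matrix ((ι ⊕ ι) ⊕ Fin 2) ((ι ⊕ ι) ⊕ Fin 2) ℝ) =
      Matrix.fromBlocks (a • realMatrix (Complex.I • 1)) 0 0 (S : Matrix (Fin 2) (Fin 2) ℝ) := by
  obtain ⟨x, hx, y, ⟨S, rfl⟩, rfl⟩ := Submodule.mem_sup.1 hz
  obtain ⟨a, rfl⟩ := Submodule.mem_span_singleton.1 hx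
  refine ⟨a, S, ?_⟩
  change a • (soUpper (ι ⊕ ι) (Fin 2) (complexStructure ι) :
    Matrix ((ι ⊕ ι) ⊕ Fin 2) ((ι ⊕ ι) ⊕ Fin 2) ℝ) + (soLower (ι ⊕ ι) (Fin 2) S :
    Matrix ((ι ⊕ ι) ⊕ Fin 2) ((ι ⊕ ι) ⊕ Fin 2) ℝ) = _
  rw [coe_soUpper, coe_soLower, coe_complexStructure, Matrix.fromBlocks_smul, Matrix.fromBlocks_add]
  simp

theorem soLie_fin_two_comm (S T : soLie (Fin 2)) :
    (S * T : Matrix (Fin 2) (Fin 2) ℝ) = T * S := by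
  have h : ∀ S : soLie (Fin 2), (S : Matrix (Fin 2) (Fin 2) ℝ) = !![0, S.1 0 1; -S.1 0 1, 0] := by
    intro S
    have hS : ∀ i k, (S : Matrix (Fin 2) (Fin 2) ℝ) k i = -(S : Matrix (Fin 2) (Fin 2) ℝ) i k :=
      fun i k => congrFun (congrFun (soLie_transpose S) i) k
    have h00 := hS 0 0
    have h11 := hS 1 1
    ext i k
    fin_cases i <;> fin_cases k
    · simp; linarith
    · simp
    · simpa using hS 0 1
    · simp; linarith
  rw [h S, h T]
  ext i k
  fin_cases i <;> fin_cases k <;> simp [mul_comm]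

/-- The case of `SO(2m + 2)`, with the torus given by the complex structure and `SO(2)`. -/
theorem ricciNormVaries_soLie_complex (hcard : 5 ≤ Fintype.card ((ι ⊕ ι) ⊕ Fin 2))
    (e : soLie ((ι ⊕ ι) ⊕ Fin 2) ≃ₗ⁅ℝ⁆ GroupLieAlgebra I G)
    {g : LinearMap.BilinForm ℝ (soLie ((ι ⊕ ι) ⊕ Fin 2))} (hg : IsScalarProduct g)
    (hinv : AdInvariant (soLie ((ι ⊕ ι) ⊕ Fin 2))
      (Matrix.specialOrthogonalGroup ((ι ⊕ ι) ⊕ Fin 2) ℝ) g)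
    {Z : Fin 2 → torusJ ι} (hZ : OrthonormalFor (g.comp (torusJ ι).subtype (torusJ ι).subtype) Z)
    {ε : ℝ} {j : ℝ → torusJ ι →ₗ[ℝ] suLie ι}
    (hj : IsIsospectralFamily (suLie ι) (Matrix.specialUnitaryGroup ι ℂ) Z ε j) :
    RicciNormVaries I ε fun t => metricOfForm I e
      (deformedForm g (torusJ ι).subtype Z
        (soUpper (ι ⊕ ι) (Fin 2) ∘ₗ realify ι ∘ₗ j t)) := by
  have hK := specialUnitaryGroup_star_mul_self (ι := ι)
  choose a S hWa using fun i => torusJ_coe (Z i).2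
  have hW : ∀ i, ((torusJ ι).subtype (Z i) : Matrix ((ι ⊕ ι) ⊕ Fin 2) ((ι ⊕ ι) ⊕ Fin 2) ℝ) =
    Matrix.fromBlocks (a i • realMatrix (Complex.I • 1)) 0 0 (S i) := hWa
  have hJ : ∀ t i, ((soUpper (ι ⊕ ι) (Fin 2) ∘ₗ realify ι ∘ₗ j t) (Z i) :
      Matrix ((ι ⊕ ι) ⊕ Fin 2) ((ι ⊕ ι) ⊕ Fin 2) ℝ) =
      Matrix.fromBlocks (realMatrix (j t (Z i))) 0 0 0 := fun t i => rfl
  refine ricciNormVaries_soLie I hcard e hg hinv hZ ?_ ?_ ?_ ?_ ?_ ?_ ?_ ?_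
  · intro i k
    simp only [hW, Matrix.fromBlocks_multiply, Matrix.smul_mul, Matrix.mul_smul, smul_smul,
      soLie_fin_two_comm (S i), mul_comm (a i)]
    simp
  · intro t i k
    simp only [hW, hJ]
    simp [Matrix.fromBlocks_multiply, realMatrix_mul]
  · intro t i k
    simp only [hW, hJ]
    simp [Matrix.fromBlocks_multiply, realMatrix_mul, trace_fromBlocks_eq, trace_realMatrix,
      trace_suLie_coe]
  · intro s hs t ht i k
    simp only [hJ]
    simp [Matrix.fromBlocks_multiply, realMatrix_mul, trace_fromBlocks_eq, trace_realMatrix,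
      hj.trace_mul_eq hK hs ht (Z i) (Z k)]
  · intro s hs t ht i k
    -- The complex structure acts as multiplication by `i`, so this term is a real multiple of the
    -- imaginary part of `tr(j_u² j_v)`, which the cubic polarization fixes.
    have h := hj.trace_cubic_eq hK hs ht (Z i) (Z k)
    simp only [hW, hJ]
    simp [Matrix.fromBlocks_multiply, realMatrix_mul, trace_fromBlocks_eq, trace_realMatrix,
      h]
  · intro s hs t ht i k
    have h := congrArg Complex.re (hj.trace_quartic_eq hK hs ht (Z i) (Z k))
    simp only [hJ]
    simp [Matrix.fromBlocks_multiply, realMatrix_mul, trace_fromBlocks_eq,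
      trace_realMatrix] at h ⊢
    linarith
  · intro s hs t ht i k p q
    -- On the upper block the product of two torus elements is a real scalar, so only quadratic
    -- traces of `j` occur.
    simp only [hW, hJ]
    simp [Matrix.fromBlocks_multiply, realMatrix_mul, trace_fromBlocks_eq, trace_realMatrix,
      hj.trace_mul_eq hK hs ht (Z i) (Z k)]
  · simp only [hJ]
    simpa [Matrix.fromBlocks_multiply, realMatrix_mul, trace_fromBlocks_eq,
      trace_realMatrix] using hj.exists_trace_re_ne

end BlockDiagonal

end

theorem proposition3p15
    {E : Type*} [NormedAddCommGroup E] [NormedSpace ℝ E] [FiniteDimensional ℝ E] [CompleteSpace E]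
    {H : Type*} [TopologicalSpace H] (I : ModelWithCorners ℝ E H) [I.Boundaryless]
    {G : Type*} [TopologicalSpace G] [ChartedSpace H G] [Group G] [LieGroup I ∞ G] :
    -- `G = SO(m) × T²` or `Spin(m) × T²`, `m ≥ 5`; `𝔱` is the Lie algebra of `T²`
    (∀ m : ℕ, 5 ≤ m →
      ∀ (𝔱 : Type*) [LieRing 𝔱] [LieAlgebra ℝ 𝔱] [IsLieAbelian 𝔱],
      ∀ e : (soLie (Fin m) × 𝔱) ≃ₗ⁅ℝ⁆ GroupLieAlgebra I G,
      ∀ h : LinearMap.BilinForm ℝ (soLie (Fin m)), IsScalarProduct h →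
        AdInvariant (soLie (Fin m)) (Matrix.specialOrthogonalGroup (Fin m) ℝ) h →
      ∀ k : LinearMap.BilinForm ℝ 𝔱, IsScalarProduct k →
      ∀ Z : Module.Basis (Fin 2) ℝ 𝔱, OrthonormalFor k Z →
      ∀ (ε : ℝ) (j : ℝ → 𝔱 →ₗ[ℝ] soLie (Fin m)),
        IsIsospectralFamily (soLie (Fin m)) (Matrix.orthogonalGroup (Fin m) ℝ) Z ε j →
        RicciNormVaries I ε fun t => metricOfForm I e
          (deformedForm (formProd h k) (LinearMap.inr ℝ _ 𝔱) Z (LinearMap.inl ℝ _ 𝔱 ∘ₗ j t))) ∧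
    -- `G = SU(m) × T²`, `m ≥ 3`
    (∀ m : ℕ, 3 ≤ m →
      ∀ (𝔱 : Type*) [LieRing 𝔱] [LieAlgebra ℝ 𝔱] [IsLieAbelian 𝔱],
      ∀ e : (suLie (Fin m) × 𝔱) ≃ₗ⁅ℝ⁆ GroupLieAlgebra I G,
      ∀ h : LinearMap.BilinForm ℝ (suLie (Fin m)), IsScalarProduct h →
        AdInvariant (suLie (Fin m)) (Matrix.specialUnitaryGroup (Fin m) ℂ) h →
      ∀ k : LinearMap.BilinForm ℝ 𝔱, IsScalarProduct k →
      ∀ Z : Module.Basis (Fin 2) ℝ 𝔱, OrthonormalFor k Z →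
      ∀ (ε : ℝ) (j : ℝ → 𝔱 →ₗ[ℝ] suLie (Fin m)),
        IsIsospectralFamily (suLie (Fin m)) (Matrix.specialUnitaryGroup (Fin m) ℂ) Z ε j →
        RicciNormVaries I ε fun t => metricOfForm I e
          (deformedForm (formProd h k) (LinearMap.inr ℝ _ 𝔱) Z (LinearMap.inl ℝ _ 𝔱 ∘ₗ j t))) ∧
    -- `G = SO(m + 4)` or `Spin(m + 4)`, `m ≥ 5`; `𝔥` is the Lie algebra of a maximal torus of `SO(4)`
    (∀ m : ℕ, 5 ≤ m →
      ∀ e : soLie (Fin m ⊕ Fin 4) ≃ₗ⁅ℝ⁆ GroupLieAlgebra I G,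
      ∀ g₀ : LinearMap.BilinForm ℝ (soLie (Fin m ⊕ Fin 4)), IsScalarProduct g₀ →
        AdInvariant (soLie (Fin m ⊕ Fin 4))
          (Matrix.specialOrthogonalGroup (Fin m ⊕ Fin 4) ℝ) g₀ →
      ∀ 𝔥 : LieSubalgebra ℝ (soLie (Fin 4)), IsMaximalAbelian 𝔥 →
      ∀ Z : Module.Basis (Fin 2) ℝ 𝔥,
        OrthonormalFor (g₀.comp (soLowerOf (Fin m) 𝔥) (soLowerOf (Fin m) 𝔥)) Z →
      ∀ (ε : ℝ) (j : ℝ → 𝔥 →ₗ[ℝ] soLie (Fin m)),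
        IsIsospectralFamily (soLie (Fin m)) (Matrix.orthogonalGroup (Fin m) ℝ) Z ε j →
        RicciNormVaries I ε fun t => metricOfForm I e
          (deformedForm g₀ (soLowerOf (Fin m) 𝔥) Z (soUpper (Fin m) (Fin 4) ∘ₗ j t))) ∧
    -- `G = SU(m + 3)`, `m ≥ 3`; `𝔥` is the Lie algebra of a maximal torus of `SU(3)`
    (∀ m : ℕ, 3 ≤ m →
      ∀ e : suLie (Fin m ⊕ Fin 3) ≃ₗ⁅ℝ⁆ GroupLieAlgebra I G,
      ∀ g₀ : LinearMap.BilinForm ℝ (suLie (Fin m ⊕ Fin 3)), IsScalarProduct g₀ →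
        AdInvariant (suLie (Fin m ⊕ Fin 3))
          (Matrix.specialUnitaryGroup (Fin m ⊕ Fin 3) ℂ) g₀ →
      ∀ 𝔥 : LieSubalgebra ℝ (suLie (Fin 3)), IsMaximalAbelian 𝔥 →
      ∀ Z : Module.Basis (Fin 2) ℝ 𝔥,
        OrthonormalFor (g₀.comp (suLowerOf (Fin m) 𝔥) (suLowerOf (Fin m) 𝔥)) Z →
      ∀ (ε : ℝ) (j : ℝ → 𝔥 →ₗ[ℝ] suLie (Fin m)),
        IsIsospectralFamily (suLie (Fin m)) (Matrix.specialUnitaryGroup (Fin m) ℂ) Z ε j →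
        RicciNormVaries I ε fun t => metricOfForm I e
          (deformedForm g₀ (suLowerOf (Fin m) 𝔥) Z (suUpper (Fin m) (Fin 3) ∘ₗ j t))) ∧
    -- `G = SO(2m + 2)` or `Spin(2m + 2)`, `m ≥ 3`; the torus is `exp(ℝ J) × SO(2)`
    (∀ m : ℕ, 3 ≤ m →
      ∀ e : soLie ((Fin m ⊕ Fin m) ⊕ Fin 2) ≃ₗ⁅ℝ⁆ GroupLieAlgebra I G,
      ∀ g₀ : LinearMap.BilinForm ℝ (soLie ((Fin m ⊕ Fin m) ⊕ Fin 2)), IsScalarProduct g₀ →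
        AdInvariant (soLie ((Fin m ⊕ Fin m) ⊕ Fin 2))
          (Matrix.specialOrthogonalGroup ((Fin m ⊕ Fin m) ⊕ Fin 2) ℝ) g₀ →
      ∀ Z : Module.Basis (Fin 2) ℝ (torusJ (Fin m)),
        OrthonormalFor (g₀.comp (torusJ (Fin m)).subtype (torusJ (Fin m)).subtype) Z →
      ∀ (ε : ℝ) (j : ℝ → torusJ (Fin m) →ₗ[ℝ] suLie (Fin m)),
        IsIsospectralFamily (suLie (Fin m)) (Matrix.specialUnitaryGroup (Fin m) ℂ) Z ε j →
        RicciNormVaries I ε fun t => metricOfForm I e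
          (deformedForm g₀ (torusJ (Fin m)).subtype Z
            (soUpper (Fin m ⊕ Fin m) (Fin 2) ∘ₗ realify (Fin m) ∘ₗ j t))) := by
  refine ⟨?_, ?_, ?_, ?_, ?_⟩
  · intro m hm 𝔱 _ _ _ e h hh hinv k hk Z hZ ε j hj
    exact ricciNormVaries_soLie_prod I (by simpa using hm) e hh hinv hk hZ hj
  · intro m hm 𝔱 _ _ _ e h hh hinv k hk Z hZ ε j hj
    have : Nontrivial (Fin m) := Fin.nontrivial_iff_two_le.2 (by omega)
    exact ricciNormVaries_suLie_prod I e hh hinv hk hZ hj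
  · intro m hm e g hg hinv 𝔥 h𝔥 Z hZ ε j hj
    have : IsLieAbelian 𝔥 := h𝔥.prop
    exact ricciNormVaries_soLie_block I (by simp; omega) e hg hinv 𝔥 hZ hj
  · intro m hm e g hg hinv 𝔥 h𝔥 Z hZ ε j hj
    have : Nontrivial (Fin m) := Fin.nontrivial_iff_two_le.2 (by omega)
    have : IsLieAbelian 𝔥 := h𝔥.prop
    exact ricciNormVaries_suLie_block I e hg hinv 𝔥 hZ hj
  · intro m hm e g hg hinv Z hZ ε j hj
    exact ricciNormVaries_soLie_complex I (by simp; omega) e hg hinv hZ hj
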